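/- Let $d\ge 1$ and let $(\Omega,\mathcal F,\mathbb P)$ be a probability space with a measurable flow $(\theta_x)_{x\in\mathbb R^d}$ (that is, $(\omega,x)\mapsto\theta_x\omega$ is measurable, $\theta_0=\mathrm{id}$, $\theta_x\circ\theta_y=\theta_{x+y}$) such that $\mathbb P$ is invariant under every $\theta_x$. A random measure on $\mathbb R^d$ is a kernel $\xi$ from $\Omega$ to $\mathbb R^d$ that is a.s. finite on all compact sets; it is stationary if a.s. $\xi(\theta_x\omega,C-x)=\xi(\omega,C)$ for all $x\in\mathbb R^d$ and all Borel $C\subset\mathbb R^d$; it is diffuse if a.s. it has no atoms; its intensity is $\lambda_\xi=\mathbb E\,\xi([0,1]^d)$. An allocation is a measurable map $\tau:\Omega\times\mathbb R^d\to\mathbb R^d\cup\{\infty\}$ such that a.s. $\tau(\theta_y\omega,x-y)=\tau(\omega,x)-y$ for all $x,y\in\mathbb R^d$ (with $\infty-y=\infty$). It balances $\xi$ and $\eta$ if a.s. $\xi(\{s:\tau(s)=\infty\})=0$ and $\xi(\{s:\tau(s)\in C\})=\eta(C)$ for all Borel $C\subset\mathbb R^d$. Let $\xi$ and $\eta$ be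 stationary random measures on $\mathbb R^d$ that are jointly ergodic, i.e. the distribution of $(\xi,\eta)$ takes only the values $0$ and $1$ on translation-invariant measurable sets. Let $\xi$ be diffuse and $0<\lambda_\xi=\lambda_\eta<\infty$. Let $c\in(0,\infty)$. Consider extensions of the probability space that support a stationary Poisson process of intensity $c$ independent of $(\xi,\eta)$: a probability space $(\Omega',\mathcal F',\mathbb P')$ with a measurable flow $(\theta'_x)$ preserving $\mathbb P'$, a measurable map $\pi:\Omega'\to\Omega$ with $\mathbb P'\circ\pi^{-1}=\mathbb P$ and $\pi\circ\theta'_x=\theta_x\circ\pi$ for all $x$, and a Poisson process $\chi$ on $\mathbb R^d$ of intensity $c$, defined on $\Omega'$, stationary with respect to $\theta'$ and independent of $(\xi\circ\pi,\eta\circ\pi)$. Then such an extension exists, and on every such extension there exists an allocation (with respect to $\theta'$ and $\mathbb P'$) balancing $\xi\circ\pi$ and $\eta\circ\pi$. -/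

import Mathlib

open MeasureTheory ProbabilityTheory
open scoped ENNReal NNReal

namespace DiffuseTransport

/-- The Euclidean space `ℝ^d`; its `volume` is Lebesgue measure. -/
abbrev Rd (d : ℕ) : Type := EuclideanSpace ℝ (Fin d)

/-- The Borel `σ`-field of `ℝ^d ∪ {∞}` (the one-point compactification). It is generated by the
Borel sets of `ℝ^d` and `{∞}`. -/
instance instMeasurableSpaceOnePoint (d : ℕ) : MeasurableSpace (OnePoint (Rd d)) := borel _

instance instBorelSpaceOnePoint (d : ℕ) : BorelSpace (OnePoint (Rd d)) := ⟨rfl⟩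

/-- A measurable flow `(θ_x)`, `x ∈ ℝ^d`, on a measurable space `Ω`. -/
structure MeasurableFlow (d : ℕ) (Ω : Type*) [MeasurableSpace Ω] where
  /-- the map `θ_x : Ω → Ω` -/
  shift : Rd d → Ω → Ω
  measurable_shift : Measurable fun p : Ω × Rd d => shift p.2 p.1
  shift_zero : ∀ ω, shift 0 ω = ω
  shift_shift : ∀ x y ω, shift x (shift y ω) = shift (x + y) ω

/-- The measure `P` is stationary under the flow: `P ∘ θ_x = P` for all `x`. -/
def MeasurableFlow.Preserves {d : ℕ} {Ω : Type*} [MeasurableSpace Ω]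
    (θ : MeasurableFlow d Ω) (P : Measure Ω) : Prop :=
  ∀ x, MeasurePreserving (θ.shift x) P P

/-- A random measure on `ℝ^d`: a kernel from `Ω` to `ℝ^d` that is almost surely finite on all
compact sets. (Measurability of `ξ : Ω → Measure (ℝ^d)` is that of all `ω ↦ ξ ω C`, `C` Borel.) -/
structure IsRandomMeasure {d : ℕ} {Ω : Type*} [MeasurableSpace Ω]
    (P : Measure Ω) (ξ : Ω → Measure (Rd d)) : Prop where
  measurable : Measurable ξ
  finite_on_compacts : ∀ᵐ ω ∂P, ∀ K : Set (Rd d), IsCompact K → ξ ω K < ∞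

/-- A point process on `ℝ^d`: a random measure with values in `ℕ` on compact sets. -/
structure IsPointProcess {d : ℕ} {Ω : Type*} [MeasurableSpace Ω]
    (P : Measure Ω) (χ : Ω → Measure (Rd d)) : Prop extends IsRandomMeasure P χ where
  nat_on_compacts : ∀ᵐ ω ∂P, ∀ K : Set (Rd d), IsCompact K → ∃ n : ℕ, χ ω K = n

/-- A random measure is stationary (adapted to the flow) if, almost surely,
`ξ(θ_x ω, C - x) = ξ(ω, C)` for all `x` and all Borel sets `C`.
Here `C - x` is written as the preimage of `C` under `y ↦ y + x`. -/
def IsStationaryRM {d : ℕ} {Ω : Type*} [MeasurableSpace Ω]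
    (θ : MeasurableFlow d Ω) (P : Measure Ω) (ξ : Ω → Measure (Rd d)) : Prop :=
  ∀ᵐ ω ∂P, ∀ (x : Rd d) (C : Set (Rd d)), MeasurableSet C →
    ξ (θ.shift x ω) ((fun y => y + x) ⁻¹' C) = ξ ω C

/-- The shift of a measure on `ℝ^d`: `translate x μ = μ(x + ·)`. -/
noncomputable def translate {d : ℕ} (x : Rd d) (μ : Measure (Rd d)) : Measure (Rd d) :=
  μ.map (fun y => y - x)

/-- Joint ergodicity of `ξ` and `η`: the distribution of `(ξ, η)` takes only the values `0` and `1`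
on translation-invariant measurable sets of pairs of measures. -/
def JointlyErgodic {d : ℕ} {Ω : Type*} [MeasurableSpace Ω]
    (P : Measure Ω) (ξ η : Ω → Measure (Rd d)) : Prop :=
  ∀ B : Set (Measure (Rd d) × Measure (Rd d)), MeasurableSet B →
    (∀ (x : Rd d) (μ ν : Measure (Rd d)), (translate x μ, translate x ν) ∈ B ↔ (μ, ν) ∈ B) →
    P {ω | (ξ ω, η ω) ∈ B} = 0 ∨ P {ω | (ξ ω, η ω) ∈ B} = 1

/-- The intensity `E ξ([0,1]^d)`. -/
noncomputable def intensity {d : ℕ} {Ω : Type*} [MeasurableSpace Ω]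
    (P : Measure Ω) (ξ : Ω → Measure (Rd d)) : ℝ≥0∞ :=
  ∫⁻ ω, ξ ω {x | ∀ i, x i ∈ Set.Icc (0 : ℝ) 1} ∂P

/-- A random measure is diffuse if almost surely it has no atoms. -/
def IsDiffuse {d : ℕ} {Ω : Type*} [MeasurableSpace Ω]
    (P : Measure Ω) (ξ : Ω → Measure (Rd d)) : Prop :=
  ∀ᵐ ω ∂P, ∀ x : Rd d, ξ ω {x} = 0

/-- `χ` is a Poisson process on `ℝ^d` with intensity `c`: a point process such that `χ(B)` is
Poisson distributed with mean `c * vol(B)` whenever `vol(B) < ∞`, and such that the values on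
finitely many pairwise disjoint such sets are independent. -/
structure IsPoissonProcess {d : ℕ} {Ω : Type*} [MeasurableSpace Ω]
    (P : Measure Ω) (c : ℝ≥0) (χ : Ω → Measure (Rd d)) : Prop extends IsPointProcess P χ where
  law : ∀ B : Set (Rd d), MeasurableSet B → volume B < ∞ →
    P.map (fun ω => χ ω B) =
      (poissonMeasure (c * (volume B).toNNReal)).map (fun n : ℕ => (n : ℝ≥0∞))
  indep : ∀ (n : ℕ) (B : Fin n → Set (Rd d)), (∀ i, MeasurableSet (B i)) →
    (∀ i, volume (B i) < ∞) → Pairwise (fun i j => Disjoint (B i) (B j)) →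
    iIndepFun (fun i ω => χ ω (B i)) P

/-- An allocation: a measurable map `τ : Ω × ℝ^d → ℝ^d ∪ {∞}` that is equivariant, i.e. almost
surely `τ(θ_y ω, x - y) = τ(ω, x) - y` for all `x, y` (with `∞ - y = ∞`). -/
structure IsAllocation {d : ℕ} {Ω : Type*} [MeasurableSpace Ω]
    (θ : MeasurableFlow d Ω) (P : Measure Ω) (τ : Ω × Rd d → OnePoint (Rd d)) : Prop where
  measurable : Measurable τ
  equivariant : ∀ᵐ ω ∂P, ∀ x y : Rd d,
    τ (θ.shift y ω, x - y) = OnePoint.map (fun z => z - y) (τ (ω, x))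

/-- `τ` balances `ξ` and `η`: almost surely `ξ` puts no mass on `{τ = ∞}`, and the image of `ξ`
under `τ` is `η`. -/
structure Balances {d : ℕ} {Ω : Type*} [MeasurableSpace Ω]
    (P : Measure Ω) (τ : Ω × Rd d → OnePoint (Rd d)) (ξ η : Ω → Measure (Rd d)) : Prop where
  no_mass_at_infty : ∀ᵐ ω ∂P, ξ ω {s | τ (ω, s) = OnePoint.infty} = 0
  image_eq : ∀ᵐ ω ∂P, ∀ C : Set (Rd d), MeasurableSet C →
    ξ ω {s | τ (ω, s) ∈ (fun z : Rd d => (z : OnePoint (Rd d))) '' C} = η ω C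

/-- `(Ω', P', θ')` is, through the projection `π : Ω' → Ω`, an extension of the stationary
probability space `(Ω, P, θ)` carrying a stationary Poisson process `χ` of intensity `c` that is
independent of `(ξ, η)`. The random measures `ξ, η` live on `Ω'` as `ξ ∘ π, η ∘ π`. -/
structure IsPoissonExtension {d : ℕ} {Ω Ω' : Type*} [MeasurableSpace Ω] [MeasurableSpace Ω']
    (θ : MeasurableFlow d Ω) (P : Measure Ω) (ξ η : Ω → Measure (Rd d)) (c : ℝ≥0)
    (θ' : MeasurableFlow d Ω') (P' : Measure Ω') (π : Ω' → Ω) (χ : Ω' → Measure (Rd d)) :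
    Prop where
  isProbabilityMeasure : IsProbabilityMeasure P'
  preserves : θ'.Preserves P'
  projection : MeasurePreserving π P' P
  projection_shift : ∀ x ω', π (θ'.shift x ω') = θ.shift x (π ω')
  poisson : IsPoissonProcess P' c χ
  stationary : IsStationaryRM θ' P' χ
  indep : IndepFun χ (fun ω' => (ξ (π ω'), η (π ω'))) P'

end DiffuseTransport

open DiffuseTransport

universe u v

/-! The Poisson process serves to cut space into cells in an equivariant way. For every radius there
is almost surely a place where `χ` charges a small ball and nothing else in a much larger concentric
ball (`IsPoissonProcess.ae_exists_isolated`, by Borel–Cantelli). The barycentre of such an isolated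
cluster is an equivariant label, and the balls of radius `R` around all these labels, displaced by a
fixed vector `v`, are disjoint bounded cells. Letting `R` run through integers and `v` through a
dense sequence gives countably many cell systems such that every ball around the origin lies in a
cell of one of them (`exists_cellSystems`).

Inside a cell, a Borel isomorphism of `ℝ^d` with the line, recentred at the label, reduces transport
to dimension one. Quantile transport sends the diffuse source into the target and leaves mass over
on one side at most. Applying it to the first system, then to the leftovers in the second, and so
on, gives a partial allocation whose image stays below `η`, and in each cell of each system either
all `ξ`-mass is allocated or all of `η` is covered (`exists_partialAllocation_of_cellSystems`). As
the cells contain arbitrarily large balls, almost surely `ξ` is allocated everywhere or `η` is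
covered everywhere.

The mass transport principle (`lintegral_image_eq`) says that on every flow-invariant event the
image has the intensity of the allocated part of `ξ`. If `ξ` and `η` have equal finite intensities
on all invariant events, then exhausting one measure exhausts the other
(`exists_balancing_partialAllocation`). An invariant event may also depend on `χ`; but by
independence and stationarity of `χ`, its conditional probability given `(ξ, η)` is an invariant
function of the pair, hence constant by joint ergodicity. Restricting to the event thus multiplies
both intensities by the same constant (`setLIntegral_randomTriple`), and ergodicity of `χ` is not
needed.

The construction is carried out on the space of triples of locally finite measures, where
equivariance holds everywhere and not just almost surely, and is then pulled back to the extension.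
For the existence of an extension, independent Poisson samples on bounded shells are superposed
(`exists_poisson_law`). Joint characteristic functions give the Poisson property and translation
invariance, and a product space supplies independence. -/

namespace DiffuseTransport

/-! ### Locally finite measures, kernels and translations -/

section Preliminaries

section Kernels

variable {α β : Type*} [MeasurableSpace α] [MeasurableSpace β]

/-- A kernel whose values are finite measures is s-finite. -/
theorem isSFiniteKernel_of_isFiniteMeasure (κ : Kernel α β) (h : ∀ a, κ a Set.univ < ∞) :
    IsSFiniteKernel κ := by
  have hm : ∀ n : ℕ, MeasurableSet {a | ⌊(κ a Set.univ).toReal⌋₊ = n} := fun n =>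
    (Nat.measurable_floor.comp (κ.measurable_coe MeasurableSet.univ).ennreal_toReal)
      (measurableSet_singleton n)
  -- Cut the parameter space by the integer part of the total mass; each piece is then uniformly
  -- bounded.
  have : κ = Kernel.sum fun n : ℕ => Kernel.piecewise (hm n) κ 0 := by
    ext a s hs
    rw [Kernel.sum_apply' _ _ hs, tsum_eq_single ⌊(κ a Set.univ).toReal⌋₊]
    · simp [Kernel.piecewise_apply]
    · intro n hn
      simp [Kernel.piecewise_apply, Ne.symm hn]
  rw [this]
  have hfin : ∀ n : ℕ, IsFiniteKernel (Kernel.piecewise (hm n) κ 0) := fun n => by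
    refine ⟨⟨(n : ℝ≥0∞) + 1, by simp, fun a => ?_⟩⟩
    rw [Kernel.piecewise_apply]
    split_ifs with ha
    · have h1 := Nat.lt_floor_add_one (κ a Set.univ).toReal
      rw [Set.mem_ofPred_eq] at ha
      rw [ha] at h1
      rw [← ENNReal.ofReal_toReal (h a).ne]
      refine (ENNReal.ofReal_le_ofReal h1.le).trans ?_
      rw [ENNReal.ofReal_add (by positivity) (by positivity)]
      simp
    · simp
  exact Kernel.isSFiniteKernel_sum

end Kernels

variable {d : ℕ}

/-- A partition of `ℝ^d` into countably many bounded Borel sets. -/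
noncomputable def shell (d : ℕ) (n : ℕ) : Set (Rd d) :=
  {x | ⌊‖x‖⌋₊ = n}

theorem measurableSet_shell (n : ℕ) : MeasurableSet (shell d n) :=
  (Nat.measurable_floor.comp measurable_norm) (measurableSet_singleton n)

theorem pairwise_disjoint_shell : Pairwise (Function.onFun Disjoint (shell d)) := by
  intro m n hmn
  refine Set.disjoint_left.2 fun x hx hx' => hmn ?_
  exact hx.symm.trans hx'

theorem iUnion_shell : ⋃ n, shell d n = Set.univ :=
  Set.eq_univ_of_forall fun _ => Set.mem_iUnion.2 ⟨_, rfl⟩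

theorem shell_subset_closedBall (n : ℕ) : shell d n ⊆ Metric.closedBall 0 (n + 1) := by
  intro x hx
  have h1 := Nat.lt_floor_add_one ‖x‖
  have hx' : ⌊‖x‖⌋₊ = n := hx
  rw [hx'] at h1
  simpa using h1.le

theorem measure_shell_lt_top (μ : Measure (Rd d)) [IsLocallyFiniteMeasure μ] (n : ℕ) :
    μ (shell d n) < ∞ :=
  (Metric.isBounded_closedBall.subset (shell_subset_closedBall n)).measure_lt_top

theorem sum_restrict_shell (μ : Measure (Rd d)) :
    Measure.sum (fun n => μ.restrict (shell d n)) = μ := by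
  rw [← Measure.restrict_iUnion pairwise_disjoint_shell measurableSet_shell, iUnion_shell,
    Measure.restrict_univ]

theorem isLocallyFiniteMeasure_of_forall_closedBall {μ : Measure (Rd d)}
    (h : ∀ n : ℕ, μ (Metric.closedBall 0 n) < ∞) : IsLocallyFiniteMeasure μ := by
  refine ⟨fun x => ?_⟩
  obtain ⟨n, hn⟩ := exists_nat_gt ‖x‖
  exact ⟨Metric.closedBall 0 n, Metric.closedBall_mem_nhds_of_mem (by simpa using hn), h n⟩

section

variable {Ω : Type*} [MeasurableSpace Ω]

theorem isSFiniteKernel_of_isLocallyFinite (κ : Kernel Ω (Rd d))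
    (h : ∀ ω, IsLocallyFiniteMeasure (κ ω)) : IsSFiniteKernel κ := by
  have : κ = Kernel.sum fun n => κ.restrict (measurableSet_shell n) := by
    ext1 ω
    rw [Kernel.sum_apply]
    simp only [Kernel.restrict_apply]
    exact (sum_restrict_shell _).symm
  rw [this]
  have hn : ∀ n, IsSFiniteKernel (κ.restrict (measurableSet_shell n)) := fun n => by
    refine isSFiniteKernel_of_isFiniteMeasure _ fun ω => ?_
    rw [Kernel.restrict_apply, Measure.restrict_apply_univ]
    have := h ω
    exact measure_shell_lt_top _ n
  exact Kernel.isSFiniteKernel_sum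

/-- Subtraction of kernels. -/
theorem exists_kernel_add_eq (μ ν : Kernel Ω (Rd d)) (h : ∀ ω, IsLocallyFiniteMeasure (μ ω))
    (hle : ∀ ω, ν ω ≤ μ ω) : ∃ ρ : Kernel Ω (Rd d), ∀ ω, ν ω + ρ ω = μ ω := by
  have hfin : ∀ ω n, IsFiniteMeasure ((ν ω).restrict (shell d n)) := fun ω n => by
    refine ⟨?_⟩
    have := h ω
    rw [Measure.restrict_apply_univ]
    exact (hle ω _).trans_lt (measure_shell_lt_top _ n)
  have happ : ∀ ω n {s : Set (Rd d)}, MeasurableSet s →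
      ((μ ω).restrict (shell d n) - (ν ω).restrict (shell d n)) s
        = μ ω (s ∩ shell d n) - ν ω (s ∩ shell d n) := fun ω n s hs => by
    have := hfin ω n
    rw [Measure.sub_apply hs (Measure.restrict_mono le_rfl (hle ω)), Measure.restrict_apply hs,
      Measure.restrict_apply hs]
  let ρ : ℕ → Kernel Ω (Rd d) := fun n =>
    ⟨fun ω => (μ ω).restrict (shell d n) - (ν ω).restrict (shell d n), by
      refine Measure.measurable_of_measurable_coe _ fun s hs => ?_
      simp only [happ _ _ hs]
      exact (μ.measurable_coe (hs.inter (measurableSet_shell n))).sub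
        (ν.measurable_coe (hs.inter (measurableSet_shell n)))⟩
  refine ⟨Kernel.sum ρ, fun ω => ?_⟩
  have h1 : ∀ n, ρ n ω + (ν ω).restrict (shell d n) = (μ ω).restrict (shell d n) := fun n => by
    have := hfin ω n
    exact Measure.sub_add_cancel_of_le (Measure.restrict_mono le_rfl (hle ω))
  rw [Kernel.sum_apply, add_comm]
  conv_lhs => rw [← sum_restrict_shell (ν ω)]
  rw [Measure.sum_add_sum]
  simp only [h1]
  exact sum_restrict_shell _

end

/-- Cancellation is legitimate on each bounded shell, where `ν` is finite. It transfers equivariance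
to a difference of equivariant kernels. -/
theorem measure_add_left_cancel {ν ρ ρ' : Measure (Rd d)} [IsLocallyFiniteMeasure ν]
    (h : ν + ρ = ν + ρ') : ρ = ρ' := by
  rw [← sum_restrict_shell ρ, ← sum_restrict_shell ρ']
  congr 1
  ext n s hs
  rw [Measure.restrict_apply hs, Measure.restrict_apply hs]
  have h1 : ν (s ∩ shell d n) + ρ (s ∩ shell d n) = ν (s ∩ shell d n) + ρ' (s ∩ shell d n) := by
    rw [← Measure.add_apply, h, Measure.add_apply]
  refine (ENNReal.add_right_inj ?_).1 h1
  exact ((measure_mono Set.inter_subset_right).trans_lt (measure_shell_lt_top ν n)).ne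

section Translate

theorem measurable_sub_right (x : Rd d) : Measurable fun y : Rd d => y - x :=
  measurable_id.sub_const x

theorem translate_apply (x : Rd d) (μ : Measure (Rd d)) {s : Set (Rd d)} (hs : MeasurableSet s) :
    translate x μ s = μ ((fun y => y - x) ⁻¹' s) :=
  Measure.map_apply (measurable_sub_right x) hs

theorem translate_translate (x y : Rd d) (μ : Measure (Rd d)) :
    translate x (translate y μ) = translate (x + y) μ := by
  unfold translate
  rw [Measure.map_map (measurable_sub_right x) (measurable_sub_right y)]
  congr 1
  funext z
  simp only [Function.comp_apply]
  abel

theorem translate_zero (μ : Measure (Rd d)) : translate 0 μ = μ := by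
  simp [translate]

theorem translate_add (x : Rd d) (μ ν : Measure (Rd d)) :
    translate x (μ + ν) = translate x μ + translate x ν :=
  Measure.map_add _ _ (measurable_sub_right x)

theorem measurableEmbedding_sub_right (x : Rd d) :
    MeasurableEmbedding fun y : Rd d => y - x := by
  simpa [sub_eq_add_neg] using (MeasurableEquiv.addRight (-x)).measurableEmbedding

theorem translate_apply_of_any (x : Rd d) (μ : Measure (Rd d)) (s : Set (Rd d)) :
    translate x μ s = μ ((fun y => y - x) ⁻¹' s) :=
  (measurableEmbedding_sub_right x).map_apply _ _

theorem preimage_sub_ball (x y : Rd d) (r : ℝ) :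
    (fun z => z - x) ⁻¹' Metric.ball y r = Metric.ball (y + x) r := by
  ext z
  simp [Metric.mem_ball, dist_eq_norm, sub_sub, add_comm]

theorem isLocallyFiniteMeasure_translate (x : Rd d) (μ : Measure (Rd d))
    [IsLocallyFiniteMeasure μ] : IsLocallyFiniteMeasure (translate x μ) := by
  refine ⟨fun y => ⟨Metric.ball y 1, Metric.ball_mem_nhds _ one_pos, ?_⟩⟩
  rw [translate_apply_of_any, preimage_sub_ball]
  exact Metric.isBounded_ball.measure_lt_top

end Translate

end Preliminaries

/-! ### Quantile transport on the line -/

section Quantile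

open Set Filter Topology

theorem exists_measure_Iic_lt (b : Measure ℝ) [IsFiniteMeasure b] {u : ℝ≥0∞} (hu : 0 < u) :
    ∃ t, b (Iic t) < u := by
  have h := tendsto_measure_iInter_atTop (μ := b) (s := fun n : ℕ => Iic (-(n : ℝ)))
    (fun n => measurableSet_Iic.nullMeasurableSet)
    (fun m n hmn => Iic_subset_Iic.2 (neg_le_neg (Nat.cast_le.2 hmn))) ⟨0, measure_ne_top _ _⟩
  have hI : ⋂ n : ℕ, Iic (-(n : ℝ)) = ∅ := by
    refine eq_empty_of_forall_notMem fun x hx => ?_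
    obtain ⟨n, hn⟩ := exists_nat_gt (-x)
    have := mem_iInter.1 hx n
    rw [mem_Iic] at this
    linarith
  rw [hI, measure_empty] at h
  obtain ⟨n, hn⟩ := (h.eventually_lt_const hu).exists
  exact ⟨_, hn⟩

/-- The quantile function of a finite measure on the line, at an interior level. -/
noncomputable def quant (b : Measure ℝ) (u : ℝ≥0∞) : ℝ :=
  -- At level `0` the set is unbounded below, and at or above the total mass it may be empty; these
  -- levels get the junk value `0` and are excluded by `matchedSet`.
  open Classical in if 0 < u ∧ u < b univ then sInf {t | u ≤ b (Iic t)} else 0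

/-- The Galois connection between quantile and distribution function; the nontrivial direction is
right continuity of the latter. All later facts on `quant` come from here. -/
theorem quant_le_iff (b : Measure ℝ) [IsFiniteMeasure b] {u : ℝ≥0∞} (h0 : 0 < u)
    (h1 : u < b univ) (t : ℝ) : quant b u ≤ t ↔ u ≤ b (Iic t) := by
  have hne : {t | u ≤ b (Iic t)}.Nonempty := by
    obtain ⟨t, ht⟩ := ((tendsto_measure_Iic_atTop b).eventually_const_lt h1).exists
    exact ⟨t, ht.le⟩
  have hbdd : BddBelow {t | u ≤ b (Iic t)} := by
    obtain ⟨t, ht⟩ := exists_measure_Iic_lt b h0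
    refine ⟨t, fun s hs => ?_⟩
    by_contra hst
    exact absurd (hs.trans (measure_mono (Iic_subset_Iic.2 (not_le.1 hst).le))) (not_le.2 ht)
  rw [quant, if_pos ⟨h0, h1⟩]
  refine ⟨fun h => ?_, fun h => csInf_le hbdd h⟩
  have hI : Iic t = ⋂ n : ℕ, Iic (t + 1 / ((n : ℝ) + 1)) := by
    ext s
    simp only [mem_Iic, mem_iInter]
    refine ⟨fun hs n => hs.trans (by have : 0 < 1 / ((n : ℝ) + 1) := by positivity
                                     linarith), fun hs => ?_⟩
    refine le_of_forall_pos_le_add fun ε hε => ?_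
    obtain ⟨n, hn⟩ := exists_nat_one_div_lt hε
    exact (hs n).trans (by linarith)
  have hlim : Tendsto (fun n : ℕ => b (Iic (t + 1 / ((n : ℝ) + 1)))) atTop (𝓝 (b (Iic t))) := by
    rw [hI]
    refine tendsto_measure_iInter_atTop (fun n => measurableSet_Iic.nullMeasurableSet) ?_
      ⟨0, measure_ne_top _ _⟩
    intro m n hmn
    refine Iic_subset_Iic.2 ?_
    have := Nat.one_div_le_one_div (α := ℝ) hmn
    linarith
  refine ge_of_tendsto' hlim fun n => ?_
  have hpos : 0 < 1 / ((n : ℝ) + 1) := by positivity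
  obtain ⟨s, hs, hs'⟩ := exists_lt_of_csInf_lt hne (lt_of_le_of_lt h (lt_add_of_pos_right t hpos))
  exact le_trans hs (measure_mono (Iic_subset_Iic.2 hs'.le))

theorem measurable_quant {X : Type*} [MeasurableSpace X] {f : X → Measure ℝ} {u : X → ℝ≥0∞}
    (hf : Measurable f) (hfin : ∀ x, IsFiniteMeasure (f x)) (hu : Measurable u) :
    Measurable fun x => quant (f x) (u x) := by
  have hfs : ∀ s : Set ℝ, MeasurableSet s → Measurable fun x => f x s := fun s hs =>
    (Measure.measurable_coe hs).comp hf
  have hA : MeasurableSet {x | 0 < u x ∧ u x < f x univ} :=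
    (measurableSet_lt measurable_const hu).inter (measurableSet_lt hu (hfs _ MeasurableSet.univ))
  refine measurable_of_Iic fun t => ?_
  have : (fun x => quant (f x) (u x)) ⁻¹' Iic t
      = ({x | 0 < u x ∧ u x < f x univ} ∩ {x | u x ≤ f x (Iic t)})
        ∪ ({x | 0 < u x ∧ u x < f x univ}ᶜ ∩ {_x | 0 ≤ t}) := by
    ext x
    by_cases hx : 0 < u x ∧ u x < f x univ
    · have := hfin x
      simp [quant_le_iff (f x) hx.1 hx.2 t, hx.1, hx.2]
    · simp only [mem_preimage, mem_Iic, quant, if_neg hx, mem_union, mem_inter_iff, mem_compl_iff]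
      simp only [mem_ofPred_eq]
      tauto
  rw [this]
  exact (hA.inter (measurableSet_le hu (hfs _ measurableSet_Iic))).union
    (hA.compl.inter (MeasurableSet.const _))

theorem measurable_measure_Iic (a : Measure ℝ) : Measurable fun s => a (Iic s) :=
  have h : Monotone fun s => a (Iic s) := fun _ _ hst => measure_mono (Iic_subset_Iic.2 hst)
  h.measurable

/-- A finite diffuse measure on the line is sent to Lebesgue measure by its distribution
function. -/
theorem measure_Iic_le_eq (a : Measure ℝ) [IsFiniteMeasure a] [NullSingletonClass a] (w : ℝ≥0∞) :
    a {s | a (Iic s) ≤ w} = min w (a univ) := by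
  have hm : MeasurableSet {s | a (Iic s) ≤ w} := measurable_measure_Iic a measurableSet_Iic
  refine le_antisymm (le_min ?_ (measure_mono (subset_univ _))) ?_
  -- Inner regularity: a compact subset has a largest point, which lies in the set, so its mass is
  -- at most `w`. The complement is treated below with a least point.
  · rw [hm.measure_eq_iSup_isCompact_of_ne_top (measure_ne_top _ _)]
    refine iSup₂_le fun K hK => iSup_le fun hKc => ?_
    rcases K.eq_empty_or_nonempty with rfl | hne
    · simp
    obtain ⟨k, hk, hk'⟩ := hKc.exists_isGreatest hne
    exact (measure_mono fun x hx => hk' hx).trans (hK hk)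
  · have hc : a {s | a (Iic s) ≤ w}ᶜ ≤ a univ - w := by
      rw [hm.compl.measure_eq_iSup_isCompact_of_ne_top (measure_ne_top _ _)]
      refine iSup₂_le fun K hK => iSup_le fun hKc => ?_
      rcases K.eq_empty_or_nonempty with rfl | hne
      · simp
      obtain ⟨k, hk, hk'⟩ := hKc.exists_isLeast hne
      have hkw : w ≤ a (Iic k) := (not_le.1 fun h => hK hk h).le
      calc a K ≤ a (Ici k) := measure_mono fun x hx => hk' hx
        -- Diffuseness of `a` enters here: the endpoint carries no mass.
        _ = a (Ioi k) := (measure_congr Ioi_ae_eq_Ici).symm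
        _ = a univ - a (Iic k) := by
            rw [← compl_Iic, measure_compl measurableSet_Iic (measure_ne_top _ _)]
        _ ≤ a univ - w := tsub_le_tsub_left hkw _
    rw [measure_compl hm (measure_ne_top _ _)] at hc
    rcases le_total w (a univ) with h | h
    · rw [min_eq_left h]
      have h2 : a univ ≤ (a univ - w) + a {s | a (Iic s) ≤ w} := tsub_le_iff_right.1 hc
      have h3 : (a univ - w) + w ≤ (a univ - w) + a {s | a (Iic s) ≤ w} := by
        rwa [tsub_add_cancel_of_le h]
      exact (ENNReal.add_le_add_iff_left
        (ne_top_of_le_ne_top (measure_ne_top a univ) tsub_le_self)).1 h3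
    · rw [min_eq_right h]
      exact measure_mono fun s _ => (measure_mono (subset_univ _)).trans h

theorem measure_Iic_lt_eq (a : Measure ℝ) [IsFiniteMeasure a] [NullSingletonClass a] (w : ℝ≥0∞) :
    a {s | a (Iic s) < w} = min w (a univ) := by
  refine le_antisymm ?_ ?_
  · rw [← measure_Iic_le_eq a w]
    exact measure_mono fun s (hs : a (Iic s) < w) => show a (Iic s) ≤ w from hs.le
  · refine le_of_forall_lt fun v hv => ?_
    obtain ⟨v', hv1, hv2⟩ := exists_between hv
    have h1 : v' = a {s | a (Iic s) ≤ v'} := by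
      rw [measure_Iic_le_eq, min_eq_left (hv2.le.trans (min_le_right _ _))]
    refine hv1.trans_le ?_
    rw [h1]
    exact measure_mono fun s hs => lt_of_le_of_lt hs (hv2.trans_le (min_le_left _ _))

theorem measure_Iic_eq_eq_zero (a : Measure ℝ) [IsFiniteMeasure a] [NullSingletonClass a]
    (w : ℝ≥0∞) :
    a {s | a (Iic s) = w} = 0 := by
  have h : {s | a (Iic s) = w} = {s | a (Iic s) ≤ w} \ {s | a (Iic s) < w} := by
    ext s
    simp only [mem_ofPred_eq, Set.mem_sdiff, not_lt]
    exact ⟨fun h => ⟨h.le, h.ge⟩, fun h => le_antisymm h.1 h.2⟩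
  have hsub : {s | a (Iic s) < w} ⊆ {s | a (Iic s) ≤ w} :=
    fun s (hs : a (Iic s) < w) => show a (Iic s) ≤ w from hs.le
  rw [h, measure_sdiff hsub
    (measurable_measure_Iic a measurableSet_Iio).nullMeasurableSet (measure_ne_top _ _),
    measure_Iic_le_eq, measure_Iic_lt_eq, tsub_self]

/-- The part of the line on which `s ↦ quant b (a (-∞, s])` is used to transport `a` to `b`. -/
def matchedSet (a b : Measure ℝ) : Set ℝ := {s | 0 < a (Iic s) ∧ a (Iic s) < b univ}

theorem measurableSet_matchedSet (a b : Measure ℝ) : MeasurableSet (matchedSet a b) :=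
  (measurable_measure_Iic a measurableSet_Ioi).inter (measurable_measure_Iic a measurableSet_Iio)

theorem measurable_quant_cdf (a b : Measure ℝ) [IsFiniteMeasure b] :
    Measurable fun s => quant b (a (Iic s)) :=
  measurable_quant measurable_const (fun _ => inferInstance) (measurable_measure_Iic a)

/-- By `quant_le_iff` the preimage of a half-line is a sublevel set of the distribution function of
`a`, up to the null levels `0` and `b univ`. -/
theorem matched_Iic (a b : Measure ℝ) [IsFiniteMeasure a] [IsFiniteMeasure b] [NullSingletonClass a]
    (t : ℝ) :
    ((a.restrict (matchedSet a b)).map fun s => quant b (a (Iic s))) (Iic t)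
      = min (b (Iic t)) (a univ) := by
  rw [Measure.map_apply (measurable_quant_cdf a b) measurableSet_Iic,
    Measure.restrict_apply (measurable_quant_cdf a b measurableSet_Iic), ← measure_Iic_le_eq]
  have h1 : (fun s => quant b (a (Iic s))) ⁻¹' Iic t ∩ matchedSet a b
      = {s | a (Iic s) ≤ b (Iic t)} \ ({s | a (Iic s) = 0} ∪ {s | a (Iic s) = b univ}) := by
    ext s
    simp only [mem_inter_iff, mem_preimage, mem_Iic, Set.mem_sdiff, mem_ofPred_eq, mem_union,
      matchedSet]
    constructor
    · rintro ⟨h, h0, hB⟩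
      exact ⟨(quant_le_iff b h0 hB t).1 h, not_or.2 ⟨h0.ne', hB.ne⟩⟩
    · rintro ⟨h, h'⟩
      obtain ⟨h0, hB⟩ := not_or.1 h'
      have h0 : 0 < a (Iic s) := pos_iff_ne_zero.2 h0
      have hB : a (Iic s) < b univ := lt_of_le_of_ne (h.trans (measure_mono (subset_univ _))) hB
      exact ⟨(quant_le_iff b h0 hB t).2 h, h0, hB⟩
  rw [h1]
  refine measure_sdiff_null (measure_union_null ?_ ?_) <;> exact measure_Iic_eq_eq_zero a _

/-- A comparison of distribution functions does not give a comparison of measures, so the image is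
identified. If `a` has less mass, it fills `b` from the left up to the quantile `t₀` and uses part
of a possible atom there. -/
theorem matched_le (a b : Measure ℝ) [IsFiniteMeasure a] [IsFiniteMeasure b]
    [NullSingletonClass a] :
    ((a.restrict (matchedSet a b)).map fun s => quant b (a (Iic s))) ≤ b := by
  set M := (a.restrict (matchedSet a b)).map fun s => quant b (a (Iic s)) with hM
  have hcdf := matched_Iic a b
  rcases le_or_gt (b univ) (a univ) with h | h
  · refine le_of_eq (Measure.ext_of_Iic _ _ fun t => ?_)
    rw [hcdf, min_eq_left ((measure_mono (subset_univ _)).trans h)]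
  rcases eq_or_ne (a univ) 0 with h0 | h0
  · have : a = 0 := Measure.measure_univ_eq_zero.1 h0
    simp [hM, this, Measure.zero_le]
  have h0 : 0 < a univ := pos_iff_ne_zero.2 h0
  set t₀ := quant b (a univ) with ht₀
  have hlow : b (Iio t₀) ≤ a univ := by
    rw [measurableSet_Iio.measure_eq_iSup_isCompact_of_ne_top (measure_ne_top _ _)]
    refine iSup₂_le fun K hK => iSup_le fun hKc => ?_
    rcases K.eq_empty_or_nonempty with rfl | hne
    · simp
    obtain ⟨k, hk, hk'⟩ := hKc.exists_isGreatest hne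
    refine (measure_mono (show K ⊆ Iic k from fun x hx => hk' hx)).trans ?_
    by_contra hcon
    exact absurd ((quant_le_iff b h0 h k).2 (not_le.1 hcon).le) (not_le.2 (hK hk))
  have hup : a univ ≤ b (Iic t₀) := (quant_le_iff b h0 h t₀).1 le_rfl
  -- The mass of `a` not used below `t₀` is put at `t₀`; by `hup` it is at most the mass of `b` at
  -- that point.
  have hMeq : M = b.restrict (Iio t₀) + (a univ - b (Iio t₀)) • Measure.dirac t₀ := by
    refine Measure.ext_of_Iic _ _ fun t => ?_
    rw [hcdf, Measure.add_apply, Measure.smul_apply, Measure.dirac_apply' _ measurableSet_Iic,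
      Measure.restrict_apply measurableSet_Iic]
    rcases lt_or_ge t t₀ with ht | ht
    · have h1 : b (Iic t) ≤ a univ := (measure_mono (fun x hx => lt_of_le_of_lt hx ht)).trans hlow
      rw [min_eq_left h1, inter_eq_left.2 (Iic_subset_Iio.2 ht)]
      simp [ht]
    · have h1 : a univ ≤ b (Iic t) := (quant_le_iff b h0 h t).1 ht
      rw [min_eq_right h1, inter_eq_right.2 (Iio_subset_Iic_self.trans (Iic_subset_Iic.2 ht))]
      simp [ht, add_tsub_cancel_of_le hlow]
  rw [hMeq]
  have hsplit : b = b.restrict (Iio t₀) + b.restrict (Ici t₀) := by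
    rw [← compl_Iio, Measure.restrict_add_restrict_compl measurableSet_Iio]
  conv_rhs => rw [hsplit]
  gcongr
  refine Measure.le_iff.2 fun s hs => ?_
  rw [Measure.smul_apply, Measure.dirac_apply' _ hs, Measure.restrict_apply hs]
  by_cases hts : t₀ ∈ s
  · simp only [hts, indicator_of_mem, Pi.one_apply, smul_eq_mul, mul_one]
    have h2 : b {t₀} ≤ b (s ∩ Ici t₀) :=
      measure_mono (singleton_subset_iff.2 ⟨hts, self_mem_Ici⟩)
    refine le_trans ?_ h2
    rw [tsub_le_iff_left]
    refine hup.trans ?_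
    rw [← Iio_union_right]
    exact measure_union_le _ _
  · simp [hts]

/-- The measure with the smaller total mass is exhausted. -/
theorem matched_dichotomy (a b : Measure ℝ) [IsFiniteMeasure a] [IsFiniteMeasure b]
    [NullSingletonClass a] :
    a (matchedSet a b)ᶜ = 0 ∨
      ((a.restrict (matchedSet a b)).map fun s => quant b (a (Iic s))) = b := by
  rcases le_total (b univ) (a univ) with h | h
  · refine Or.inr (Measure.ext_of_Iic _ _ fun t => ?_)
    rw [matched_Iic, min_eq_left ((measure_mono (subset_univ _)).trans h)]
  · left
    refine measure_mono_null ?_ (measure_union_null (measure_Iic_eq_eq_zero a 0)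
      (measure_Iic_eq_eq_zero a (b univ)))
    intro s hs
    by_contra hcon
    obtain ⟨h0, hB⟩ := not_or.1 hcon
    exact hs ⟨pos_iff_ne_zero.2 h0, lt_of_le_of_ne ((measure_mono (subset_univ _)).trans h) hB⟩

end Quantile

/-! ### Partial allocations, cell systems and transport inside cells -/

section CellTransport

variable {d : ℕ} {Ω : Type*} [MeasurableSpace Ω]

/-- A kernel that commutes with the flow everywhere. -/
def IsEquivariant (θ : MeasurableFlow d Ω) (κ : Kernel Ω (Rd d)) : Prop :=
  ∀ x ω, κ (θ.shift x ω) = translate x (κ ω)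

/-- A set of pairs `(ω, x)` that is invariant under the diagonal flow. -/
def IsDiagInvariant (θ : MeasurableFlow d Ω) (F : Set (Ω × Rd d)) : Prop :=
  ∀ ω x y, (θ.shift y ω, x - y) ∈ F ↔ (ω, x) ∈ F

theorem IsDiagInvariant.compl {θ : MeasurableFlow d Ω} {F : Set (Ω × Rd d)}
    (h : IsDiagInvariant θ F) : IsDiagInvariant θ Fᶜ :=
  fun ω x y => not_congr (h ω x y)

theorem IsDiagInvariant.inter {θ : MeasurableFlow d Ω} {F G : Set (Ω × Rd d)}
    (h : IsDiagInvariant θ F) (h' : IsDiagInvariant θ G) : IsDiagInvariant θ (F ∩ G) :=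
  fun ω x y => and_congr (h ω x y) (h' ω x y)

/-- The restriction of a kernel to a measurable set of pairs. -/
noncomputable def restrictPairs (κ : Kernel Ω (Rd d)) [IsSFiniteKernel κ] (F : Set (Ω × Rd d))
    (hF : MeasurableSet F) : Kernel Ω (Rd d) :=
  ⟨fun ω => (κ ω).restrict (Prod.mk ω ⁻¹' F), by
    refine Measure.measurable_of_measurable_coe _ fun s hs => ?_
    simp only [Measure.restrict_apply hs]
    exact Kernel.measurable_kernel_prodMk_left (κ := κ) ((measurable_snd hs).inter hF)⟩

theorem restrictPairs_apply (κ : Kernel Ω (Rd d)) [IsSFiniteKernel κ] {F : Set (Ω × Rd d)}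
    (hF : MeasurableSet F) (ω : Ω) :
    restrictPairs κ F hF ω = (κ ω).restrict (Prod.mk ω ⁻¹' F) := rfl

theorem isEquivariant_restrictPairs {θ : MeasurableFlow d Ω} {κ : Kernel Ω (Rd d)}
    [IsSFiniteKernel κ] {F : Set (Ω × Rd d)} (hF : MeasurableSet F) (hκ : IsEquivariant θ κ)
    (hFi : IsDiagInvariant θ F) : IsEquivariant θ (restrictPairs κ F hF) := by
  intro y ω
  ext s hs
  rw [restrictPairs_apply, restrictPairs_apply, translate_apply _ _ hs, Measure.restrict_apply hs,
    Measure.restrict_apply (measurable_sub_right y hs), hκ, translate_apply_of_any]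
  congr 1
  ext z
  exact and_congr Iff.rfl (hFi ω z y)

/-- A measurable, equivariant, partially defined map from `ℝ^d` to itself. -/
structure PartialAllocation (θ : MeasurableFlow d Ω) where
  /-- the domain -/
  dom : Set (Ω × Rd d)
  /-- the map, relevant on the domain only -/
  map : Ω × Rd d → Rd d
  measurableSet_dom : MeasurableSet dom
  measurable_map : Measurable map
  dom_shift : IsDiagInvariant θ dom
  map_shift : ∀ ω x y, (ω, x) ∈ dom → map (θ.shift y ω, x - y) = map (ω, x) - y

namespace PartialAllocation

variable {θ : MeasurableFlow d Ω}

/-- The image of a random measure under a partial allocation. -/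
noncomputable def image (T : PartialAllocation θ) (κ : Kernel Ω (Rd d)) [IsSFiniteKernel κ] :
    Kernel Ω (Rd d) :=
  ⟨fun ω => ((κ ω).restrict (Prod.mk ω ⁻¹' T.dom)).map fun x => T.map (ω, x), by
    refine Measure.measurable_of_measurable_coe _ fun s hs => ?_
    have h : ∀ ω, Measurable fun x => T.map (ω, x) := fun ω =>
      T.measurable_map.comp measurable_prodMk_left
    simp only [Measure.map_apply (h _) hs, Measure.restrict_apply (h _ hs)]
    exact Kernel.measurable_kernel_prodMk_left (κ := κ)
      ((T.measurable_map hs).inter T.measurableSet_dom)⟩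

theorem measurable_map_mk (T : PartialAllocation θ) (ω : Ω) :
    Measurable fun x => T.map (ω, x) :=
  T.measurable_map.comp measurable_prodMk_left

theorem measurableSet_dom_mk (T : PartialAllocation θ) (ω : Ω) :
    MeasurableSet (Prod.mk ω ⁻¹' T.dom) :=
  measurable_prodMk_left T.measurableSet_dom

theorem image_def (T : PartialAllocation θ) (κ : Kernel Ω (Rd d)) [IsSFiniteKernel κ] (ω : Ω) :
    T.image κ ω = ((κ ω).restrict (Prod.mk ω ⁻¹' T.dom)).map fun x => T.map (ω, x) := rfl

theorem image_apply (T : PartialAllocation θ) (κ : Kernel Ω (Rd d)) [IsSFiniteKernel κ] (ω : Ω)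
    {s : Set (Rd d)} (hs : MeasurableSet s) :
    T.image κ ω s = κ ω {x | (ω, x) ∈ T.dom ∧ T.map (ω, x) ∈ s} := by
  rw [image_def, Measure.map_apply (T.measurable_map_mk ω) hs,
    Measure.restrict_apply (T.measurable_map_mk ω hs), Set.inter_comm]
  rfl

theorem isEquivariant_image (T : PartialAllocation θ) {κ : Kernel Ω (Rd d)} [IsSFiniteKernel κ]
    (hκ : IsEquivariant θ κ) : IsEquivariant θ (T.image κ) := by
  intro y ω
  ext s hs
  rw [translate_apply _ _ hs, image_apply _ _ _ hs, image_apply _ _ _ (measurable_sub_right y hs),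
    hκ, translate_apply_of_any]
  congr 1
  ext z
  simp only [Set.mem_preimage, Set.mem_ofPred_eq]
  rw [T.dom_shift]
  refine and_congr_right fun hz => ?_
  rw [T.map_shift ω z y hz]

/-- The restriction of a partial allocation to a smaller domain. -/
def restrict (T : PartialAllocation θ) (F : Set (Ω × Rd d)) (hF : MeasurableSet F)
    (hFi : IsDiagInvariant θ F) : PartialAllocation θ where
  dom := T.dom ∩ F
  map := T.map
  measurableSet_dom := T.measurableSet_dom.inter hF
  measurable_map := T.measurable_map
  dom_shift := T.dom_shift.inter hFi
  map_shift := fun ω x y h => T.map_shift ω x y h.1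

theorem image_restrict (T : PartialAllocation θ) (F : Set (Ω × Rd d)) (hF : MeasurableSet F)
    (hFi : IsDiagInvariant θ F) (κ : Kernel Ω (Rd d)) [IsSFiniteKernel κ]
    [IsSFiniteKernel (restrictPairs κ F hF)] :
    (T.restrict F hF hFi).image κ = T.image (restrictPairs κ F hF) := by
  ext1 ω
  rw [image_def, image_def, restrictPairs_apply,
    Measure.restrict_restrict (T.measurableSet_dom_mk ω)]
  rfl

end PartialAllocation

/-- An equivariant measurable system of disjoint bounded open cells; two points of `carrier` are in
the same cell if they have the same label. -/
structure CellSystem (θ : MeasurableFlow d Ω) where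
  /-- the union of all cells -/
  carrier : Set (Ω × Rd d)
  /-- the label of the cell of a point -/
  label : Ω × Rd d → Rd d
  measurableSet_carrier : MeasurableSet carrier
  measurable_label : Measurable label
  carrier_shift : IsDiagInvariant θ carrier
  label_shift : ∀ ω x y, (ω, x) ∈ carrier → label (θ.shift y ω, x - y) = label (ω, x) - y
  isOpen_cell : ∀ ω c, IsOpen {x | (ω, x) ∈ carrier ∧ label (ω, x) = c}
  isBounded_cell : ∀ ω c, Bornology.IsBounded {x | (ω, x) ∈ carrier ∧ label (ω, x) = c}

namespace CellSystem

variable {θ : MeasurableFlow d Ω}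

/-- The cell with label `c`. -/
def cell (S : CellSystem θ) (ω : Ω) (c : Rd d) : Set (Rd d) :=
  {x | (ω, x) ∈ S.carrier ∧ S.label (ω, x) = c}

theorem mem_cell (S : CellSystem θ) {ω : Ω} {c x : Rd d} :
    x ∈ S.cell ω c ↔ (ω, x) ∈ S.carrier ∧ S.label (ω, x) = c := Iff.rfl

theorem measurableSet_cell (S : CellSystem θ) (ω : Ω) (c : Rd d) : MeasurableSet (S.cell ω c) :=
  (S.isOpen_cell ω c).measurableSet

theorem sub_mem_cell_iff (S : CellSystem θ) (ω : Ω) (c x y : Rd d) :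
    x - y ∈ S.cell (θ.shift y ω) (c - y) ↔ x ∈ S.cell ω c := by
  rw [mem_cell, mem_cell, S.carrier_shift]
  refine and_congr_right fun h => ?_
  rw [S.label_shift ω x y h, sub_left_inj]

theorem pairwise_disjoint_cell (S : CellSystem θ) (ω : Ω) :
    Pairwise (Function.onFun Disjoint (S.cell ω)) := by
  intro c c' h
  refine Set.disjoint_left.2 fun x hx hx' => h ?_
  rw [← (S.mem_cell.1 hx).2, (S.mem_cell.1 hx').2]

/-- Disjoint nonempty open sets in a separable space are countably many. This is why cells are
required to be open. -/
theorem countable_label (S : CellSystem θ) (ω : Ω) : {c | (S.cell ω c).Nonempty}.Countable := by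
  refine Set.PairwiseDisjoint.countable_of_isOpen (s := S.cell ω)
    (fun c _ c' _ h => S.pairwise_disjoint_cell ω h) (fun c _ => S.isOpen_cell ω c) ?_
  exact fun c hc => hc

theorem iUnion_cell (S : CellSystem θ) (ω : Ω) :
    ⋃ c : {c | (S.cell ω c).Nonempty}, S.cell ω c = Prod.mk ω ⁻¹' S.carrier := by
  ext x
  simp only [Set.mem_iUnion, Set.mem_preimage]
  constructor
  · rintro ⟨c, hc⟩
    exact hc.1
  · intro h
    exact ⟨⟨S.label (ω, x), ⟨x, h, rfl⟩⟩, h, rfl⟩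

variable (φ : Rd d ≃ᵐ ℝ)

/-- The measurable isomorphism `φ` recentred at `c`. -/
noncomputable def chart (c : Rd d) : Rd d ≃ᵐ ℝ := (MeasurableEquiv.addRight (-c)).trans φ

theorem chart_apply (c z : Rd d) : chart φ c z = φ (z - c) := by
  simp [chart, sub_eq_add_neg]

/-- A random measure on the cell with label `c`, seen on the line. -/
noncomputable def cellLaw (S : CellSystem θ) (κ : Kernel Ω (Rd d)) (p : Ω × Rd d) : Measure ℝ :=
  ((κ p.1).restrict (S.cell p.1 p.2)).map (chart φ p.2)

theorem cellLaw_apply (S : CellSystem θ) (κ : Kernel Ω (Rd d)) (p : Ω × Rd d) {s : Set ℝ}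
    (hs : MeasurableSet s) :
    S.cellLaw φ κ p s = κ p.1 {z | φ (z - p.2) ∈ s ∧ z ∈ S.cell p.1 p.2} := by
  rw [cellLaw, Measure.map_apply (chart φ p.2).measurable hs,
    Measure.restrict_apply ((chart φ p.2).measurable hs)]
  simp only [← chart_apply]
  rfl

theorem measurable_cellLaw (S : CellSystem θ) (κ : Kernel Ω (Rd d)) [IsSFiniteKernel κ] :
    Measurable (S.cellLaw φ κ) := by
  refine Measure.measurable_of_measurable_coe _ fun s hs => ?_
  simp only [S.cellLaw_apply φ κ _ hs]
  have hset : MeasurableSet {q : (Ω × Rd d) × Rd d |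
      φ (q.2 - q.1.2) ∈ s ∧ q.2 ∈ S.cell q.1.1 q.1.2} := by
    have h1 : Measurable fun q : (Ω × Rd d) × Rd d => φ (q.2 - q.1.2) := by fun_prop
    have h2 : Measurable fun q : (Ω × Rd d) × Rd d => (q.1.1, q.2) := by fun_prop
    exact (h1 hs).inter ((h2 S.measurableSet_carrier).inter
      (measurableSet_eq_fun (S.measurable_label.comp h2) (by fun_prop)))
  exact Kernel.measurable_kernel_prodMk_left (κ := κ.comap Prod.fst measurable_fst) hset

theorem isFiniteMeasure_cellLaw (S : CellSystem θ) {κ : Kernel Ω (Rd d)}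
    (hκ : ∀ ω, IsLocallyFiniteMeasure (κ ω)) (p : Ω × Rd d) :
    IsFiniteMeasure (S.cellLaw φ κ p) := by
  have := hκ p.1
  refine ⟨?_⟩
  rw [S.cellLaw_apply φ κ p MeasurableSet.univ]
  exact ((S.isBounded_cell p.1 p.2).subset fun z hz => hz.2).measure_lt_top

/-- Recentring the chart at the label cancels the shift, so the one-dimensional problem in a cell
does not depend on the position of the origin. Equivariance of `transport` rests on this. -/
theorem cellLaw_shift (S : CellSystem θ) {κ : Kernel Ω (Rd d)} (hκ : IsEquivariant θ κ) (ω : Ω)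
    (c y : Rd d) : S.cellLaw φ κ (θ.shift y ω, c - y) = S.cellLaw φ κ (ω, c) := by
  ext s hs
  rw [cellLaw_apply _ _ _ _ hs, cellLaw_apply _ _ _ _ hs]
  simp only
  rw [hκ, translate_apply_of_any]
  congr 1
  ext z
  simp only [Set.mem_preimage, Set.mem_ofPred_eq, S.sub_mem_cell_iff, sub_sub_sub_cancel_right]

theorem nullSingletonClass_cellLaw (S : CellSystem θ) {κ : Kernel Ω (Rd d)}
    (hκ : ∀ ω x, κ ω {x} = 0) (p : Ω × Rd d) : NullSingletonClass (S.cellLaw φ κ p) := by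
  refine ⟨fun t => ?_⟩
  rw [cellLaw_apply _ _ _ _ (measurableSet_singleton t)]
  refine measure_mono_null ?_ (hκ p.1 (φ.symm t + p.2))
  rintro z ⟨hz, -⟩
  rw [Set.mem_singleton_iff] at hz ⊢
  rw [← hz, MeasurableEquiv.symm_apply_apply, sub_add_cancel]

theorem measurable_cellLaw_Iic (S : CellSystem θ) (κ : Kernel Ω (Rd d)) [IsSFiniteKernel κ] :
    Measurable fun p : Ω × Rd d =>
      S.cellLaw φ κ (p.1, S.label p) (Set.Iic (φ (p.2 - S.label p))) := by
  simp only [S.cellLaw_apply φ κ _ measurableSet_Iic]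
  have hset : MeasurableSet {q : (Ω × Rd d) × Rd d |
      φ (q.2 - S.label q.1) ∈ Set.Iic (φ (q.1.2 - S.label q.1)) ∧
        q.2 ∈ S.cell q.1.1 (S.label q.1)} := by
    have hl := S.measurable_label
    have h0 : Measurable fun q : (Ω × Rd d) × Rd d => S.label q.1 := hl.comp measurable_fst
    have h1 : Measurable fun q : (Ω × Rd d) × Rd d => φ (q.2 - S.label q.1) :=
      φ.measurable.comp (measurable_snd.sub h0)
    have h2 : Measurable fun q : (Ω × Rd d) × Rd d => (q.1.1, q.2) := by fun_prop
    have h3 : Measurable fun q : (Ω × Rd d) × Rd d => φ (q.1.2 - S.label q.1) :=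
      φ.measurable.comp ((measurable_snd.comp measurable_fst).sub h0)
    exact (measurableSet_le h1 h3).inter ((h2 S.measurableSet_carrier).inter
      (measurableSet_eq_fun (hl.comp h2) h0))
  exact Kernel.measurable_kernel_prodMk_left (κ := κ.comap Prod.fst measurable_fst) hset

/-- The quantile transport, within each cell, of the diffuse `κ` to `ρ`. -/
noncomputable def transport (S : CellSystem θ) (κ ρ : Kernel Ω (Rd d)) [IsSFiniteKernel κ]
    [IsSFiniteKernel ρ] (hκ : IsEquivariant θ κ) (hρ : IsEquivariant θ ρ)
    (hρ' : ∀ ω, IsLocallyFiniteMeasure (ρ ω)) : PartialAllocation θ where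
  dom := {p | p ∈ S.carrier ∧ φ (p.2 - S.label p) ∈
    matchedSet (S.cellLaw φ κ (p.1, S.label p)) (S.cellLaw φ ρ (p.1, S.label p))}
  map := fun p => φ.symm (quant (S.cellLaw φ ρ (p.1, S.label p))
    (S.cellLaw φ κ (p.1, S.label p) (Set.Iic (φ (p.2 - S.label p))))) + S.label p
  measurableSet_dom := by
    have hp : Measurable fun p : Ω × Rd d => (p.1, S.label p) :=
      measurable_fst.prodMk S.measurable_label
    refine S.measurableSet_carrier.inter (MeasurableSet.inter ?_ ?_)
    · exact measurableSet_lt measurable_const (S.measurable_cellLaw_Iic φ κ)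
    · exact measurableSet_lt (S.measurable_cellLaw_Iic φ κ)
        ((Measure.measurable_coe MeasurableSet.univ).comp ((S.measurable_cellLaw φ ρ).comp hp))
  measurable_map := by
    have hp : Measurable fun p : Ω × Rd d => (p.1, S.label p) :=
      measurable_fst.prodMk S.measurable_label
    exact (φ.symm.measurable.comp (measurable_quant ((S.measurable_cellLaw φ ρ).comp hp)
      (fun p => S.isFiniteMeasure_cellLaw φ hρ' _) (S.measurable_cellLaw_Iic φ κ))).add
      S.measurable_label
  dom_shift := by
    intro ω x y
    refine (and_congr_left' (S.carrier_shift ω x y)).trans (and_congr_right fun h => ?_)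
    simp only [S.label_shift ω x y h, S.cellLaw_shift φ hκ, S.cellLaw_shift φ hρ,
      sub_sub_sub_cancel_right]
  map_shift := by
    rintro ω x y ⟨h, -⟩
    simp only [S.label_shift ω x y h, S.cellLaw_shift φ hκ, S.cellLaw_shift φ hρ,
      sub_sub_sub_cancel_right]
    abel

theorem map_symm_cellLaw (S : CellSystem θ) (ρ : Kernel Ω (Rd d)) (ω : Ω) (c : Rd d) :
    (S.cellLaw φ ρ (ω, c)).map (chart φ c).symm = (ρ ω).restrict (S.cell ω c) := by
  rw [cellLaw, Measure.map_map (chart φ c).symm.measurable (chart φ c).measurable]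
  simp

section

variable (S : CellSystem θ) (κ ρ : Kernel Ω (Rd d)) [IsSFiniteKernel κ]
    [IsSFiniteKernel ρ] (hκ : IsEquivariant θ κ) (hρ : IsEquivariant θ ρ)
    (hρ' : ∀ ω, IsLocallyFiniteMeasure (ρ ω))

theorem transport_dom_inter_cell (ω : Ω) (c : Rd d) :
    Prod.mk ω ⁻¹' (S.transport φ κ ρ hκ hρ hρ').dom ∩ S.cell ω c
      = chart φ c ⁻¹' matchedSet (S.cellLaw φ κ (ω, c)) (S.cellLaw φ ρ (ω, c)) ∩ S.cell ω c := by
  ext x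
  simp only [Set.mem_inter_iff, Set.mem_preimage, chart_apply, transport, Set.mem_ofPred_eq]
  refine and_congr_left fun hx => ?_
  obtain ⟨h, rfl⟩ := S.mem_cell.1 hx
  exact and_iff_right h

/-- The image of the restriction of `κ` to a cell is the quantile image. -/
theorem transport_image_cell (ω : Ω) (c : Rd d) :
    ((κ ω).restrict (Prod.mk ω ⁻¹' (S.transport φ κ ρ hκ hρ hρ').dom ∩ S.cell ω c)).map
        (fun x => (S.transport φ κ ρ hκ hρ hρ').map (ω, x))
      = (((S.cellLaw φ κ (ω, c)).restrict
          (matchedSet (S.cellLaw φ κ (ω, c)) (S.cellLaw φ ρ (ω, c)))).map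
          fun s => quant (S.cellLaw φ ρ (ω, c)) (S.cellLaw φ κ (ω, c) (Set.Iic s))).map
          (chart φ c).symm := by
  have hfin := S.isFiniteMeasure_cellLaw φ hρ' (ω, c)
  have hmeas := measurable_quant_cdf (S.cellLaw φ κ (ω, c)) (S.cellLaw φ ρ (ω, c))
  have hms := measurableSet_matchedSet (S.cellLaw φ κ (ω, c)) (S.cellLaw φ ρ (ω, c))
  rw [S.transport_dom_inter_cell, Measure.map_map (chart φ c).symm.measurable hmeas]
  conv_rhs => rw [cellLaw.eq_1 φ S κ (ω, c)]
  rw [Measure.restrict_map (chart φ c).measurable (by rw [← cellLaw]; exact hms),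
    Measure.map_map ((chart φ c).symm.measurable.comp (by rw [← cellLaw]; exact hmeas))
      (chart φ c).measurable]
  rw [Measure.restrict_restrict ((chart φ c).measurable (by rw [← cellLaw]; exact hms))]
  -- The two maps agree only on the cell, where the label equals `c`.
  refine Measure.map_congr ?_
  refine (ae_restrict_iff' (((chart φ c).measurable hms).inter (S.measurableSet_cell ω c))).2
    (Filter.Eventually.of_forall fun x hx => ?_)
  obtain ⟨h, rfl⟩ := S.mem_cell.1 hx.2
  have hsymm : ∀ s c, (chart φ c).symm s = φ.symm s + c := fun s c => by
    rw [MeasurableEquiv.symm_apply_eq, chart_apply]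
    simp
  simp only [Function.comp_apply, hsymm, chart_apply]
  rfl

theorem transport_image_cell_le (hκ' : ∀ ω, IsLocallyFiniteMeasure (κ ω)) (hκd : ∀ ω x, κ ω {x} = 0)
    (ω : Ω) (c : Rd d) :
    ((κ ω).restrict (Prod.mk ω ⁻¹' (S.transport φ κ ρ hκ hρ hρ').dom ∩ S.cell ω c)).map
        (fun x => (S.transport φ κ ρ hκ hρ hρ').map (ω, x)) ≤ (ρ ω).restrict (S.cell ω c) := by
  have hfin := S.isFiniteMeasure_cellLaw φ hρ' (ω, c)
  have hfin' := S.isFiniteMeasure_cellLaw φ hκ' (ω, c)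
  have hna := S.nullSingletonClass_cellLaw φ hκd (ω, c)
  rw [transport_image_cell, ← S.map_symm_cellLaw φ ρ ω c]
  exact Measure.map_mono (matched_le _ _) (chart φ c).symm.measurable

theorem transport_image_eq_sum (ω : Ω) :
    (S.transport φ κ ρ hκ hρ hρ').image κ ω = Measure.sum fun c : {c | (S.cell ω c).Nonempty} =>
      ((κ ω).restrict (Prod.mk ω ⁻¹' (S.transport φ κ ρ hκ hρ hρ').dom ∩ S.cell ω c)).map
        (fun x => (S.transport φ κ ρ hκ hρ hρ').map (ω, x)) := by
  have hc : Countable {c | (S.cell ω c).Nonempty} := (S.countable_label ω).to_subtype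
  set T := S.transport φ κ ρ hκ hρ hρ' with hT
  have h1 : Prod.mk ω ⁻¹' T.dom
      = ⋃ c : {c | (S.cell ω c).Nonempty}, Prod.mk ω ⁻¹' T.dom ∩ S.cell ω c := by
    rw [← Set.inter_iUnion, S.iUnion_cell, Set.inter_eq_left.2]
    exact fun x hx => hx.1
  rw [PartialAllocation.image_def]
  conv_lhs => rw [h1]
  rw [Measure.restrict_iUnion, Measure.map_sum (T.measurable_map_mk ω).aemeasurable]
  · intro c c' hcc'
    exact (S.pairwise_disjoint_cell ω (fun h => hcc' (Subtype.ext h))).mono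
      Set.inter_subset_right Set.inter_subset_right
  · exact fun c => (T.measurableSet_dom_mk ω).inter (S.measurableSet_cell ω c)

/-- The image of each cell is bounded by `ρ` on the same cell, and the cells are disjoint, so the
bounds add up. -/
theorem transport_image_le (hκ' : ∀ ω, IsLocallyFiniteMeasure (κ ω)) (hκd : ∀ ω x, κ ω {x} = 0)
    (ω : Ω) : (S.transport φ κ ρ hκ hρ hρ').image κ ω ≤ ρ ω := by
  have hc : Countable {c | (S.cell ω c).Nonempty} := (S.countable_label ω).to_subtype
  calc (S.transport φ κ ρ hκ hρ hρ').image κ ω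
      ≤ Measure.sum fun c : {c | (S.cell ω c).Nonempty} => (ρ ω).restrict (S.cell ω c) := by
        rw [transport_image_eq_sum]
        refine Measure.le_iff.2 fun s hs => ?_
        rw [Measure.sum_apply _ hs, Measure.sum_apply _ hs]
        exact ENNReal.tsum_le_tsum fun c =>
          S.transport_image_cell_le φ κ ρ hκ hρ hρ' hκ' hκd ω c s
    _ = (ρ ω).restrict (⋃ c : {c | (S.cell ω c).Nonempty}, S.cell ω c) :=
        (Measure.restrict_iUnion (s := fun c : {c | (S.cell ω c).Nonempty} => S.cell ω c)
          (fun c c' h => S.pairwise_disjoint_cell ω (fun h' => h (Subtype.ext h')))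
          fun c => S.measurableSet_cell ω c).symm
    _ ≤ ρ ω := Measure.restrict_le_self

/-- In each cell, either all of `κ` is transported or all of `ρ` is covered. -/
theorem transport_dichotomy (hκ' : ∀ ω, IsLocallyFiniteMeasure (κ ω)) (hκd : ∀ ω x, κ ω {x} = 0)
    (ω : Ω) (c : Rd d) :
    κ ω (S.cell ω c \ Prod.mk ω ⁻¹' (S.transport φ κ ρ hκ hρ hρ').dom) = 0 ∨
      (ρ ω).restrict (S.cell ω c) ≤ (S.transport φ κ ρ hκ hρ hρ').image κ ω := by
  have hfin := S.isFiniteMeasure_cellLaw φ hρ' (ω, c)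
  have hfin' := S.isFiniteMeasure_cellLaw φ hκ' (ω, c)
  have hna := S.nullSingletonClass_cellLaw φ hκd (ω, c)
  rcases matched_dichotomy (S.cellLaw φ κ (ω, c)) (S.cellLaw φ ρ (ω, c)) with h | h
  · left
    rw [cellLaw_apply _ _ _ _ (measurableSet_matchedSet _ _).compl] at h
    refine measure_mono_null ?_ h
    rintro x ⟨hx, hx'⟩
    refine ⟨fun hm => hx' ?_, hx⟩
    have : x ∈ Prod.mk ω ⁻¹' (S.transport φ κ ρ hκ hρ hρ').dom ∩ S.cell ω c := by
      rw [transport_dom_inter_cell]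
      exact ⟨by rw [Set.mem_preimage, chart_apply]; exact hm, hx⟩
    exact this.1
  · right
    have h2 := S.transport_image_cell φ κ ρ hκ hρ hρ' ω c
    rw [h, S.map_symm_cellLaw] at h2
    rw [← h2, PartialAllocation.image_def]
    exact Measure.map_mono (Measure.restrict_mono Set.inter_subset_left le_rfl)
      ((S.transport φ κ ρ hκ hρ hρ').measurable_map_mk ω)

end

end CellSystem

end CellTransport

/-! ### Exhausting countably many cell systems -/

section Iteration

variable {d : ℕ} {Ω : Type*} [MeasurableSpace Ω] {θ : MeasurableFlow d Ω}

theorem isLocallyFiniteMeasure_of_le {μ ν : Measure (Rd d)} [IsLocallyFiniteMeasure ν]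
    (h : μ ≤ ν) : IsLocallyFiniteMeasure μ := by
  refine ⟨fun x => ?_⟩
  obtain ⟨s, hs, hs'⟩ := ν.finiteAt_nhds x
  exact ⟨s, hs, (h s).trans_lt hs'⟩

/-- The state of the construction: the set of points not yet allocated, and the part of the target
measure not yet covered. -/
structure Remainder (θ : MeasurableFlow d Ω) where
  /-- the points not yet allocated -/
  free : Set (Ω × Rd d)
  /-- the part of the target not yet covered -/
  rest : Kernel Ω (Rd d)
  measurableSet_free : MeasurableSet free
  free_shift : IsDiagInvariant θ free
  isEquivariant_rest : IsEquivariant θ rest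
  isLocallyFinite_rest : ∀ ω, IsLocallyFiniteMeasure (rest ω)

/-- One round of the construction: cellwise quantile transport of the free part of `ξ` to the
uncovered part of the target, with the leftovers recorded as the new state. -/
theorem exists_remainder_step (φ : Rd d ≃ᵐ ℝ) (ξ : Kernel Ω (Rd d)) [IsSFiniteKernel ξ]
    (hξe : IsEquivariant θ ξ) (hξf : ∀ ω, IsLocallyFiniteMeasure (ξ ω))
    (hξd : ∀ ω x, ξ ω {x} = 0) (S : CellSystem θ) (s : Remainder θ) :
    ∃ (T : PartialAllocation θ) (s' : Remainder θ), T.dom ⊆ s.free ∧ s'.free = s.free \ T.dom ∧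
      (∀ ω, T.image ξ ω + s'.rest ω = s.rest ω) ∧
      ∀ ω c, ξ ω (S.cell ω c ∩ Prod.mk ω ⁻¹' s'.free) = 0 ∨ s'.rest ω (S.cell ω c) = 0 := by
  have hrest := s.isLocallyFinite_rest
  have hsf : IsSFiniteKernel s.rest := isSFiniteKernel_of_isLocallyFinite _ hrest
  let κ := restrictPairs ξ s.free s.measurableSet_free
  have hκle : ∀ ω, κ ω ≤ ξ ω := fun ω => Measure.restrict_le_self
  have hκf : ∀ ω, IsLocallyFiniteMeasure (κ ω) := fun ω => isLocallyFiniteMeasure_of_le (hκle ω)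
  have hκs : IsSFiniteKernel κ := isSFiniteKernel_of_isLocallyFinite _ hκf
  have hκd : ∀ ω x, κ ω {x} = 0 := fun ω x => le_zero_iff.1 ((hκle ω _).trans (hξd ω x).le)
  have hκe : IsEquivariant θ κ := isEquivariant_restrictPairs _ hξe s.free_shift
  let T₀ := S.transport φ κ s.rest hκe s.isEquivariant_rest hrest
  let T := T₀.restrict s.free s.measurableSet_free s.free_shift
  have hT : T.image ξ = T₀.image κ := T₀.image_restrict _ _ _ ξ
  have hle : ∀ ω, T.image ξ ω ≤ s.rest ω := fun ω => by
    rw [hT]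
    exact S.transport_image_le φ κ s.rest hκe s.isEquivariant_rest hrest hκf hκd ω
  obtain ⟨ρ, hρ⟩ := exists_kernel_add_eq s.rest (T.image ξ) hrest hle
  -- The difference is unique because the image is locally finite, so it inherits equivariance.
  have hρe : IsEquivariant θ ρ := by
    intro x ω
    have := hrest (θ.shift x ω)
    have := isLocallyFiniteMeasure_of_le (hle (θ.shift x ω))
    refine measure_add_left_cancel (ν := T.image ξ (θ.shift x ω)) ?_
    rw [hρ, s.isEquivariant_rest, ← hρ ω, translate_add, T.isEquivariant_image hξe]
  have hρf : ∀ ω, IsLocallyFiniteMeasure (ρ ω) := fun ω => by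
    have := hrest ω
    refine isLocallyFiniteMeasure_of_le (ν := s.rest ω) ?_
    rw [← hρ ω]
    exact Measure.le_add_left le_rfl
  refine ⟨T, ⟨s.free \ T.dom, ρ, s.measurableSet_free.diff T.measurableSet_dom,
    s.free_shift.inter T.dom_shift.compl, hρe, hρf⟩, Set.inter_subset_right, rfl, hρ,
    fun ω c => ?_⟩
  rcases S.transport_dichotomy φ κ s.rest hκe s.isEquivariant_rest hrest hκf hκd ω c with h | h
  · left
    have hm : MeasurableSet (S.cell ω c \ Prod.mk ω ⁻¹' T₀.dom) :=
      (S.measurableSet_cell ω c).diff (T₀.measurableSet_dom_mk ω)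
    rw [restrictPairs_apply, Measure.restrict_apply hm] at h
    refine measure_mono_null ?_ h
    rintro x ⟨hx, hxf, hxd⟩
    exact ⟨⟨hx, fun hd => hxd ⟨hd, hxf⟩⟩, hxf⟩
  · right
    have := hrest ω
    have hfin : s.rest ω (S.cell ω c) < ∞ := (S.isBounded_cell ω c).measure_lt_top
    have h1 : s.rest ω (S.cell ω c) ≤ T.image ξ ω (S.cell ω c) := by
      have := h (S.cell ω c)
      rw [Measure.restrict_apply_self] at this
      rw [hT]
      exact this
    have h2 : T.image ξ ω (S.cell ω c) + ρ ω (S.cell ω c) = s.rest ω (S.cell ω c) := by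
      rw [← Measure.add_apply, hρ]
    -- Boundedness of the cell makes the mass finite, so that it can be cancelled.
    have h3 : T.image ξ ω (S.cell ω c) ≠ ∞ := ((hle ω _).trans_lt hfin).ne
    rw [← h2] at h1
    have h4 : T.image ξ ω (S.cell ω c) + ρ ω (S.cell ω c) ≤ T.image ξ ω (S.cell ω c) + 0 := by
      simpa using h1
    exact le_zero_iff.1 ((ENNReal.add_le_add_iff_left h3).1 h4)

/-- Exhausting a sequence of cell systems. -/
theorem exists_partialAllocation_of_cellSystems (φ : Rd d ≃ᵐ ℝ) (ξ η : Kernel Ω (Rd d))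
    [IsSFiniteKernel ξ] (hξe : IsEquivariant θ ξ) (hηe : IsEquivariant θ η)
    (hξf : ∀ ω, IsLocallyFiniteMeasure (ξ ω)) (hηf : ∀ ω, IsLocallyFiniteMeasure (η ω))
    (hξd : ∀ ω x, ξ ω {x} = 0) (S : ℕ → CellSystem θ) :
    ∃ T : PartialAllocation θ, (∀ ω, T.image ξ ω ≤ η ω) ∧
      ∀ n ω c, ξ ω ((S n).cell ω c \ Prod.mk ω ⁻¹' T.dom) = 0 ∨
        (η ω).restrict ((S n).cell ω c) ≤ T.image ξ ω := by
  choose T next hdom hfree hadd hcell using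
    fun n s => exists_remainder_step φ ξ hξe hξf hξd (S n) s
  let s₀ : Remainder θ := ⟨Set.univ, η, MeasurableSet.univ, fun _ _ _ => Iff.rfl, hηe, hηf⟩
  let s : ℕ → Remainder θ := fun n => Nat.rec s₀ (fun n s => next n s) n
  let U : ℕ → PartialAllocation θ := fun n => T n (s n)
  have hs : ∀ n, s (n + 1) = next n (s n) := fun n => rfl
  have hanti : Antitone fun n => (s n).free := antitone_nat_of_succ_le fun n => by
    rw [hs, hfree]
    exact Set.sdiff_subset
  have hdisj' : ∀ m n, m < n → Disjoint (U m).dom (U n).dom := by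
    intro m n hmn
    refine Set.disjoint_left.2 fun p hp hp' => ?_
    have h1 : p ∈ (s (m + 1)).free := hanti hmn (hdom n (s n) hp')
    rw [hs, hfree] at h1
    exact h1.2 hp
  have hdisj : Pairwise (Function.onFun Disjoint fun n => (U n).dom) := by
    intro m n hmn
    rcases lt_or_gt_of_ne hmn with h | h
    · exact hdisj' m n h
    · exact (hdisj' n m h).symm
  -- Each round allocates only points still free, so the domains are disjoint and the maps glue.
  obtain ⟨f, hfm, hf⟩ := exists_measurable_piecewise (fun n => (U n).dom)
    (fun n => (U n).measurableSet_dom) (fun n => (U n).map) (fun n => (U n).measurable_map)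
    (fun m n hmn p hp => ((hdisj hmn).le_bot hp).elim)
  let V : PartialAllocation θ :=
    { dom := ⋃ n, (U n).dom
      map := f
      measurableSet_dom := MeasurableSet.iUnion fun n => (U n).measurableSet_dom
      measurable_map := hfm
      dom_shift := fun ω x y => by
        simp only [Set.mem_iUnion]
        exact exists_congr fun n => (U n).dom_shift ω x y
      map_shift := fun ω x y h => by
        obtain ⟨n, hn⟩ := Set.mem_iUnion.1 h
        rw [hf n hn, hf n (((U n).dom_shift ω x y).2 hn), (U n).map_shift ω x y hn] }
  have himage : ∀ ω, V.image ξ ω = Measure.sum fun n => (U n).image ξ ω := by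
    intro ω
    have h1 : Prod.mk ω ⁻¹' V.dom = ⋃ n, Prod.mk ω ⁻¹' (U n).dom := Set.preimage_iUnion
    rw [PartialAllocation.image_def, h1, Measure.restrict_iUnion
      (fun m n hmn => (hdisj hmn).preimage _) (fun n => (U n).measurableSet_dom_mk ω),
      Measure.map_sum (V.measurable_map_mk ω).aemeasurable]
    congr 1
    funext n
    rw [PartialAllocation.image_def]
    refine Measure.map_congr ((ae_restrict_iff' ((U n).measurableSet_dom_mk ω)).2
      (Filter.Eventually.of_forall fun x hx => hf n hx))
  have hpartial : ∀ n ω, (∑ k ∈ Finset.range n, (U k).image ξ ω) + (s n).rest ω = η ω := by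
    intro n ω
    induction n with
    | zero => simp [s, s₀]
    | succ n ih =>
      rw [Finset.sum_range_succ, add_assoc, hs, hadd, ih]
  refine ⟨V, fun ω => ?_, fun n ω c => ?_⟩
  · rw [himage]
    refine Measure.le_iff.2 fun t ht => ?_
    rw [Measure.sum_apply _ ht, ENNReal.tsum_eq_iSup_nat]
    refine iSup_le fun n => ?_
    rw [← hpartial n ω, Measure.add_apply, Measure.finsetSum_apply]
    exact le_self_add
  -- Both alternatives of round `n` persist: free points only become fewer, and a vanishing rest at
  -- stage `n + 1` means that the first `n + 1` rounds already cover the cell.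
  · rcases hcell n (s n) ω c with h | h
    · left
      refine measure_mono_null ?_ h
      rintro x ⟨hx, hx'⟩
      refine ⟨hx, ?_⟩
      have hall : ∀ m, (ω, x) ∈ (s m).free := by
        intro m
        induction m with
        | zero => exact Set.mem_univ _
        | succ m ih =>
          rw [hs, hfree]
          exact ⟨ih, fun hd => hx' (Set.mem_iUnion.2 ⟨m, hd⟩)⟩
      exact hall (n + 1)
    · right
      refine Measure.le_iff.2 fun t ht => ?_
      rw [Measure.restrict_apply ht, ← hpartial (n + 1) ω, Measure.add_apply, himage,
        Measure.sum_apply _ ht, Measure.finsetSum_apply]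
      have h0 : (s (n + 1)).rest ω (t ∩ (S n).cell ω c) = 0 :=
        measure_mono_null Set.inter_subset_right h
      rw [h0, add_zero]
      refine le_trans ?_ (ENNReal.sum_le_tsum (Finset.range (n + 1)))
      exact Finset.sum_le_sum fun k _ => measure_mono Set.inter_subset_left

end Iteration

/-! ### Mass transport and the comparison of intensities -/

section MassBalance

variable {d : ℕ} {Ω : Type*} [MeasurableSpace Ω] {θ : MeasurableFlow d Ω}

/-- A flow-invariant event. -/
def IsFlowInvariant (θ : MeasurableFlow d Ω) (E : Set Ω) : Prop :=
  ∀ x ω, θ.shift x ω ∈ E ↔ ω ∈ E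

theorem MeasurableFlow.measurable_shift_right (θ : MeasurableFlow d Ω) (x : Rd d) :
    Measurable (θ.shift x) :=
  θ.measurable_shift.comp (measurable_id.prodMk measurable_const)

theorem measurePreserving_restrict_shift {P : Measure Ω} {E : Set Ω} (hP : θ.Preserves P)
    (hE : MeasurableSet E)
    (hEi : IsFlowInvariant θ E) (y : Rd d) :
    MeasurePreserving (θ.shift y) (P.restrict E) (P.restrict E) := by
  have h := (hP y).restrict_preimage hE
  have h2 : θ.shift y ⁻¹' E = E := Set.ext fun ω => hEi y ω
  rwa [h2] at h

section MassTransport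

variable {P : Measure Ω} [IsProbabilityMeasure P] {E : Set Ω} {ξ : Kernel Ω (Rd d)}
  [IsSFiniteKernel ξ]

/-- Invariance of the Campbell measure. -/
theorem measurePreserving_compProd_shift (hP : θ.Preserves P) (hξ : IsEquivariant θ ξ)
    (hE : MeasurableSet E) (hEi : IsFlowInvariant θ E) (y : Rd d) :
    MeasurePreserving (fun p : Ω × Rd d => (θ.shift y p.1, p.2 - y))
      ((P.restrict E) ⊗ₘ ξ) ((P.restrict E) ⊗ₘ ξ) := by
  have hm : Measurable fun p : Ω × Rd d => (θ.shift y p.1, p.2 - y) :=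
    ((θ.measurable_shift_right y).comp measurable_fst).prodMk (measurable_snd.sub_const y)
  refine ⟨hm, ?_⟩
  ext s hs
  rw [Measure.map_apply hm hs, Measure.compProd_apply (hm hs), Measure.compProd_apply hs,
    ← (measurePreserving_restrict_shift hP hE hEi y).lintegral_comp
      (Kernel.measurable_kernel_prodMk_left hs)]
  refine lintegral_congr fun ω => ?_
  rw [hξ, translate_apply_of_any]
  rfl

/-- The mass transport principle: a partial allocation preserves intensities. -/
theorem lintegral_image_eq (hP : θ.Preserves P) (hξ : IsEquivariant θ ξ) (hE : MeasurableSet E)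
    (hEi : IsFlowInvariant θ E) (T : PartialAllocation θ) {C : Set (Rd d)} (hC : MeasurableSet C)
    (hC0 : volume C ≠ 0) (hC1 : volume C ≠ ∞) :
    ∫⁻ ω in E, T.image ξ ω C ∂P = ∫⁻ ω in E, ξ ω (C ∩ Prod.mk ω ⁻¹' T.dom) ∂P := by
  set ν := (P.restrict E) ⊗ₘ ξ with hν
  have hTm := T.measurable_map
  have hTd := T.measurableSet_dom
  have hA : MeasurableSet {p : Ω × Rd d | p ∈ T.dom ∧ T.map p ∈ C} := hTd.inter (hTm hC)
  have hB : MeasurableSet {p : Ω × Rd d | p.2 ∈ C ∧ p ∈ T.dom} := (measurable_snd hC).inter hTd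
  have h1 : ∫⁻ ω in E, T.image ξ ω C ∂P = ν {p | p ∈ T.dom ∧ T.map p ∈ C} := by
    rw [hν, Measure.compProd_apply hA]
    exact lintegral_congr fun ω => T.image_apply ξ ω hC
  have h2 : ∫⁻ ω in E, ξ ω (C ∩ Prod.mk ω ⁻¹' T.dom) ∂P = ν {p | p.2 ∈ C ∧ p ∈ T.dom} := by
    rw [hν, Measure.compProd_apply hB]
    rfl
  rw [h1, h2]
  -- Double counting: for fixed `w`, the diagonal shift by `w` carries the section of `G` to that of
  -- `H` and preserves the Campbell measure. Integrating out `w` first instead gives a factor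
  -- `volume C` on both sides.
  let G : Set ((Ω × Rd d) × Rd d) := {q | (q.1.2 ∈ C ∧ q.1 ∈ T.dom) ∧ T.map q.1 - q.2 ∈ C}
  let H : Set ((Ω × Rd d) × Rd d) := {q | (q.1 ∈ T.dom ∧ T.map q.1 ∈ C) ∧ q.1.2 + q.2 ∈ C}
  have hG : MeasurableSet G :=
    (measurable_fst hB).inter (((hTm.comp measurable_fst).sub measurable_snd) hC)
  have hH : MeasurableSet H :=
    (measurable_fst hA).inter (((measurable_snd.comp measurable_fst).add measurable_snd) hC)
  have hGv : (ν.prod volume) G = volume C * ν {p | p.2 ∈ C ∧ p ∈ T.dom} := by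
    rw [Measure.prod_apply hG, ← lintegral_indicator_const hB]
    refine lintegral_congr fun p => ?_
    by_cases hp : p ∈ {p : Ω × Rd d | p.2 ∈ C ∧ p ∈ T.dom}
    · rw [Set.indicator_of_mem hp]
      have : Prod.mk p ⁻¹' G = (fun w => T.map p - w) ⁻¹' C := by
        ext w
        exact and_iff_right hp
      rw [this]
      exact (Measure.measurePreserving_sub_left volume (T.map p)).measure_preimage
        hC.nullMeasurableSet
    · rw [Set.indicator_of_notMem hp]
      have : Prod.mk p ⁻¹' G = ∅ := by
        ext w
        exact iff_of_false (fun h => hp h.1) (fun h => h.elim)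
      rw [this, measure_empty]
  have hHv : (ν.prod volume) H = volume C * ν {p | p ∈ T.dom ∧ T.map p ∈ C} := by
    rw [Measure.prod_apply hH, ← lintegral_indicator_const hA]
    refine lintegral_congr fun p => ?_
    by_cases hp : p ∈ {p : Ω × Rd d | p ∈ T.dom ∧ T.map p ∈ C}
    · rw [Set.indicator_of_mem hp]
      have : Prod.mk p ⁻¹' H = (fun w => p.2 + w) ⁻¹' C := by
        ext w
        exact and_iff_right hp
      rw [this, measure_preimage_add]
    · rw [Set.indicator_of_notMem hp]
      have : Prod.mk p ⁻¹' H = ∅ := by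
        ext w
        exact iff_of_false (fun h => hp h.1) (fun h => h.elim)
      rw [this, measure_empty]
  have hGH : (ν.prod volume) G = (ν.prod volume) H := by
    rw [Measure.prod_apply_symm hG, Measure.prod_apply_symm hH]
    refine lintegral_congr fun w => ?_
    have hHw : MeasurableSet ((fun p : Ω × Rd d => (p, w)) ⁻¹' H) := measurable_prodMk_right hH
    rw [← (measurePreserving_compProd_shift hP hξ hE hEi w).measure_preimage
      hHw.nullMeasurableSet]
    congr 1
    ext ⟨ω, x⟩
    show ((x ∈ C ∧ (ω, x) ∈ T.dom) ∧ T.map (ω, x) - w ∈ C) ↔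
      (((θ.shift w ω, x - w) ∈ T.dom ∧ T.map (θ.shift w ω, x - w) ∈ C) ∧ x - w + w ∈ C)
    rw [T.dom_shift, sub_add_cancel]
    constructor
    · rintro ⟨⟨h1, h2⟩, h3⟩
      exact ⟨⟨h2, by rwa [T.map_shift ω x w h2]⟩, h1⟩
    · rintro ⟨⟨h2, h3⟩, h1⟩
      rw [T.map_shift ω x w h2] at h3
      exact ⟨⟨h1, h2⟩, h3⟩
  rw [hGv, hHv] at hGH
  exact ((ENNReal.mul_right_inj hC0 hC1).1 hGH).symm

end MassTransport

theorem eq_of_le_of_forall_inter_ball {μ ν : Measure (Rd d)}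
    (h : ∀ᶠ r : ℕ in Filter.atTop, μ.restrict (Metric.ball 0 r) ≤ ν) : μ ≤ ν := by
  refine Measure.le_iff.2 fun s hs => ?_
  have hmono : Monotone fun r : ℕ => s ∩ Metric.ball (0 : Rd d) r := fun m n hmn =>
    Set.inter_subset_inter_right _ (Metric.ball_subset_ball (Nat.cast_le.2 hmn))
  have hU : ⋃ r : ℕ, s ∩ Metric.ball (0 : Rd d) r = s := by
    rw [← Set.inter_iUnion, Metric.iUnion_ball_nat, Set.inter_univ]
  have hlim := tendsto_measure_iUnion_atTop (μ := μ) hmono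
  rw [hU] at hlim
  refine le_of_tendsto hlim ?_
  filter_upwards [h] with r hr
  have := hr s
  rwa [Measure.restrict_apply hs] at this

/-- Countably many translates suffice, so almost sure statements about `Q` can be spread over the
whole space by stationarity. -/
theorem iUnion_translate_eq_univ {Q : Set (Rd d)} (hQ : (interior Q).Nonempty) :
    ⋃ n : ℕ, (fun y => y - TopologicalSpace.denseSeq (Rd d) n) ⁻¹' Q = Set.univ := by
  refine Set.eq_univ_of_forall fun x => ?_
  have hopen : IsOpen ((fun z => x - z) ⁻¹' interior Q) :=
    isOpen_interior.preimage (continuous_const.sub continuous_id)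
  obtain ⟨q, hq⟩ := hQ
  obtain ⟨n, hn⟩ := (TopologicalSpace.denseRange_denseSeq (Rd d)).exists_mem_open hopen
    ⟨x - q, by simpa using hq⟩
  have hn' : x - TopologicalSpace.denseSeq (Rd d) n ∈ Q := interior_subset hn
  exact Set.mem_iUnion.2 ⟨n, hn'⟩

/-- A partial allocation that covers the target, in all cells that exhaust space, is total and
exact provided that the intensities agree on all invariant events. -/
theorem exists_balancing_partialAllocation {P : Measure Ω} [IsProbabilityMeasure P]
    (hP : θ.Preserves P) (φ : Rd d ≃ᵐ ℝ) (ξ η : Kernel Ω (Rd d))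
    [IsSFiniteKernel ξ] (hξe : IsEquivariant θ ξ) (hηe : IsEquivariant θ η)
    (hξf : ∀ ω, IsLocallyFiniteMeasure (ξ ω)) (hηf : ∀ ω, IsLocallyFiniteMeasure (η ω))
    (hξd : ∀ ω x, ξ ω {x} = 0) (S : ℕ → CellSystem θ)
    (hS : ∀ᵐ ω ∂P, ∀ r : ℕ, ∃ n c, Metric.ball 0 r ⊆ (S n).cell ω c)
    {Q : Set (Rd d)} (hQ : MeasurableSet Q) (hQi : (interior Q).Nonempty)
    (hQb : Bornology.IsBounded Q)
    (hint : ∀ E, MeasurableSet E → IsFlowInvariant θ E →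
      ∫⁻ ω in E, ξ ω Q ∂P = ∫⁻ ω in E, η ω Q ∂P)
    (hfin : ∫⁻ ω, η ω Q ∂P < ∞) :
    ∃ T : PartialAllocation θ, ∀ᵐ ω ∂P, ξ ω (Prod.mk ω ⁻¹' T.domᶜ) = 0 ∧ T.image ξ ω = η ω := by
  obtain ⟨T, hle, hT⟩ :=
    exists_partialAllocation_of_cellSystems φ ξ η hξe hηe hξf hηf hξd S
  refine ⟨T, ?_⟩
  have hQ0 : volume Q ≠ 0 := (Measure.measure_pos_of_nonempty_interior volume hQi).ne'
  have hQ1 : volume Q ≠ ∞ := hQb.measure_lt_top.ne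
  -- The event that `ξ` is completely allocated. It is invariant, so mass transport applies to it
  -- and to its complement.
  let E : Set Ω := {ω | ξ ω (Prod.mk ω ⁻¹' T.domᶜ) = 0}
  have hE : MeasurableSet E :=
    Kernel.measurable_kernel_prodMk_left T.measurableSet_dom.compl (measurableSet_singleton 0)
  have hEi : IsFlowInvariant θ E := fun x ω => by
    show ξ (θ.shift x ω) (Prod.mk (θ.shift x ω) ⁻¹' T.domᶜ) = 0 ↔ ξ ω (Prod.mk ω ⁻¹' T.domᶜ) = 0
    rw [hξe, translate_apply_of_any]
    have : (fun y => y - x) ⁻¹' (Prod.mk (θ.shift x ω) ⁻¹' T.domᶜ) = Prod.mk ω ⁻¹' T.domᶜ :=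
      Set.ext fun z => not_congr (T.dom_shift ω z x)
    rw [this]
  have hEci : IsFlowInvariant θ Eᶜ := fun x ω => not_congr (hEi x ω)
  -- On `E` the image has the same intensity as `ξ`, hence as `η`; being at most `η` with finite
  -- mean, it agrees with `η` on `Q`.
  have hle' : ∀ᵐ ω ∂P, ω ∈ E → T.image ξ ω Q = η ω Q := by
    rw [← ae_restrict_iff' hE]
    refine ae_eq_of_ae_le_of_lintegral_le (Filter.Eventually.of_forall fun ω => hle ω Q) ?_
      (η.measurable_coe hQ).aemeasurable ?_
    · exact ((lintegral_mono fun ω => hle ω Q).trans_lt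
        ((setLIntegral_le_lintegral _ _).trans_lt hfin)).ne
    · rw [← hint E hE hEi, lintegral_image_eq hP hξe hE hEi T hQ hQ0 hQ1]
      refine le_of_eq (setLIntegral_congr_fun hE fun ω hω => ?_)
      refine le_antisymm ?_ (measure_mono Set.inter_subset_left)
      calc ξ ω Q ≤ ξ ω ((Q ∩ Prod.mk ω ⁻¹' T.dom) ∪ Prod.mk ω ⁻¹' T.domᶜ) := by
            refine measure_mono fun x hx => ?_
            by_cases h : (ω, x) ∈ T.dom
            · exact Or.inl ⟨hx, h⟩
            · exact Or.inr h
        _ ≤ _ := measure_union_le _ _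
        _ = ξ ω (Q ∩ Prod.mk ω ⁻¹' T.dom) := by
            rw [show ξ ω (Prod.mk ω ⁻¹' T.domᶜ) = 0 from hω, add_zero]
  -- Off `E` some ball `B` carries unallocated mass. A cell containing a ball larger than `B` cannot
  -- be in the first alternative, so `η` is covered there.
  have hcover : ∀ᵐ ω ∂P, ω ∈ Eᶜ → T.image ξ ω = η ω := by
    filter_upwards [hS] with ω hω hωE
    refine le_antisymm (hle ω) (eq_of_le_of_forall_inter_ball ?_)
    have hex : ∃ r₀ : ℕ, ξ ω (Metric.ball 0 r₀ \ Prod.mk ω ⁻¹' T.dom) ≠ 0 := by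
      by_contra hcon
      push Not at hcon
      refine hωE ?_
      show ξ ω (Prod.mk ω ⁻¹' T.domᶜ) = 0
      refine measure_mono_null ?_ (measure_iUnion_null hcon)
      intro x hx
      have : x ∈ ⋃ n : ℕ, Metric.ball (0 : Rd d) n := by
        rw [Metric.iUnion_ball_nat]
        exact Set.mem_univ x
      obtain ⟨n, hn⟩ := Set.mem_iUnion.1 this
      exact Set.mem_iUnion.2 ⟨n, hn, hx⟩
    obtain ⟨r₀, hr₀⟩ := hex
    filter_upwards [Filter.eventually_ge_atTop r₀] with r hr
    obtain ⟨n, c, hnc⟩ := hω r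
    rcases hT n ω c with h | h
    · refine absurd (measure_mono_null ?_ h) hr₀
      exact Set.sdiff_subset_sdiff_left
        ((Metric.ball_subset_ball (Nat.cast_le.2 hr)).trans hnc)
    · exact (Measure.restrict_mono hnc le_rfl).trans h
  -- Off `E` the allocated part of `ξ` has the intensity of `η`, hence that of `ξ`, so nothing in
  -- `Q` is left. Over all translates of `Q` this contradicts the definition of `E`, so `E` has
  -- probability one.
  have hnull : ∀ᵐ ω ∂P, ω ∈ Eᶜ → ξ ω (Q \ Prod.mk ω ⁻¹' T.dom) = 0 := by
    have hsum : ∀ ω, ξ ω (Q ∩ Prod.mk ω ⁻¹' T.dom) ≤ ξ ω Q := fun ω =>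
      measure_mono Set.inter_subset_left
    have hfinE : ∫⁻ ω in Eᶜ, ξ ω Q ∂P ≠ ∞ := by
      rw [hint _ hE.compl hEci]
      exact ((setLIntegral_le_lintegral _ _).trans_lt hfin).ne
    have hae : (fun ω => ξ ω (Q ∩ Prod.mk ω ⁻¹' T.dom)) =ᵐ[P.restrict Eᶜ] fun ω => ξ ω Q := by
      refine ae_eq_of_ae_le_of_lintegral_le (Filter.Eventually.of_forall hsum)
        ((lintegral_mono hsum).trans_lt hfinE.lt_top).ne (ξ.measurable_coe hQ).aemeasurable ?_
      rw [hint _ hE.compl hEci, ← lintegral_image_eq hP hξe hE.compl hEci T hQ hQ0 hQ1]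
      refine le_of_eq (lintegral_congr_ae ?_)
      filter_upwards [(ae_restrict_iff' hE.compl).2 hcover] with ω hω
      rw [hω]
    refine (ae_restrict_iff' hE.compl).1 ?_
    filter_upwards [hae] with ω hω
    have := hξf ω
    have h1 := measure_inter_add_sdiff (μ := ξ ω) Q (T.measurableSet_dom_mk ω)
    rw [hω] at h1
    have hfinQ : ξ ω Q ≠ ∞ := hQb.measure_lt_top.ne
    exact (ENNReal.add_right_inj hfinQ).1 (h1.trans (add_zero _).symm)
  have htrans : ∀ {p : Ω → Prop}, (∀ᵐ ω ∂P, p ω) →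
      ∀ᵐ ω ∂P, ∀ n : ℕ, p (θ.shift (TopologicalSpace.denseSeq (Rd d) n) ω) := fun h =>
    ae_all_iff.2 fun n => (hP _).quasiMeasurePreserving.ae h
  have hU := iUnion_translate_eq_univ hQi
  filter_upwards [htrans hle', htrans hnull] with ω h1 h2
  have hωE : ω ∈ E := by
    by_contra hωE
    refine hωE ?_
    show ξ ω (Prod.mk ω ⁻¹' T.domᶜ) = 0
    refine measure_mono_null ?_ (measure_iUnion_null fun n : ℕ => ?_)
      (t := ⋃ n : ℕ, (fun y => y - TopologicalSpace.denseSeq (Rd d) n) ⁻¹' Q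
        \ Prod.mk ω ⁻¹' T.dom)
    · intro x hx
      obtain ⟨n, hn⟩ := Set.mem_iUnion.1 (hU.symm ▸ Set.mem_univ x)
      exact Set.mem_iUnion.2 ⟨n, hn, hx⟩
    · have := h2 n ((hEci _ _).2 hωE)
      rw [hξe, translate_apply_of_any] at this
      rw [← this]
      congr 1
      ext z
      exact and_congr_right fun _ => not_congr (T.dom_shift ω z _).symm
  refine ⟨hωE, ?_⟩
  have := hηf ω
  have := isLocallyFiniteMeasure_of_le (hle ω)
  have hQeq : ∀ n : ℕ, (T.image ξ ω).restrict
      ((fun y => y - TopologicalSpace.denseSeq (Rd d) n) ⁻¹' Q) = (η ω).restrict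
      ((fun y => y - TopologicalSpace.denseSeq (Rd d) n) ⁻¹' Q) := by
    intro n
    have hm := measurable_sub_right (TopologicalSpace.denseSeq (Rd d) n) hQ
    have hb : η ω ((fun y => y - TopologicalSpace.denseSeq (Rd d) n) ⁻¹' Q) < ∞ := by
      have := hηf (θ.shift (TopologicalSpace.denseSeq (Rd d) n) ω)
      rw [← translate_apply _ _ hQ, ← hηe]
      exact hQb.measure_lt_top
    have : IsFiniteMeasure ((T.image ξ ω).restrict
        ((fun y => y - TopologicalSpace.denseSeq (Rd d) n) ⁻¹' Q)) :=
      ⟨by rw [Measure.restrict_apply_univ]; exact (hle ω _).trans_lt hb⟩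
    refine Measure.eq_of_le_of_measure_univ_eq (Measure.restrict_mono le_rfl (hle ω)) ?_
    have h := h1 n ((hEi _ _).2 hωE)
    rw [Measure.restrict_apply_univ, Measure.restrict_apply_univ, ← translate_apply _ _ hQ,
      ← translate_apply _ _ hQ, ← hηe, ← T.isEquivariant_image hξe, h]
  exact Measure.ext_of_iUnion_eq_univ hU hQeq

end MassBalance

/-! ### Cells around isolated clusters -/

section PoissonCells

open Metric

variable {d : ℕ} {Ω : Type*} [MeasurableSpace Ω] {θ : MeasurableFlow d Ω}

/-- `μ` has mass near `c`, and none in the rest of a ball around `c` of radius `3 * R`. -/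
def IsCluster (μ : Measure (Rd d)) (R : ℝ) (c : Rd d) : Prop :=
  μ (ball c (3 * R) \ ball c 1) = 0 ∧ 0 < μ (ball c 1)

/-- The ball around `y` contains the cluster and stays within distance `2R + 1 ≤ 3R` of `c`. So
every observer within `R` of `c` sees the same mass and computes the same barycentre. -/
theorem IsCluster.restrict_ball_eq {μ : Measure (Rd d)} {R : ℝ} {c y : Rd d}
    (h : IsCluster μ R c) (hR : 1 ≤ R) (hy : dist y c < R) :
    μ.restrict (ball y (R + 1)) = μ.restrict (ball c 1) := by
  have h1 : ball c 1 ⊆ ball y (R + 1) := ball_subset_ball' (by rw [dist_comm]; linarith)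
  have h2 : ball y (R + 1) ⊆ ball c (3 * R) := ball_subset_ball' (by linarith)
  refine Measure.restrict_congr_set (Filter.EventuallyEq.symm ?_)
  refine ae_eq_set.2 ⟨by rw [Set.sdiff_eq_empty.2 h1, measure_empty], ?_⟩
  exact measure_mono_null (Set.sdiff_subset_sdiff_left h2) h.1

theorem isCluster_translate {μ : Measure (Rd d)} {R : ℝ} {c : Rd d} (y : Rd d) :
    IsCluster (translate y μ) R (c - y) ↔ IsCluster μ R c := by
  unfold IsCluster
  rw [translate_apply_of_any, translate_apply_of_any, Set.preimage_sdiff, preimage_sub_ball,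
    preimage_sub_ball, sub_add_cancel]

theorem integrableOn_id_ball (μ : Measure (Rd d)) [IsLocallyFiniteMeasure μ] (y : Rd d) (r : ℝ) :
    IntegrableOn (fun z : Rd d => z) (ball y r) μ :=
  (continuous_id.continuousOn.integrableOn_compact (isCompact_closedBall y r)).mono_set
    ball_subset_closedBall

/-- Positivity is essential: the average over a null set is `0` by convention, which is not
equivariant. -/
theorem average_ball_translate {μ : Measure (Rd d)} [IsLocallyFiniteMeasure μ] {y : Rd d} {r : ℝ}
    (h : 0 < μ (ball y r)) (a : Rd d) :
    ⨍ z in ball (y - a) r, z ∂(translate a μ) = (⨍ z in ball y r, z ∂μ) - a := by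
  have hfin : μ (ball y r) ≠ ∞ := isBounded_ball.measure_lt_top.ne
  have hpre : (fun z => z - a) ⁻¹' ball (y - a) r = ball y r := by
    rw [preimage_sub_ball, sub_add_cancel]
  have hreal : (μ (ball y r)).toReal ≠ 0 := (ENNReal.toReal_pos h.ne' hfin).ne'
  rw [setAverage_eq, setAverage_eq, measureReal_def, translate_apply_of_any, hpre, translate,
    (measurableEmbedding_sub_right a).setIntegral_map, hpre,
    integral_sub (integrableOn_id_ball μ y r) (integrableOn_const hfin), setIntegral_const,
    smul_sub, smul_smul, measureReal_def, inv_mul_cancel₀ hreal, one_smul]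

theorem measurable_average_ball (χ : Kernel Ω (Rd d)) [IsSFiniteKernel χ] (v : Rd d) (r : ℝ) :
    Measurable fun p : Ω × Rd d => ⨍ z in ball (p.2 - v) r, z ∂(χ p.1) := by
  have hset : MeasurableSet {q : (Ω × Rd d) × Rd d | q.2 ∈ ball (q.1.2 - v) r} := by
    have h1 : Measurable fun q : (Ω × Rd d) × Rd d => dist q.2 (q.1.2 - v) := by fun_prop
    exact h1 measurableSet_Iio
  have h1 : Measurable fun p : Ω × Rd d => χ p.1 (ball (p.2 - v) r) :=
    Kernel.measurable_kernel_prodMk_left (κ := χ.comap Prod.fst measurable_fst) hset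
  have h2 : Measurable fun p : Ω × Rd d => ∫ z in ball (p.2 - v) r, z ∂(χ p.1) := by
    have h3 : StronglyMeasurable fun q : (Ω × Rd d) × Rd d =>
        {q : (Ω × Rd d) × Rd d | q.2 ∈ ball (q.1.2 - v) r}.indicator (fun q => q.2) q :=
      (measurable_snd.indicator hset).stronglyMeasurable
    have h4 := (h3.integral_kernel_prod_right' (κ := χ.comap Prod.fst measurable_fst)).measurable
    have h5 : (fun p : Ω × Rd d => ∫ z in ball (p.2 - v) r, z ∂(χ p.1)) = fun p =>
        ∫ z, {q : (Ω × Rd d) × Rd d | q.2 ∈ ball (q.1.2 - v) r}.indicator (fun q => q.2) (p, z)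
          ∂(χ p.1) := by
      funext p
      rw [← integral_indicator measurableSet_ball]
      rfl
    rw [h5]
    exact h4
  simp only [setAverage_eq]
  exact (h1.ennreal_toReal.inv).smul h2

theorem measurableSet_isCluster (χ : Kernel Ω (Rd d)) [IsSFiniteKernel χ] (R : ℝ)
    {l : Ω × Rd d → Rd d} (hl : Measurable l) :
    MeasurableSet {p : Ω × Rd d | IsCluster (χ p.1) R (l p)} := by
  have hd : Measurable fun q : (Ω × Rd d) × Rd d => dist q.2 (l q.1) :=
    measurable_snd.dist (hl.comp measurable_fst)
  have hball : ∀ r : ℝ, MeasurableSet {q : (Ω × Rd d) × Rd d | q.2 ∈ ball (l q.1) r} :=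
    fun r => hd measurableSet_Iio
  have h1 : Measurable fun p : Ω × Rd d => χ p.1 (ball (l p) (3 * R) \ ball (l p) 1) :=
    Kernel.measurable_kernel_prodMk_left (κ := χ.comap Prod.fst measurable_fst)
      ((hball (3 * R)).diff (hball 1))
  have h2 : Measurable fun p : Ω × Rd d => χ p.1 (ball (l p) 1) :=
    Kernel.measurable_kernel_prodMk_left (κ := χ.comap Prod.fst measurable_fst) (hball 1)
  exact (h1 (measurableSet_singleton 0)).inter (h2 measurableSet_Ioi)

section

variable (χ : Kernel Ω (Rd d)) (R : ℝ) (v : Rd d)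

/-- The barycentre of `χ` around `x - v`. -/
noncomputable def clusterLabel (p : Ω × Rd d) : Rd d := ⨍ z in ball (p.2 - v) (R + 1), z ∂(χ p.1)

/-- The balls of radius `R` around `c + v`, for all clusters `c`. -/
def clusterCarrier : Set (Ω × Rd d) :=
  {p | IsCluster (χ p.1) R (clusterLabel χ R v p) ∧ dist (p.2 - v) (clusterLabel χ R v p) < R}

variable {χ R v}

theorem measure_ball_pos_of_isCluster {μ : Measure (Rd d)} {c y : Rd d} (h : IsCluster μ R c)
    (hy : dist y c < R) : 0 < μ (ball y (R + 1)) :=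
  h.2.trans_le (measure_mono (ball_subset_ball' (by rw [dist_comm]; linarith)))

theorem clusterLabel_shift_of_pos (hχe : IsEquivariant θ χ)
    (hχf : ∀ ω, IsLocallyFiniteMeasure (χ ω)) {ω : Ω} {x : Rd d}
    (h : 0 < χ ω (ball (x - v) (R + 1))) (y : Rd d) :
    clusterLabel χ R v (θ.shift y ω, x - y) = clusterLabel χ R v (ω, x) - y := by
  have := hχf ω
  unfold clusterLabel
  simp only
  rw [hχe, ← average_ball_translate h, sub_right_comm]

theorem clusterLabel_shift (hχe : IsEquivariant θ χ) (hχf : ∀ ω, IsLocallyFiniteMeasure (χ ω))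
    {ω : Ω} {x : Rd d} (h : (ω, x) ∈ clusterCarrier χ R v) (y : Rd d) :
    clusterLabel χ R v (θ.shift y ω, x - y) = clusterLabel χ R v (ω, x) - y :=
  clusterLabel_shift_of_pos hχe hχf (measure_ball_pos_of_isCluster h.1 h.2) y

theorem mem_clusterCarrier_shift (hχe : IsEquivariant θ χ)
    (hχf : ∀ ω, IsLocallyFiniteMeasure (χ ω)) {ω : Ω} {x : Rd d}
    (h : (ω, x) ∈ clusterCarrier χ R v) (y : Rd d) :
    (θ.shift y ω, x - y) ∈ clusterCarrier χ R v := by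
  have hl := clusterLabel_shift hχe hχf h y
  refine ⟨?_, ?_⟩
  · rw [hl, hχe]
    exact (isCluster_translate y).2 h.1
  · rw [hl, sub_right_comm, dist_sub_right]
    exact h.2

theorem mem_clusterCarrier_of_isCluster (hR : 1 ≤ R) {ω : Ω} {c : Rd d}
    (hc : IsCluster (χ ω) R c) (hcc : ⨍ z in ball c 1, z ∂(χ ω) = c) {x : Rd d}
    (hx : dist (x - v) c < R) :
    (ω, x) ∈ clusterCarrier χ R v ∧ clusterLabel χ R v (ω, x) = c := by
  have hl : clusterLabel χ R v (ω, x) = c := by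
    unfold clusterLabel
    simp only
    rw [hc.restrict_ball_eq hR hx, hcc]
  refine ⟨⟨?_, ?_⟩, hl⟩
  · rw [hl]; exact hc
  · rw [hl]; exact hx

/-- One point with label `c` shows that `c` is the barycentre of its own cluster; then every point
of the ball computes the same label. -/
theorem clusterCell_eq (hR : 1 ≤ R) {ω : Ω} {c : Rd d}
    (hne : {x | (ω, x) ∈ clusterCarrier χ R v ∧ clusterLabel χ R v (ω, x) = c}.Nonempty) :
    {x | (ω, x) ∈ clusterCarrier χ R v ∧ clusterLabel χ R v (ω, x) = c} = ball (c + v) R := by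
  obtain ⟨x₀, hx₀, hc₀⟩ := hne
  have hc : IsCluster (χ ω) R c := hc₀ ▸ hx₀.1
  have hcc : ⨍ z in ball c 1, z ∂(χ ω) = c := by
    rw [← hc.restrict_ball_eq hR (hc₀ ▸ hx₀.2)]
    exact hc₀
  ext x
  have hdist : dist x (c + v) = dist (x - v) c := by
    rw [dist_eq_norm, dist_eq_norm]; congr 1; abel
  rw [mem_ball, hdist, Set.mem_ofPred_eq]
  constructor
  · rintro ⟨h, rfl⟩
    exact h.2
  · exact mem_clusterCarrier_of_isCluster hR hc hcc

/-- The cell system of balls around (shifted) isolated clusters. -/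
noncomputable def clusterCells [IsSFiniteKernel χ] (hχe : IsEquivariant θ χ)
    (hχf : ∀ ω, IsLocallyFiniteMeasure (χ ω)) (hR : 1 ≤ R) (v : Rd d) : CellSystem θ where
  carrier := clusterCarrier χ R v
  label := clusterLabel χ R v
  measurableSet_carrier :=
    (measurableSet_isCluster χ R (measurable_average_ball χ v (R + 1))).inter
      (((measurable_snd.sub_const v).dist (measurable_average_ball χ v (R + 1))) measurableSet_Iio)
  measurable_label := measurable_average_ball χ v (R + 1)
  carrier_shift := fun ω x y => by
    refine ⟨fun h => ?_, fun h => mem_clusterCarrier_shift hχe hχf h y⟩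
    -- The converse implication is the direct one for the inverse shift.
    have := mem_clusterCarrier_shift hχe hχf h (-y)
    rwa [θ.shift_shift, neg_add_cancel, θ.shift_zero, sub_sub, add_neg_cancel, sub_zero] at this
  label_shift := fun ω x y h => clusterLabel_shift hχe hχf h y
  isOpen_cell := fun ω c => by
    rcases Set.eq_empty_or_nonempty
      {x | (ω, x) ∈ clusterCarrier χ R v ∧ clusterLabel χ R v (ω, x) = c} with h | h
    · rw [h]; exact isOpen_empty
    · rw [clusterCell_eq hR h]; exact isOpen_ball
  isBounded_cell := fun ω c => by
    rcases Set.eq_empty_or_nonempty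
      {x | (ω, x) ∈ clusterCarrier χ R v ∧ clusterLabel χ R v (ω, x) = c} with h | h
    · rw [h]; exact Bornology.isBounded_empty
    · rw [clusterCell_eq hR h]; exact isBounded_ball

/-- An isolated cluster in the weaker sense of the hypotheses yields, for every shift `v`, a cell
containing the ball with centre `c + v`. -/
theorem exists_ball_subset_clusterCell [IsSFiniteKernel χ] (hχe : IsEquivariant θ χ)
    (hχf : ∀ ω, IsLocallyFiniteMeasure (χ ω)) (hR : 1 ≤ R) {ω : Ω} {z : Rd d}
    (h0 : 0 < χ ω (ball z (1 / 2))) (h1 : χ ω (ball z (3 * R + 1) \ ball z (1 / 2)) = 0) :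
    ∃ c, ∀ v, ball (c + v) R ⊆ (clusterCells hχe hχf hR v).cell ω c := by
  have := hχf ω
  have hfin : χ ω (ball z (1 / 2)) ≠ ∞ := isBounded_ball.measure_lt_top.ne
  -- The point `z` need not be the barycentre, but by convexity the barycentre is within `1/2` of
  -- it. The inner radius `1` in `IsCluster` and the extra `1` in the outer radius absorb this
  -- displacement.
  set c := ⨍ y in ball z (1 / 2), y ∂(χ ω) with hcdef
  have hcz : c ∈ closedBall z (1 / 2) := by
    refine (convex_closedBall z (1 / 2)).set_average_mem isClosed_closedBall h0.ne' hfin ?_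
      (integrableOn_id_ball _ _ _)
    exact (ae_restrict_iff' measurableSet_ball).2
      (Filter.Eventually.of_forall fun x hx => ball_subset_closedBall hx)
  rw [mem_closedBall] at hcz
  have hsub1 : ball z (1 / 2) ⊆ ball c 1 := ball_subset_ball' (by rw [dist_comm]; linarith)
  have hsub2 : ball c (3 * R) ⊆ ball z (3 * R + 1) := ball_subset_ball' (by linarith)
  have hc : IsCluster (χ ω) R c := by
    refine ⟨measure_mono_null (Set.sdiff_subset_sdiff hsub2 hsub1) h1, ?_⟩
    exact h0.trans_le (measure_mono hsub1)
  have hcc : ⨍ y in ball c 1, y ∂(χ ω) = c := by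
    have hr : (χ ω).restrict (ball c 1) = (χ ω).restrict (ball z (1 / 2)) := by
      refine Measure.restrict_congr_set (Filter.EventuallyEq.symm ?_)
      refine ae_eq_set.2 ⟨by rw [Set.sdiff_eq_empty.2 hsub1, measure_empty], ?_⟩
      refine measure_mono_null (Set.sdiff_subset_sdiff_left ?_) h1
      exact (ball_subset_ball (by linarith)).trans hsub2
    rw [hr]
  refine ⟨c, fun v x hx => mem_clusterCarrier_of_isCluster hR hc hcc ?_⟩
  rw [mem_ball, dist_eq_norm] at hx
  rw [dist_eq_norm]
  convert hx using 2
  abel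

end

/-- If `χ` has arbitrarily well isolated clusters, then there are countably many cell systems whose
cells exhaust `ℝ^d`. -/
theorem exists_cellSystems (χ : Kernel Ω (Rd d)) (hχe : IsEquivariant θ χ)
    (hχf : ∀ ω, IsLocallyFiniteMeasure (χ ω)) :
    ∃ S : ℕ → CellSystem θ, ∀ ω, (∀ R : ℕ, ∃ z, 0 < χ ω (ball z (1 / 2)) ∧
      χ ω (ball z (3 * ((R : ℝ) + 1) + 1) \ ball z (1 / 2)) = 0) →
      ∀ r : ℕ, ∃ n c, ball 0 r ⊆ (S n).cell ω c := by
  have hsf : IsSFiniteKernel χ := isSFiniteKernel_of_isLocallyFinite _ hχf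
  have hR : ∀ R : ℕ, (1 : ℝ) ≤ (R : ℝ) + 1 := fun R => by
    have : (0 : ℝ) ≤ R := Nat.cast_nonneg R
    linarith
  -- The index codes a pair (radius, displacement). For the ball of radius `r` take cells of radius
  -- `r + 1` and a displacement within `1` of `-c`, which brings the cell centre within `1` of the
  -- origin.
  refine ⟨fun n => clusterCells hχe hχf (hR n.unpair.1)
    (TopologicalSpace.denseSeq (Rd d) n.unpair.2), fun ω hω r => ?_⟩
  obtain ⟨z, hz0, hz1⟩ := hω r
  obtain ⟨c, hc⟩ := exists_ball_subset_clusterCell hχe hχf (hR r) hz0 hz1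
  obtain ⟨k, hk⟩ := (TopologicalSpace.denseRange_denseSeq (Rd d)).exists_mem_open
    (isOpen_ball (x := -c) (ε := 1)) ⟨-c, mem_ball_self one_pos⟩
  refine ⟨Nat.pair r k, c, ?_⟩
  have hsub : ball (0 : Rd d) r ⊆ ball (c + TopologicalSpace.denseSeq (Rd d) k) ((r : ℝ) + 1) := by
    refine ball_subset_ball' ?_
    rw [mem_ball, dist_eq_norm, sub_neg_eq_add, add_comm] at hk
    rw [dist_eq_norm, zero_sub, norm_neg]
    linarith
  refine hsub.trans ?_
  simp only [Nat.unpair_pair]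
  exact hc _

end PoissonCells

/-! ### Isolated clusters of a Poisson process -/

section PoissonProperties

open Metric

variable {d : ℕ} {Ω : Type*} [MeasurableSpace Ω]

namespace IsPoissonProcess

variable {P : Measure Ω} {c : ℝ≥0} {χ : Ω → Measure (Rd d)}

theorem measurable_apply (h : IsPoissonProcess P c χ) {B : Set (Rd d)} (hB : MeasurableSet B) :
    Measurable fun ω => χ ω B :=
  (Measure.measurable_coe hB).comp h.measurable

theorem measure_eq_nat (h : IsPoissonProcess P c χ) {B : Set (Rd d)} (hB : MeasurableSet B)
    (hv : volume B < ∞) (n : ℕ) :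
    P ((fun ω => χ ω B) ⁻¹' {(n : ℝ≥0∞)}) = poissonMeasure (c * (volume B).toNNReal) {n} := by
  rw [← Measure.map_apply (h.measurable_apply hB) (measurableSet_singleton _), h.law B hB hv,
    Measure.map_apply (measurable_of_countable _) (measurableSet_singleton _)]
  congr 1
  ext m
  simp

theorem measure_eq_zero_pos (h : IsPoissonProcess P c χ) {B : Set (Rd d)} (hB : MeasurableSet B)
    (hv : volume B < ∞) : 0 < P ((fun ω => χ ω B) ⁻¹' {0}) := by
  have := h.measure_eq_nat hB hv 0
  rw [Nat.cast_zero] at this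
  rw [this, poissonMeasure_singleton]
  simp only [pow_zero, mul_one, Nat.factorial_zero, Nat.cast_one, div_one]
  exact ENNReal.ofReal_pos.2 (Real.exp_pos _)

theorem measure_eq_one_pos (h : IsPoissonProcess P c χ) (hc : 0 < c) {B : Set (Rd d)}
    (hB : MeasurableSet B) (hv : volume B < ∞) (hv0 : 0 < volume B) :
    0 < P ((fun ω => χ ω B) ⁻¹' {1}) := by
  have := h.measure_eq_nat hB hv 1
  rw [Nat.cast_one] at this
  rw [this, poissonMeasure_singleton]
  have hpos : 0 < c * (volume B).toNNReal := mul_pos hc (ENNReal.toNNReal_pos hv0.ne' hv.ne)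
  refine ENNReal.ofReal_pos.2 ?_
  have : (0 : ℝ) < ((c * (volume B).toNNReal : ℝ≥0) : ℝ) := hpos
  positivity

theorem iIndepFun_of_disjoint {ι : Type*} (h : IsPoissonProcess P c χ) (B : ι → Set (Rd d))
    (hB : ∀ i, MeasurableSet (B i)) (hv : ∀ i, volume (B i) < ∞)
    (hd : Pairwise fun i j => Disjoint (B i) (B j)) : iIndepFun (fun i ω => χ ω (B i)) P := by
  rw [iIndepFun_iff_finset]
  intro s
  have h1 := h.indep s.card (fun i => B (s.equivFin.symm i)) (fun i => hB _) (fun i => hv _)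
    (fun i j hij => hd fun he => hij (s.equivFin.symm.injective (Subtype.ext he)))
  have h2 := h1.precomp s.equivFin.injective
  convert h2 using 3
  simp

/-- Almost surely, a Poisson process has arbitrarily well isolated clusters. -/
theorem ae_exists_isolated [IsProbabilityMeasure P] (hd : 1 ≤ d) (h : IsPoissonProcess P c χ)
    (hc : 0 < c) {L : ℝ} (hL : 1 ≤ L) :
    ∃ z : ℕ → Rd d, ∀ᵐ ω ∂P, ∃ k, 0 < χ ω (ball (z k) (1 / 2)) ∧
      χ ω (ball (z k) L \ ball (z k) (1 / 2)) = 0 := by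
  let e : Rd d := EuclideanSpace.single ⟨0, hd⟩ (1 : ℝ)
  have he : ‖e‖ = 1 := by simp [e]
  -- Spacing `2L` makes the balls of radius `L` disjoint, so the configurations in them are
  -- independent.
  let z : ℕ → Rd d := fun k => (2 * L * k) • e
  have hzd : ∀ j k, j ≠ k → 2 * L ≤ dist (z j) (z k) := by
    intro j k hjk
    have h1 : (1 : ℝ) ≤ |(j : ℝ) - k| := by
      have : (1 : ℤ) ≤ |(j : ℤ) - k| := Int.one_le_abs (sub_ne_zero.2 (by exact_mod_cast hjk))
      exact_mod_cast this
    rw [dist_eq_norm, ← sub_smul, norm_smul, he, mul_one, ← mul_sub, norm_mul, Real.norm_eq_abs,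
      Real.norm_eq_abs, abs_of_pos (by linarith : 0 < 2 * L)]
    nlinarith
  let B : ℕ × Bool → Set (Rd d) := fun i =>
    if i.2 then ball (z i.1) (1 / 2) else ball (z i.1) L \ ball (z i.1) (1 / 2)
  have hBsub : ∀ i, B i ⊆ ball (z i.1) L := by
    rintro ⟨k, _ | _⟩
    · exact Set.sdiff_subset
    · exact ball_subset_ball (by linarith)
  have hBm : ∀ i, MeasurableSet (B i) := by
    rintro ⟨k, _ | _⟩
    · exact measurableSet_ball.diff measurableSet_ball
    · exact measurableSet_ball
  have hBv : ∀ i, volume (B i) < ∞ := fun i => (isBounded_ball.subset (hBsub i)).measure_lt_top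
  have hBd : Pairwise fun i j => Disjoint (B i) (B j) := by
    rintro ⟨j, a⟩ ⟨k, b⟩ hne
    by_cases hjk : j = k
    · subst hjk
      have hab : a ≠ b := fun hab => hne (by rw [hab])
      rcases a with _ | _ <;> rcases b with _ | _
      · exact absurd rfl hab
      · exact Set.disjoint_sdiff_left
      · exact Set.disjoint_sdiff_right
      · exact absurd rfl hab
    · exact (ball_disjoint_ball (by linarith [hzd j k hjk])).mono (hBsub _) (hBsub _)
  have hind := h.iIndepFun_of_disjoint B hBm hBv hBd
  -- Exactly one point in the inner ball and none in the rest of the large ball: events of the same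
  -- positive probability for every `k`, so the second Borel–Cantelli lemma applies.
  let V : ℕ × Bool → Set ℝ≥0∞ := fun i => if i.2 then {1} else {0}
  have hV : ∀ i, MeasurableSet (V i) := fun i => by
    simp only [V]
    split_ifs <;> exact measurableSet_singleton _
  let A : ℕ → Set Ω := fun k =>
    (fun ω => χ ω (B (k, true))) ⁻¹' V (k, true) ∩ (fun ω => χ ω (B (k, false))) ⁻¹' V (k, false)
  have hAm : ∀ k, MeasurableSet (A k) := fun k =>
    (h.measurable_apply (hBm _) (hV _)).inter (h.measurable_apply (hBm _) (hV _))
  have hprod : ∀ s : Finset ℕ, P (⋂ k ∈ s, A k) = ∏ k ∈ s,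
      (P ((fun ω => χ ω (B (k, true))) ⁻¹' V (k, true)) *
        P ((fun ω => χ ω (B (k, false))) ⁻¹' V (k, false))) := by
    intro s
    have h1 := hind.measure_inter_preimage_eq_mul (s ×ˢ Finset.univ) (sets := V)
      (fun i _ => hV i)
    rw [Finset.prod_product] at h1
    simp only [Fintype.prod_bool] at h1
    rw [← h1]
    congr 1
    ext ω
    simp only [A, Set.mem_iInter, Finset.mem_product, Finset.mem_univ, and_true, Prod.forall,
      Bool.forall_bool, Set.mem_inter_iff, forall_and]
    tauto
  have hA1 : ∀ k, P (A k) = P ((fun ω => χ ω (B (k, true))) ⁻¹' V (k, true)) *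
        P ((fun ω => χ ω (B (k, false))) ⁻¹' V (k, false)) := fun k => by
    have := hprod {k}
    simpa using this
  have hAi : iIndepSet A P := by
    rw [iIndepSet_iff_meas_biInter hAm]
    intro s
    rw [hprod s]
    exact Finset.prod_congr rfl fun k _ => (hA1 k).symm
  have hvol : ∀ k b, volume (B (k, b)) = volume (B (0, b)) := by
    have htr : ∀ k r, ball (z k) r = (fun y => y - z k) ⁻¹' ball 0 r := fun k r => by
      rw [preimage_sub_ball, zero_add]
    have hz0 : z 0 = 0 := by simp [z]
    rintro k (_ | _)
    · show volume (ball (z k) L \ ball (z k) (1 / 2)) = volume (ball (z 0) L \ ball (z 0) (1 / 2))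
      rw [htr, htr, ← Set.preimage_sdiff, hz0]
      exact (measurePreserving_sub_right volume (z k)).measure_preimage
        (measurableSet_ball.diff measurableSet_ball).nullMeasurableSet
    · show volume (ball (z k) (1 / 2)) = volume (ball (z 0) (1 / 2))
      rw [htr, hz0]
      exact (measurePreserving_sub_right volume (z k)).measure_preimage
        measurableSet_ball.nullMeasurableSet
  have hconst : ∀ k, P (A k) = P (A 0) := fun k => by
    have t1 := h.measure_eq_nat (hBm (k, true)) (hBv _) 1
    have t2 := h.measure_eq_nat (hBm (0, true)) (hBv _) 1
    have f1 := h.measure_eq_nat (hBm (k, false)) (hBv _) 0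
    have f2 := h.measure_eq_nat (hBm (0, false)) (hBv _) 0
    rw [hvol k true, ← t2, Nat.cast_one] at t1
    rw [hvol k false, ← f2, Nat.cast_zero] at f1
    rw [hA1, hA1]
    exact congrArg₂ _ t1 f1
  have hA0 : P (A 0) ≠ 0 := by
    rw [hA1]
    refine mul_ne_zero ?_ ?_
    · exact (h.measure_eq_one_pos hc (hBm (0, true)) (hBv _)
        (measure_ball_pos volume (z 0) (by norm_num))).ne'
    · exact (h.measure_eq_zero_pos (hBm (0, false)) (hBv _)).ne'
  have hsum : ∑' k, P (A k) = ∞ := by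
    simp only [hconst]
    exact ENNReal.tsum_const_eq_top_of_ne_zero hA0
  have hlim := measure_limsup_eq_one hAm hAi hsum
  have hae : ∀ᵐ ω ∂P, ω ∈ Filter.limsup A Filter.atTop :=
    (mem_ae_iff_prob_eq_one₀ (MeasurableSet.measurableSet_limsup hAm).nullMeasurableSet).2 hlim
  refine ⟨z, ?_⟩
  filter_upwards [hae] with ω hω
  obtain ⟨k, hk1, hk0⟩ := (Filter.mem_limsup_iff_frequently_mem.1 hω).exists
  have e1 : χ ω (ball (z k) (1 / 2)) = 1 := hk1
  exact ⟨k, by rw [e1]; exact one_pos, hk0⟩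

end IsPoissonProcess

end PoissonProperties

/-! ### The canonical space of locally finite measures -/

section LocallyFinite

open Metric

variable {d : ℕ}

/-- The space of locally finite measures on `ℝ^d`. -/
abbrev LocFin (d : ℕ) : Type := {μ : Measure (Rd d) // IsLocallyFiniteMeasure μ}

theorem measurableSet_isLocallyFiniteMeasure :
    MeasurableSet {μ : Measure (Rd d) | IsLocallyFiniteMeasure μ} := by
  have : {μ : Measure (Rd d) | IsLocallyFiniteMeasure μ}
      = ⋂ n : ℕ, {μ | μ (closedBall 0 n) < ∞} := by
    ext μ
    simp only [Set.mem_ofPred_eq, Set.mem_iInter]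
    exact ⟨fun h n => isBounded_closedBall.measure_lt_top,
      isLocallyFiniteMeasure_of_forall_closedBall⟩
  rw [this]
  exact MeasurableSet.iInter fun n =>
    Measure.measurable_coe measurableSet_closedBall measurableSet_Iio

/-- The identity, as a kernel from the space of locally finite measures. -/
noncomputable def locFinKernel (d : ℕ) : Kernel (LocFin d) (Rd d) :=
  ⟨Subtype.val, measurable_subtype_coe⟩

instance instIsSFiniteKernelLocFin : IsSFiniteKernel (locFinKernel d) :=
  isSFiniteKernel_of_isLocallyFinite _ fun μ => μ.2

theorem measurable_translate_locFin :
    Measurable fun p : LocFin d × Rd d => translate p.2 p.1.1 := by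
  refine Measure.measurable_of_measurable_coe _ fun s hs => ?_
  simp only [translate_apply _ _ hs]
  have hset : MeasurableSet {q : (LocFin d × Rd d) × Rd d | q.2 - q.1.2 ∈ s} := by
    have : Measurable fun q : (LocFin d × Rd d) × Rd d => q.2 - q.1.2 := by fun_prop
    exact this hs
  exact Kernel.measurable_kernel_prodMk_left
    (κ := (locFinKernel d).comap Prod.fst measurable_fst) hset

/-- The translation flow on the space of locally finite measures. -/
noncomputable def locFinFlow (d : ℕ) : MeasurableFlow d (LocFin d) where
  shift := fun x μ => ⟨translate x μ.1, have := μ.2; isLocallyFiniteMeasure_translate x μ.1⟩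
  measurable_shift := measurable_translate_locFin.subtype_mk
  shift_zero := fun μ => Subtype.ext (translate_zero μ.1)
  shift_shift := fun x y μ => Subtype.ext (translate_translate x y μ.1)

theorem locFinFlow_shift (x : Rd d) (μ : LocFin d) :
    ((locFinFlow d).shift x μ).1 = translate x μ.1 := rfl

/-- The product of two flows. -/
def MeasurableFlow.prod {Ω Ω' : Type*} [MeasurableSpace Ω] [MeasurableSpace Ω']
    (θ : MeasurableFlow d Ω) (θ' : MeasurableFlow d Ω') : MeasurableFlow d (Ω × Ω') where
  shift := fun x p => (θ.shift x p.1, θ'.shift x p.2)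
  measurable_shift := by
    have h1 : Measurable fun p : (Ω × Ω') × Rd d => (p.1.1, p.2) := by fun_prop
    have h2 : Measurable fun p : (Ω × Ω') × Rd d => (p.1.2, p.2) := by fun_prop
    exact (θ.measurable_shift.comp h1).prodMk (θ'.measurable_shift.comp h2)
  shift_zero := fun p => by simp only [θ.shift_zero, θ'.shift_zero]
  shift_shift := fun x y p => by simp only [θ.shift_shift, θ'.shift_shift]

open Classical in
/-- Replace a measure that is not locally finite by zero. -/
noncomputable def truncate (μ : Measure (Rd d)) : LocFin d :=
  if h : IsLocallyFiniteMeasure μ then ⟨μ, h⟩ else ⟨0, inferInstance⟩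

theorem truncate_of_isLocallyFinite {μ : Measure (Rd d)} (h : IsLocallyFiniteMeasure μ) :
    (truncate μ).1 = μ := by
  rw [truncate, dif_pos h]

theorem measurable_truncate : Measurable (truncate (d := d)) := by
  classical
  have h : Measurable fun μ : Measure (Rd d) => if IsLocallyFiniteMeasure μ then μ else 0 :=
    Measurable.ite measurableSet_isLocallyFiniteMeasure measurable_id measurable_const
  refine (MeasurableEmbedding.subtype_coe
    measurableSet_isLocallyFiniteMeasure).measurable_comp_iff.1 ?_
  convert h using 1
  funext μ
  simp only [Function.comp_apply, truncate]
  split_ifs <;> rfl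

/-- Local finiteness and the zero measure are both translation invariant. Hence invariant functions
on the canonical space give invariant sets of arbitrary measures, as joint ergodicity demands. -/
theorem truncate_translate (x : Rd d) (μ : Measure (Rd d)) :
    truncate (translate x μ) = (locFinFlow d).shift x (truncate μ) := by
  refine Subtype.ext ?_
  rw [locFinFlow_shift]
  by_cases h : IsLocallyFiniteMeasure μ
  · rw [truncate_of_isLocallyFinite h,
      truncate_of_isLocallyFinite (isLocallyFiniteMeasure_translate x μ)]
  · have h' : ¬ IsLocallyFiniteMeasure (translate x μ) := fun h' => h <| by
      have := isLocallyFiniteMeasure_translate (-x) (translate x μ)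
      rwa [translate_translate, neg_add_cancel, translate_zero] at this
    rw [truncate, truncate, dif_neg h, dif_neg h']
    simp [translate]

theorem isLocallyFiniteMeasure_of_finite_on_compacts {μ : Measure (Rd d)}
    (h : ∀ K : Set (Rd d), IsCompact K → μ K < ∞) : IsLocallyFiniteMeasure μ :=
  isLocallyFiniteMeasure_of_forall_closedBall fun _ => h _ (isCompact_closedBall _ _)

theorem IsStationaryRM.ae_eq_translate {Ω : Type*} [MeasurableSpace Ω] {θ : MeasurableFlow d Ω}
    {P : Measure Ω} {ξ : Ω → Measure (Rd d)} (h : IsStationaryRM θ P ξ) :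
    ∀ᵐ ω ∂P, ∀ x, ξ (θ.shift x ω) = translate x (ξ ω) := by
  filter_upwards [h] with ω hω x
  ext s hs
  rw [translate_apply _ _ hs, ← hω x _ (measurable_sub_right x hs), ← Set.preimage_comp]
  congr 1
  ext y
  simp

/-- Random measures, made locally finite everywhere. -/
theorem IsRandomMeasure.ae_truncate {Ω : Type*} [MeasurableSpace Ω] {P : Measure Ω}
    {ξ : Ω → Measure (Rd d)} (h : IsRandomMeasure P ξ) : ∀ᵐ ω ∂P, (truncate (ξ ω)).1 = ξ ω := by
  filter_upwards [h.finite_on_compacts] with ω hω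
  exact truncate_of_isLocallyFinite (isLocallyFiniteMeasure_of_finite_on_compacts hω)

section Nonatomic

variable {Ω : Type*} [MeasurableSpace Ω] {θ : MeasurableFlow d Ω}

theorem measurableSet_nonatoms (κ : Kernel Ω (Rd d)) [IsSFiniteKernel κ] :
    MeasurableSet {p : Ω × Rd d | κ p.1 {p.2} = 0} := by
  have hset : MeasurableSet {q : (Ω × Rd d) × Rd d | q.2 = q.1.2} :=
    measurableSet_eq_fun (by fun_prop) (by fun_prop)
  exact Kernel.measurable_kernel_prodMk_left (κ := κ.comap Prod.fst measurable_fst) hset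
    (measurableSet_singleton 0)

/-- The diffuse part of a kernel. -/
noncomputable def diffusePart (κ : Kernel Ω (Rd d)) [IsSFiniteKernel κ] : Kernel Ω (Rd d) :=
  restrictPairs κ _ (measurableSet_nonatoms κ)

theorem diffusePart_le (κ : Kernel Ω (Rd d)) [IsSFiniteKernel κ] (ω : Ω) :
    diffusePart κ ω ≤ κ ω := Measure.restrict_le_self

theorem diffusePart_singleton (κ : Kernel Ω (Rd d)) [IsSFiniteKernel κ] (ω : Ω) (x : Rd d) :
    diffusePart κ ω {x} = 0 := by
  rw [diffusePart, restrictPairs_apply, Measure.restrict_apply (measurableSet_singleton x)]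
  by_cases h : κ ω {x} = 0
  · exact measure_mono_null Set.inter_subset_left h
  · have : {x} ∩ Prod.mk ω ⁻¹' {p : Ω × Rd d | κ p.1 {p.2} = 0} = ∅ := by
      ext y
      refine iff_of_false ?_ (fun h => h.elim)
      rintro ⟨hy, hy'⟩
      rw [Set.mem_singleton_iff] at hy
      subst hy
      exact h hy'
    rw [this, measure_empty]

theorem diffusePart_eq (κ : Kernel Ω (Rd d)) [IsSFiniteKernel κ] {ω : Ω}
    (h : ∀ x, κ ω {x} = 0) : diffusePart κ ω = κ ω := by
  rw [diffusePart, restrictPairs_apply]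
  have : Prod.mk ω ⁻¹' {p : Ω × Rd d | κ p.1 {p.2} = 0} = Set.univ :=
    Set.eq_univ_of_forall fun x => h x
  rw [this, Measure.restrict_univ]

theorem isEquivariant_diffusePart {κ : Kernel Ω (Rd d)} [IsSFiniteKernel κ]
    (h : IsEquivariant θ κ) : IsEquivariant θ (diffusePart κ) := by
  refine isEquivariant_restrictPairs _ h fun ω x y => ?_
  show κ (θ.shift y ω) {x - y} = 0 ↔ κ ω {x} = 0
  rw [h, translate_apply_of_any]
  have : (fun z => z - y) ⁻¹' {x - y} = {x} := by
    ext z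
    simp
  rw [this]

end Nonatomic

end LocallyFinite

/-! ### Ergodicity, and the allocation on a given extension -/

section Allocation

open Metric

variable {d : ℕ}

/-- The closed unit cube. -/
def unitCube (d : ℕ) : Set (Rd d) := {x | ∀ i, x i ∈ Set.Icc (0 : ℝ) 1}

theorem measurableSet_unitCube : MeasurableSet (unitCube d) := by
  have : unitCube d = ⋂ i, (fun x : Rd d => x i) ⁻¹' Set.Icc 0 1 := by
    ext x
    simp [unitCube]
  rw [this]
  exact MeasurableSet.iInter fun i => (by fun_prop : Measurable fun x : Rd d => x i)
    measurableSet_Icc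

theorem isBounded_unitCube : Bornology.IsBounded (unitCube d) := by
  refine (isBounded_closedBall (x := (0 : Rd d)) (r := Real.sqrt d)).subset fun x hx => ?_
  rw [mem_closedBall, dist_zero_right, EuclideanSpace.norm_eq]
  refine Real.sqrt_le_sqrt ?_
  calc ∑ i, ‖x i‖ ^ 2 ≤ ∑ _i : Fin d, (1 : ℝ) := Finset.sum_le_sum fun i _ => by
        have := hx i
        rw [Real.norm_eq_abs, abs_of_nonneg this.1]
        exact pow_le_one₀ this.1 this.2
    _ = d := by simp

theorem interior_unitCube_nonempty : (interior (unitCube d)).Nonempty := by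
  let U : Set (Rd d) := ⋂ i, (fun x : Rd d => x i) ⁻¹' Set.Ioo 0 1
  have hU : IsOpen U := isOpen_iInter_of_finite fun i =>
    isOpen_Ioo.preimage (by fun_prop : Continuous fun x : Rd d => x i)
  refine ⟨WithLp.toLp 2 fun _ => 1 / 2, interior_maximal (t := U) ?_ hU ?_⟩
  · intro x hx i
    exact Set.Ioo_subset_Icc_self (Set.mem_iInter.1 hx i)
  · refine Set.mem_iInter.2 fun i => ?_
    simp only [Set.mem_preimage, Set.mem_Ioo]
    norm_num

/-- The flow on triples of locally finite measures. -/
noncomputable def tripleFlow (d : ℕ) : MeasurableFlow d ((LocFin d × LocFin d) × LocFin d) :=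
  ((locFinFlow d).prod (locFinFlow d)).prod (locFinFlow d)

/-- A function of a pair of jointly ergodic random measures that is invariant is constant. -/
theorem JointlyErgodic.exists_ae_eq_const {Ω : Type*} [MeasurableSpace Ω] {P : Measure Ω}
    [IsProbabilityMeasure P] {ξ η : Ω → Measure (Rd d)} (h : JointlyErgodic P ξ η)
    (hξ : Measurable ξ) (hη : Measurable η) {p : LocFin d × LocFin d → ℝ≥0∞} (hp : Measurable p)
    (hpi : ∀ x μ, p (((locFinFlow d).prod (locFinFlow d)).shift x μ) = p μ) :
    ∃ a, ∀ᵐ ω ∂P, p (truncate (ξ ω), truncate (η ω)) = a := by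
  have hpm : Measurable fun q : Measure (Rd d) × Measure (Rd d) =>
      p (truncate q.1, truncate q.2) :=
    hp.comp ((measurable_truncate.comp measurable_fst).prodMk
      (measurable_truncate.comp measurable_snd))
  -- The measurable sets of `ℝ≥0∞` contain a countable separating family, so a zero-one law for
  -- preimages forces a constant.
  refine Filter.exists_eventuallyEq_const_of_forall_separating MeasurableSet fun U hU => ?_
  have hB := h ((fun q => p (truncate q.1, truncate q.2)) ⁻¹' U) (hpm hU) fun x μ ν => by
    show p (truncate (translate x μ), truncate (translate x ν)) ∈ U ↔
      p (truncate μ, truncate ν) ∈ U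
    rw [truncate_translate, truncate_translate]
    exact iff_of_eq (congrArg (· ∈ U) (hpi x (truncate μ, truncate ν)))
  rcases hB with h0 | h1
  · exact Or.inr (measure_eq_zero_iff_ae_notMem.1 h0)
  · left
    exact (mem_ae_iff_prob_eq_one₀ ((hpm hU).preimage (hξ.prodMk hη)).nullMeasurableSet).2 h1

section Extension

variable {Ω Ω' : Type*} [MeasurableSpace Ω] [MeasurableSpace Ω'] {P : Measure Ω}
  {θ : MeasurableFlow d Ω} {ξ η : Ω → Measure (Rd d)} {c : ℝ≥0} {θ' : MeasurableFlow d Ω'}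
  {P' : Measure Ω'} {π : Ω' → Ω} {χ : Ω' → Measure (Rd d)}

/-- The joint value of all three random measures. -/
noncomputable def randomTriple (ξ η : Ω → Measure (Rd d)) (π : Ω' → Ω) (χ : Ω' → Measure (Rd d))
    (ω : Ω') : (LocFin d × LocFin d) × LocFin d :=
  ((truncate (ξ (π ω)), truncate (η (π ω))), truncate (χ ω))

theorem measurable_randomTriple (hξ : Measurable ξ) (hη : Measurable η) (hπ : Measurable π)
    (hχ : Measurable χ) : Measurable (randomTriple ξ η π χ) :=
  ((measurable_truncate.comp (hξ.comp hπ)).prodMk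
    (measurable_truncate.comp (hη.comp hπ))).prodMk (measurable_truncate.comp hχ)

theorem ae_randomTriple_shift (h : IsPoissonExtension θ P ξ η c θ' P' π χ)
    (hξs : IsStationaryRM θ P ξ) (hηs : IsStationaryRM θ P η) :
    ∀ᵐ ω ∂P', ∀ x, randomTriple ξ η π χ (θ'.shift x ω)
      = (tripleFlow d).shift x (randomTriple ξ η π χ ω) := by
  filter_upwards [h.projection.quasiMeasurePreserving.ae hξs.ae_eq_translate,
    h.projection.quasiMeasurePreserving.ae hηs.ae_eq_translate,
    h.stationary.ae_eq_translate] with ω h1 h2 h3 x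
  simp only [randomTriple, h.projection_shift, h1, h2, h3, truncate_translate]
  rfl

/-- The triple intertwines the two flows almost surely, so its law inherits invariance from `P'`. -/
theorem preserves_map_randomTriple (h : IsPoissonExtension θ P ξ η c θ' P' π χ)
    (hξ : Measurable ξ) (hη : Measurable η)
    (hξs : IsStationaryRM θ P ξ) (hηs : IsStationaryRM θ P η) :
    (tripleFlow d).Preserves (P'.map (randomTriple ξ η π χ)) := by
  intro x
  have hm := measurable_randomTriple hξ hη h.projection.measurable h.poisson.measurable
  refine ⟨(tripleFlow d).measurable_shift_right x, ?_⟩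
  rw [Measure.map_map ((tripleFlow d).measurable_shift_right x) hm]
  have h1 : (tripleFlow d).shift x ∘ randomTriple ξ η π χ
      =ᵐ[P'] randomTriple ξ η π χ ∘ θ'.shift x := by
    filter_upwards [ae_randomTriple_shift h hξs hηs] with ω hω
    exact (hω x).symm
  rw [Measure.map_congr h1, ← Measure.map_map hm (h.preserves x).measurable, (h.preserves x).map_eq]

/-- On flow-invariant events of the extension, the law of the events and that of any functional of
`(ξ, η)` decouple. -/
theorem setLIntegral_randomTriple [IsProbabilityMeasure P]
    (h : IsPoissonExtension θ P ξ η c θ' P' π χ)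
    (hξ : Measurable ξ) (hη : Measurable η) (herg : JointlyErgodic P ξ η)
    {E : Set ((LocFin d × LocFin d) × LocFin d)} (hE : MeasurableSet E)
    (hEi : IsFlowInvariant (tripleFlow d) E) :
    ∃ a, ∀ f : LocFin d × LocFin d → ℝ≥0∞, Measurable f →
      ∫⁻ g in E, f g.1 ∂(P'.map (randomTriple ξ η π χ))
        = a * ∫⁻ ω, f (truncate (ξ ω), truncate (η ω)) ∂P := by
  have := h.isProbabilityMeasure
  have hπ := h.projection.measurable
  have hχ := h.poisson.measurable
  let Y : Ω → LocFin d × LocFin d := fun ω => (truncate (ξ ω), truncate (η ω))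
  have hY : Measurable Y := (measurable_truncate.comp hξ).prodMk (measurable_truncate.comp hη)
  let X : Ω' → LocFin d := fun ω => truncate (χ ω)
  have hX : Measurable X := measurable_truncate.comp hχ
  have hind : IndepFun (Y ∘ π) X P' := by
    have h1 := h.indep.symm.comp (φ := fun q : Measure (Rd d) × Measure (Rd d) =>
      (truncate q.1, truncate q.2)) (ψ := truncate)
      ((measurable_truncate.comp measurable_fst).prodMk
        (measurable_truncate.comp measurable_snd)) measurable_truncate
    exact h1
  have hlaw : P'.map (randomTriple ξ η π χ) = (P.map Y).prod (P'.map X) := by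
    have h1 := (indepFun_iff_map_prod_eq_prod_map_map (hY.comp hπ).aemeasurable
      hX.aemeasurable).1 hind
    rw [← Measure.map_map hY hπ, h.projection.map_eq] at h1
    exact h1
  have hXi : ∀ x, (P'.map X).map ((locFinFlow d).shift x) = P'.map X := fun x => by
    rw [Measure.map_map ((locFinFlow d).measurable_shift_right x) hX]
    have h1 : (locFinFlow d).shift x ∘ X =ᵐ[P'] X ∘ θ'.shift x := by
      filter_upwards [h.stationary.ae_eq_translate] with ω hω
      simp only [Function.comp_apply, X, hω, truncate_translate]
    rw [Measure.map_congr h1, ← Measure.map_map hX (h.preserves x).measurable,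
      (h.preserves x).map_eq]
  have hPX : IsProbabilityMeasure (P'.map X) := Measure.isProbabilityMeasure_map hX.aemeasurable
  have hPY : IsProbabilityMeasure (P.map Y) := Measure.isProbabilityMeasure_map hY.aemeasurable
  -- The conditional probability of `E` given `(ξ, η)`. Invariance of `E` and of the law of `χ`
  -- makes it invariant, hence almost surely a constant `a`.
  let p : LocFin d × LocFin d → ℝ≥0∞ := fun q => P'.map X (Prod.mk q ⁻¹' E)
  have hp : Measurable p := measurable_measure_prodMk_left hE
  have hpi : ∀ x μ, p (((locFinFlow d).prod (locFinFlow d)).shift x μ) = p μ := fun x μ => by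
    show P'.map X (Prod.mk (((locFinFlow d).prod (locFinFlow d)).shift x μ) ⁻¹' E)
      = P'.map X (Prod.mk μ ⁻¹' E)
    conv_lhs => rw [← hXi x]
    rw [Measure.map_apply ((locFinFlow d).measurable_shift_right x) (measurable_prodMk_left hE)]
    congr 1
    ext κ
    exact hEi x (μ, κ)
  obtain ⟨a, ha⟩ := herg.exists_ae_eq_const hξ hη hp hpi
  refine ⟨a, fun f hf => ?_⟩
  have hfE : Measurable
      (E.indicator fun g : (LocFin d × LocFin d) × LocFin d => f g.1) :=
    (hf.comp measurable_fst).indicator hE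
  rw [← lintegral_indicator hE, hlaw, lintegral_prod _ hfE.aemeasurable]
  have h1 : ∀ q, ∫⁻ κ, E.indicator (fun g : (LocFin d × LocFin d) × LocFin d => f g.1) (q, κ)
      ∂(P'.map X) = p q * f q := fun q => by
    have : (fun κ => E.indicator (fun g : (LocFin d × LocFin d) × LocFin d => f g.1) (q, κ))
        = (Prod.mk q ⁻¹' E).indicator fun _ => f q := rfl
    rw [this, lintegral_indicator_const (measurable_prodMk_left hE), mul_comm]
  simp only [h1]
  have hpf : Measurable fun q => p q * f q := hp.mul hf
  rw [lintegral_map hpf hY, ← lintegral_const_mul a (f := fun ω => f (Y ω)) (hf.comp hY)]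
  refine lintegral_congr_ae ?_
  filter_upwards [ha] with ω hω
  rw [← hω]

/-- Every extension by a Poisson process carries a balancing allocation. -/
theorem exists_balancing_allocation [IsProbabilityMeasure P] (hd : 1 ≤ d)
    (h : IsPoissonExtension θ P ξ η c θ' P' π χ)
    (hξ : IsRandomMeasure P ξ) (hη : IsRandomMeasure P η)
    (hξs : IsStationaryRM θ P ξ) (hηs : IsStationaryRM θ P η)
    (herg : JointlyErgodic P ξ η) (hdiff : IsDiffuse P ξ)
    (heq : intensity P ξ = intensity P η) (hfin : intensity P η < ∞) (hc : 0 < c) :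
    ∃ τ : Ω' × Rd d → OnePoint (Rd d),
      IsAllocation θ' P' τ ∧ Balances P' τ (ξ ∘ π) (η ∘ π) := by
  classical
  have := h.isProbabilityMeasure
  have hm := measurable_randomTriple hξ.measurable hη.measurable h.projection.measurable
    h.poisson.measurable
  set Φ := randomTriple ξ η π χ with hΦ
  have hQ : IsProbabilityMeasure (P'.map Φ) := Measure.isProbabilityMeasure_map hm.aemeasurable
  have hξt := hξ.ae_truncate
  have hηt := hη.ae_truncate
  have hπae := h.projection.quasiMeasurePreserving
  let κ₁ : Kernel ((LocFin d × LocFin d) × LocFin d) (Rd d) :=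
    (locFinKernel d).comap (fun g => g.1.1) (by fun_prop)
  let κ₂ : Kernel ((LocFin d × LocFin d) × LocFin d) (Rd d) :=
    (locFinKernel d).comap (fun g => g.1.2) (by fun_prop)
  let κ₃ : Kernel ((LocFin d × LocFin d) × LocFin d) (Rd d) :=
    (locFinKernel d).comap (fun g => g.2) (by fun_prop)
  have e₁ : IsEquivariant (tripleFlow d) κ₁ := fun x g => rfl
  have e₂ : IsEquivariant (tripleFlow d) κ₂ := fun x g => rfl
  have e₃ : IsEquivariant (tripleFlow d) κ₃ := fun x g => rfl
  have hf₁ : ∀ g, IsLocallyFiniteMeasure (κ₁ g) := fun g => g.1.1.2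
  have hf₂ : ∀ g, IsLocallyFiniteMeasure (κ₂ g) := fun g => g.1.2.2
  have hf₃ : ∀ g, IsLocallyFiniteMeasure (κ₃ g) := fun g => g.2.2
  have hfd : ∀ g, IsLocallyFiniteMeasure (diffusePart κ₁ g) := fun g =>
    isLocallyFiniteMeasure_of_le (diffusePart_le κ₁ g)
  have hsd : IsSFiniteKernel (diffusePart κ₁) := isSFiniteKernel_of_isLocallyFinite _ hfd
  have hκ₁ : ∀ᵐ ω ∂P', κ₁ (Φ ω) = ξ (π ω) := hπae.ae hξt
  have hκ₂ : ∀ᵐ ω ∂P', κ₂ (Φ ω) = η (π ω) := hπae.ae hηt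
  have hκ₃ : ∀ᵐ ω ∂P', κ₃ (Φ ω) = χ ω := h.poisson.toIsRandomMeasure.ae_truncate
  have hκd : ∀ᵐ ω ∂P', diffusePart κ₁ (Φ ω) = ξ (π ω) := by
    filter_upwards [hκ₁, hπae.ae hdiff] with ω h1 h2
    rw [diffusePart_eq κ₁ (fun x => by rw [h1]; exact h2 x), h1]
  have hcube := measurableSet_unitCube (d := d)
  have hlocm : Measurable fun μ : LocFin d => μ.1 (unitCube d) :=
    (Measure.measurable_coe hcube).comp measurable_subtype_coe
  have hi₁ : ∫⁻ ω, (truncate (ξ ω)).1 (unitCube d) ∂P = intensity P ξ :=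
    lintegral_congr_ae (by filter_upwards [hξt] with ω hω; rw [hω]; rfl)
  have hi₂ : ∫⁻ ω, (truncate (η ω)).1 (unitCube d) ∂P = intensity P η :=
    lintegral_congr_ae (by filter_upwards [hηt] with ω hω; rw [hω]; rfl)
  have hint : ∀ E, MeasurableSet E → IsFlowInvariant (tripleFlow d) E →
      ∫⁻ g in E, diffusePart κ₁ g (unitCube d) ∂(P'.map Φ)
        = ∫⁻ g in E, κ₂ g (unitCube d) ∂(P'.map Φ) := by
    intro E hE hEi
    obtain ⟨a, ha⟩ := setLIntegral_randomTriple h hξ.measurable hη.measurable herg hE hEi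
    have h1 := ha (fun q => q.1.1 (unitCube d)) (hlocm.comp measurable_fst)
    have h2 := ha (fun q => q.2.1 (unitCube d)) (hlocm.comp measurable_snd)
    simp only [hi₁, hi₂] at h1 h2
    -- Diffuseness is rephrased as nullity of the set of atoms, a measurable condition that passes
    -- from `P'` to the image law.
    have h3 : ∀ᵐ g ∂(P'.map Φ), diffusePart κ₁ g = κ₁ g := by
      have hset : MeasurableSet {g | κ₁ g (Prod.mk g ⁻¹'
          {p : ((LocFin d × LocFin d) × LocFin d) × Rd d | κ₁ p.1 {p.2} = 0}ᶜ) = 0} :=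
        Kernel.measurable_kernel_prodMk_left (measurableSet_nonatoms κ₁).compl
          (measurableSet_singleton 0)
      have h4 : ∀ᵐ g ∂(P'.map Φ), κ₁ g (Prod.mk g ⁻¹'
          {p : ((LocFin d × LocFin d) × LocFin d) × Rd d | κ₁ p.1 {p.2} = 0}ᶜ) = 0 := by
        refine (ae_map_iff hm.aemeasurable hset).2 ?_
        filter_upwards [hκ₁, hπae.ae hdiff] with ω h1 h2
        have : Prod.mk (Φ ω) ⁻¹'
            {p : ((LocFin d × LocFin d) × LocFin d) × Rd d | κ₁ p.1 {p.2} = 0}ᶜ = ∅ := by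
          ext x
          refine iff_of_false (fun hx => hx ?_) (fun hx => hx.elim)
          show κ₁ (Φ ω) {x} = 0
          rw [h1]
          exact h2 x
        rw [this, measure_empty]
      filter_upwards [h4] with g hg
      exact Measure.restrict_eq_self_of_ae_mem hg
    calc ∫⁻ g in E, diffusePart κ₁ g (unitCube d) ∂(P'.map Φ)
        = ∫⁻ g in E, κ₁ g (unitCube d) ∂(P'.map Φ) :=
          lintegral_congr_ae (ae_restrict_of_ae (by filter_upwards [h3] with g hg; rw [hg]))
      _ = a * intensity P ξ := h1
      _ = a * intensity P η := by rw [heq]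
      _ = _ := h2.symm
  have hfin' : ∫⁻ g, κ₂ g (unitCube d) ∂(P'.map Φ) < ∞ := by
    rw [lintegral_map (κ₂.measurable_coe hcube) hm]
    have h1 : ∫⁻ ω, κ₂ (Φ ω) (unitCube d) ∂P' = ∫⁻ ω, (truncate (η ω)).1 (unitCube d) ∂P := by
      have h2 : Measurable fun ω => (truncate (η ω)).1 (unitCube d) :=
        hlocm.comp (measurable_truncate.comp hη.measurable)
      rw [← h.projection.lintegral_comp h2]
      rfl
    rw [h1, hi₂]
    exact hfin
  obtain ⟨S, hS⟩ := exists_cellSystems κ₃ e₃ hf₃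
  have hcov : ∀ᵐ g ∂(P'.map Φ), ∀ r : ℕ, ∃ n c, ball 0 r ⊆ (S n).cell g c := by
    have hL : ∀ R : ℕ, (1 : ℝ) ≤ 3 * ((R : ℝ) + 1) + 1 := fun R => by
      have : (0 : ℝ) ≤ R := Nat.cast_nonneg R
      linarith
    choose z hz using fun R : ℕ => h.poisson.ae_exists_isolated hd hc (hL R)
    -- Because the candidate centres are deterministic and countable, the event is measurable and
    -- can be transferred to the image law.
    have hset : MeasurableSet (⋂ R : ℕ, ⋃ k : ℕ, {g | 0 < κ₃ g (ball (z R k) (1 / 2))} ∩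
        {g | κ₃ g (ball (z R k) (3 * ((R : ℝ) + 1) + 1) \ ball (z R k) (1 / 2)) = 0}) :=
      MeasurableSet.iInter fun R => MeasurableSet.iUnion fun k =>
        (κ₃.measurable_coe measurableSet_ball measurableSet_Ioi).inter
          (κ₃.measurable_coe (measurableSet_ball.diff measurableSet_ball)
            (measurableSet_singleton 0))
    have hae := (ae_map_iff hm.aemeasurable hset).2 (by
      filter_upwards [ae_all_iff.2 hz, hκ₃] with ω hω h3
      refine Set.mem_iInter.2 fun R => Set.mem_iUnion.2 ?_
      obtain ⟨k, hk⟩ := hω R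
      rw [← h3] at hk
      exact ⟨k, hk⟩)
    filter_upwards [hae] with g hg
    refine hS g fun R => ?_
    obtain ⟨k, hk⟩ := Set.mem_iUnion.1 (Set.mem_iInter.1 hg R)
    exact ⟨z R k, hk⟩
  have hnt : ¬ Countable (Rd d) := by
    intro hcount
    have hinj : Function.Injective fun t : ℝ => (EuclideanSpace.single ⟨0, hd⟩ t : Rd d) :=
      fun s t hst => by simpa using congrArg (fun x : Rd d => x ⟨0, hd⟩) hst
    exact not_countable (α := ℝ) hinj.countable
  obtain ⟨T, hT⟩ := exists_balancing_partialAllocation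
    (preserves_map_randomTriple h hξ.measurable hη.measurable hξs hηs)
    (PolishSpace.measurableEquivOfNotCountable hnt (not_countable_iff.2 inferInstance))
    (diffusePart κ₁) κ₂ (isEquivariant_diffusePart e₁) e₂
    hfd hf₂ (diffusePart_singleton κ₁) S hcov hcube interior_unitCube_nonempty isBounded_unitCube
    hint hfin'
  have hT' := ae_of_ae_map hm.aemeasurable hT
  have hpair : Measurable fun p : Ω' × Rd d => (Φ p.1, p.2) :=
    (hm.comp measurable_fst).prodMk measurable_snd
  -- The canonical partial allocation pulled back along the triple, with the unallocated points sent
  -- to infinity.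
  refine ⟨fun p => if (Φ p.1, p.2) ∈ T.dom then ((T.map (Φ p.1, p.2) : Rd d) : OnePoint (Rd d))
    else OnePoint.infty, ⟨?_, ?_⟩, ⟨?_, ?_⟩⟩
  · exact Measurable.ite (hpair T.measurableSet_dom)
      (OnePoint.continuous_coe.measurable.comp (T.measurable_map.comp hpair)) measurable_const
  · filter_upwards [ae_randomTriple_shift h hξs hηs] with ω hω x y
    simp only [← hΦ] at hω ⊢
    simp only [hω y, T.dom_shift (Φ ω) x y]
    split_ifs with hx
    · rw [T.map_shift _ _ _ hx]
      rfl
    · rfl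
  · filter_upwards [hT', hκd] with ω h1 h2
    rw [Function.comp_apply, ← h2]
    refine measure_mono_null ?_ h1.1
    intro x hx
    by_contra hx'
    have hx'' : (Φ ω, x) ∈ T.dom := not_not.1 hx'
    simp only [Set.mem_ofPred_eq, if_pos hx''] at hx
    exact OnePoint.coe_ne_infty _ hx
  · filter_upwards [hT', hκd, hκ₂] with ω h1 h2 h3 C hC
    rw [Function.comp_apply, Function.comp_apply, ← h2, ← h3, ← h1.2, T.image_apply _ _ hC]
    congr 1
    ext x
    simp only [Set.mem_ofPred_eq]
    split_ifs with hx
    · simp [hx]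
    · simp [hx]

end Extension

end Allocation

/-! ### Superposition of independent Poisson blocks -/

section PoissonConstruction

open Complex Filter Topology

theorem integral_finsetProd_infinitePi {ι : Type*} {X : ι → Type*} {mX : ∀ i, MeasurableSpace (X i)}
    (μ : ∀ i, Measure (X i)) [∀ i, IsProbabilityMeasure (μ i)] (s : Finset ι) {f : ∀ i, X i → ℂ}
    (hf : ∀ i, Measurable (f i)) :
    ∫ y, ∏ i ∈ s, f i (y i) ∂(Measure.infinitePi μ) = ∏ i ∈ s, ∫ x, f i x ∂(μ i) := by
  have h1 : ∀ y : ∀ i, X i, ∏ i ∈ s, f i (y i) = (fun z : ∀ i : s, X i => ∏ i : s, f i (z i))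
      (s.restrict y) := fun y => (Finset.prod_coe_sort s fun i => f i (y i)).symm
  have hm : Measurable fun z : ∀ i : s, X i => ∏ i : s, f i (z i) :=
    Finset.measurable_prod _ fun i _ => (hf i).comp (measurable_pi_apply i)
  refine (integral_congr_ae (Eventually.of_forall h1)).trans
    ((integral_restrict_infinitePi (μ := μ) (f := fun z : ∀ i : s, X i => ∏ i : s, f i (z i))
      hm.aestronglyMeasurable).trans ?_)
  rw [integral_fintype_prod_eq_prod (f := fun (i : s) x => f i x),
    Finset.prod_coe_sort s fun i => ∫ x, f i x ∂(μ i)]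

variable {β : Type*} [MeasurableSpace β]

/-- The counting measure of the first `n` points of a sequence. -/
noncomputable def blockMeasure (p : ℕ × (ℕ → β)) : Measure β :=
  ∑ i ∈ Finset.range p.1, Measure.dirac (p.2 i)

theorem blockMeasure_apply (p : ℕ × (ℕ → β)) {s : Set β} (hs : MeasurableSet s) :
    blockMeasure p s = ∑ i ∈ Finset.range p.1, s.indicator 1 (p.2 i) := by
  simp [blockMeasure, Measure.finsetSum_apply, Measure.dirac_apply' _ hs]

theorem measurable_blockSum {γ : Type*} [MeasurableSpace γ] [AddCommMonoid γ] [MeasurableAdd₂ γ]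
    {f : β → γ} (hf : Measurable f) :
    Measurable fun p : ℕ × (ℕ → β) => ∑ i ∈ Finset.range p.1, f (p.2 i) :=
  measurable_from_prod_countable_right fun n =>
    Finset.measurable_sum (Finset.range n) (f := fun i (u : ℕ → β) => f (u i))
      fun i _ => hf.comp (measurable_pi_apply i)

theorem measurable_blockMeasure : Measurable (blockMeasure (β := β)) := by
  refine Measure.measurable_of_measurable_coe _ fun s hs => ?_
  simp only [blockMeasure_apply _ hs]
  exact measurable_blockSum (measurable_one.indicator hs)

/-- The law of a Poisson number of independent points with distribution `ν`. -/
noncomputable def blockLaw (m : ℝ≥0) (ν : Measure β) [IsProbabilityMeasure ν] :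
    Measure (ℕ × (ℕ → β)) :=
  (poissonMeasure m).prod (Measure.infinitePi fun _ => ν)

instance instIsProbabilityMeasureBlockLaw (m : ℝ≥0) (ν : Measure β) [IsProbabilityMeasure ν] :
    IsProbabilityMeasure (blockLaw m ν) := by
  unfold blockLaw
  infer_instance

/-- Given `n` points, independence yields the `n`-th power of one characteristic function; summation
against the Poisson weights is an exponential series. -/
theorem integral_cexp_blockSum (m : ℝ≥0) (ν : Measure β) [IsProbabilityMeasure ν] {f : β → ℝ}
    (hf : Measurable f) :
    ∫ p, cexp ((∑ i ∈ Finset.range p.1, f (p.2 i) : ℝ) * I) ∂(blockLaw m ν)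
      = cexp (m * (∫ x, cexp (f x * I) ∂ν - 1)) := by
  have hm : Measurable fun p : ℕ × (ℕ → β) =>
      cexp ((∑ i ∈ Finset.range p.1, f (p.2 i) : ℝ) * I) := by
    have := measurable_blockSum hf
    fun_prop
  have hint : Integrable (fun p : ℕ × (ℕ → β) =>
      cexp ((∑ i ∈ Finset.range p.1, f (p.2 i) : ℝ) * I)) (blockLaw m ν) :=
    Integrable.of_bound hm.aestronglyMeasurable 1
      (Eventually.of_forall fun p => by rw [Complex.norm_exp_ofReal_mul_I])
  rw [blockLaw] at hint ⊢
  rw [integral_prod _ hint]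
  have h1 : ∀ n : ℕ, ∫ u, cexp ((∑ i ∈ Finset.range n, f (u i) : ℝ) * I)
      ∂(Measure.infinitePi fun _ : ℕ => ν) = (∫ x, cexp (f x * I) ∂ν) ^ n := fun n => by
    have h2 : ∀ u : ℕ → β, cexp ((∑ i ∈ Finset.range n, f (u i) : ℝ) * I)
        = ∏ i ∈ Finset.range n, cexp (f (u i) * I) := fun u => by
      rw [← Complex.exp_sum, ← Finset.sum_mul]
      push_cast
      rfl
    simp only [h2]
    rw [integral_finsetProd_infinitePi (fun _ : ℕ => ν) (Finset.range n)
      (f := fun _ x => cexp (f x * I)) (fun _ => by fun_prop)]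
    simp
  simp only [h1]
  set φ := ∫ x, cexp (f x * I) ∂ν
  rw [integral_poissonMeasure]
  calc ∑' n : ℕ, (Real.exp (-m) * (m : ℝ) ^ n / n.factorial) • φ ^ n
      = ∑' n : ℕ, cexp (-m) * ((m * φ) ^ n / n.factorial) := by
        congr 1
        funext n
        rw [Complex.real_smul]
        push_cast
        rw [mul_pow]
        ring
    _ = cexp (-m) * cexp (m * φ) := by
        rw [tsum_mul_left, (NormedSpace.expSeries_div_hasSum_exp (m * φ)).tsum_eq,
          Complex.exp_eq_exp_ℂ]
    _ = cexp (m * (φ - 1)) := by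
        rw [← Complex.exp_add]
        ring_nf

theorem lintegral_nat_poissonMeasure (m : ℝ≥0) : ∫⁻ n, (n : ℝ≥0∞) ∂(poissonMeasure m) = m := by
  rw [poissonMeasure, lintegral_sum_measure]
  simp only [lintegral_smul_measure, lintegral_dirac, smul_eq_mul]
  rw [tsum_eq_zero_add' ENNReal.summable]
  have h1 : ∀ n : ℕ, ENNReal.ofReal (Real.exp (-m) * (m : ℝ) ^ (n + 1) / (n + 1).factorial)
      * ((n + 1 : ℕ) : ℝ≥0∞) = m * ENNReal.ofReal (Real.exp (-m) * (m : ℝ) ^ n / n.factorial) := by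
    intro n
    have h2 : ((n + 1 : ℕ) : ℝ≥0∞) = ENNReal.ofReal ((n + 1 : ℕ) : ℝ)  :=
      (ENNReal.ofReal_natCast _).symm
    have h3 : (m : ℝ≥0∞) = ENNReal.ofReal (m : ℝ) := by simp
    rw [h2, h3, ← ENNReal.ofReal_mul (by positivity), ← ENNReal.ofReal_mul (by positivity),
      Nat.factorial_succ]
    congr 1
    push_cast
    field_simp
    ring
  simp only [h1, Nat.cast_zero, mul_zero, zero_add]
  rw [ENNReal.tsum_mul_left]
  have h4 : ∑' n : ℕ, ENNReal.ofReal (Real.exp (-m) * (m : ℝ) ^ n / n.factorial) = 1 := by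
    have h5 := hasSum_one_poissonMeasure m
    rw [← ENNReal.ofReal_tsum_of_nonneg (fun n => by positivity) h5.summable, h5.tsum_eq,
      ENNReal.ofReal_one]
  rw [h4, mul_one]

theorem lintegral_blockMeasure (m : ℝ≥0) (ν : Measure β) [IsProbabilityMeasure ν] {s : Set β}
    (hs : MeasurableSet s) : ∫⁻ p, blockMeasure p s ∂(blockLaw m ν) = m * ν s := by
  have hm : Measurable fun p : ℕ × (ℕ → β) => blockMeasure p s :=
    (Measure.measurable_coe hs).comp measurable_blockMeasure
  rw [blockLaw, lintegral_prod _ hm.aemeasurable]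
  have h1 : ∀ n : ℕ, ∫⁻ u, blockMeasure (n, u) s ∂(Measure.infinitePi fun _ : ℕ => ν)
      = n * ν s := fun n => by
    simp only [blockMeasure_apply _ hs]
    have hind : ∀ i : ℕ, Measurable fun u : ℕ → β => s.indicator (1 : β → ℝ≥0∞) (u i) := fun i =>
      (measurable_one.indicator hs).comp (measurable_pi_apply i)
    rw [lintegral_finsetSum _ fun i _ => hind i]
    have h2 : ∀ i : ℕ, ∫⁻ u, s.indicator (1 : β → ℝ≥0∞) (u i)
        ∂(Measure.infinitePi fun _ : ℕ => ν) = ν s := fun i => by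
      rw [(measurePreserving_eval_infinitePi (fun _ : ℕ => ν) i).lintegral_comp
        (measurable_one.indicator hs), lintegral_indicator_one hs]
    simp [h2]
  simp only [h1]
  rw [lintegral_mul_const _ (measurable_of_countable _), lintegral_nat_poissonMeasure]

/-- The superposition of a sequence of blocks. -/
noncomputable def superposition (w : ℕ → ℕ × (ℕ → β)) : Measure β :=
  Measure.sum fun k => blockMeasure (w k)

/-- The law of a sequence of independent blocks. -/
noncomputable def sequenceLaw (m : ℕ → ℝ≥0) (ν : ℕ → Measure β)
    [∀ k, IsProbabilityMeasure (ν k)] : Measure (ℕ → ℕ × (ℕ → β)) :=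
  Measure.infinitePi fun k => blockLaw (m k) (ν k)

instance instIsProbabilityMeasureSequenceLaw (m : ℕ → ℝ≥0) (ν : ℕ → Measure β)
    [∀ k, IsProbabilityMeasure (ν k)] : IsProbabilityMeasure (sequenceLaw m ν) := by
  unfold sequenceLaw
  infer_instance

theorem superposition_apply (w : ℕ → ℕ × (ℕ → β)) {s : Set β} (hs : MeasurableSet s) :
    superposition w s = ∑' k, blockMeasure (w k) s :=
  Measure.sum_apply _ hs

theorem measurable_blockMeasure_apply {s : Set β} (hs : MeasurableSet s) (k : ℕ) :
    Measurable fun w : ℕ → ℕ × (ℕ → β) => blockMeasure (w k) s :=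
  ((Measure.measurable_coe hs).comp measurable_blockMeasure).comp (measurable_pi_apply k)

theorem measurable_superposition : Measurable (superposition (β := β)) := by
  refine Measure.measurable_of_measurable_coe _ fun s hs => ?_
  simp only [superposition_apply _ hs]
  exact Measurable.tsum fun k => measurable_blockMeasure_apply hs k

theorem lintegral_superposition (m : ℕ → ℝ≥0) (ν : ℕ → Measure β)
    [∀ k, IsProbabilityMeasure (ν k)] {s : Set β} (hs : MeasurableSet s) :
    ∫⁻ w, superposition w s ∂(sequenceLaw m ν) = Measure.sum (fun k => m k • ν k) s := by
  simp only [superposition_apply _ hs]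
  rw [lintegral_tsum fun k => (measurable_blockMeasure_apply hs k).aemeasurable,
    Measure.sum_apply _ hs]
  congr 1
  funext k
  have h := (measurePreserving_eval_infinitePi (fun k => blockLaw (m k) (ν k)) k).lintegral_comp
    ((Measure.measurable_coe hs).comp measurable_blockMeasure)
  simp only [Function.comp_apply] at h
  rw [sequenceLaw, Measure.smul_apply]
  refine Eq.trans h ?_
  rw [lintegral_blockMeasure _ _ hs]
  rfl

theorem ae_superposition_lt_top (m : ℕ → ℝ≥0) (ν : ℕ → Measure β)
    [∀ k, IsProbabilityMeasure (ν k)] {s : Set β} (hs : MeasurableSet s)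
    (hfin : Measure.sum (fun k => m k • ν k) s < ∞) :
    ∀ᵐ w ∂(sequenceLaw m ν), superposition w s < ∞ := by
  refine ae_lt_top ((Measure.measurable_coe hs).comp measurable_superposition) ?_
  rw [← lintegral_superposition m ν hs] at hfin
  exact hfin.ne

/-- The joint characteristic function of the values of the superposition. -/
theorem integral_cexp_superposition (m : ℕ → ℝ≥0) (ν : ℕ → Measure β)
    [∀ k, IsProbabilityMeasure (ν k)] {ι : Type*} [Fintype ι] {C : ι → Set β}
    (hC : ∀ j, MeasurableSet (C j)) (hfin : ∀ j, Measure.sum (fun k => m k • ν k) (C j) < ∞)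
    (t : ι → ℝ) :
    ∫ w, cexp ((∑ j, t j * (superposition w (C j)).toReal : ℝ) * I) ∂(sequenceLaw m ν)
      = cexp (∫ x, (cexp ((∑ j, t j * (C j).indicator 1 x : ℝ) * I) - 1)
          ∂(Measure.sum fun k => m k • ν k)) := by
  set Λ := Measure.sum fun k => m k • ν k with hΛ
  let f : β → ℝ := fun x => ∑ j, t j * (C j).indicator 1 x
  have hf : Measurable f := Finset.measurable_sum _ fun j _ =>
    (measurable_one.indicator (hC j)).const_mul (t j)
  let g : ℕ × (ℕ → β) → ℝ := fun p => ∑ i ∈ Finset.range p.1, f (p.2 i)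
  have hg : Measurable g := measurable_blockSum hf
  -- A linear combination of block counts is a sum of `f` over the points. The partial products over
  -- blocks are thus explicit, and both sides pass to the limit, the left by dominated convergence.
  have hblock : ∀ p : ℕ × (ℕ → β), g p = ∑ j, t j * (blockMeasure p (C j)).toReal := fun p => by
    have h1 : ∀ j, (blockMeasure p (C j)).toReal
        = ∑ i ∈ Finset.range p.1, (C j).indicator 1 (p.2 i) := fun j => by
      rw [blockMeasure_apply _ (hC j), ENNReal.toReal_sum]
      · refine Finset.sum_congr rfl fun i _ => ?_
        by_cases h : p.2 i ∈ C j <;> simp [h]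
      · intro i _
        by_cases h : p.2 i ∈ C j <;> simp [h]
    simp only [h1, g, f, Finset.mul_sum]
    exact Finset.sum_comm
  have hlim : ∀ᵐ w ∂(sequenceLaw m ν), Tendsto (fun K => ∑ k ∈ Finset.range K, g (w k)) atTop
      (𝓝 (∑ j, t j * (superposition w (C j)).toReal)) := by
    filter_upwards [ae_all_iff.2 fun j => ae_superposition_lt_top m ν (hC j) (hfin j)] with w hw
    have h1 : ∀ j, HasSum (fun k => (blockMeasure (w k) (C j)).toReal)
        (superposition w (C j)).toReal := fun j => by
      have h2 := (hw j).ne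
      rw [superposition_apply _ (hC j)] at h2 ⊢
      rw [ENNReal.tsum_toReal_eq (ENNReal.ne_top_of_tsum_ne_top h2)]
      exact (ENNReal.summable_toReal h2).hasSum
    have h3 : HasSum (fun k => g (w k)) (∑ j, t j * (superposition w (C j)).toReal) := by
      simp only [hblock]
      exact hasSum_sum fun j _ => (h1 j).mul_left (t j)
    exact h3.tendsto_sum_nat
  have hpart : ∀ K, ∫ w, cexp ((∑ k ∈ Finset.range K, g (w k) : ℝ) * I) ∂(sequenceLaw m ν)
      = cexp (∑ k ∈ Finset.range K, ∫ x, (cexp (f x * I) - 1) ∂(m k • ν k)) := fun K => by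
    have h2 : ∀ w : ℕ → ℕ × (ℕ → β), cexp ((∑ k ∈ Finset.range K, g (w k) : ℝ) * I)
        = ∏ k ∈ Finset.range K, cexp (g (w k) * I) := fun w => by
      rw [← Complex.exp_sum, ← Finset.sum_mul]
      push_cast
      rfl
    simp only [h2]
    rw [sequenceLaw, integral_finsetProd_infinitePi (fun k => blockLaw (m k) (ν k))
      (Finset.range K) (f := fun _ p => cexp (g p * I)) (fun _ => by fun_prop), Complex.exp_sum]
    refine Finset.prod_congr rfl fun k _ => ?_
    rw [integral_cexp_blockSum (m k) (ν k) hf]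
    congr 1
    have hint : Integrable (fun x => cexp (f x * I)) (ν k) :=
      Integrable.of_bound (by fun_prop) 1
        (Eventually.of_forall fun p => by rw [Complex.norm_exp_ofReal_mul_I])
    rw [integral_smul_nnreal_measure, integral_sub hint (integrable_const _)]
    simp [NNReal.smul_def]
  -- The integrand is bounded by `2` and vanishes off the union of the `C j`, which has finite mass.
  have hintΛ : Integrable (fun x => cexp (f x * I) - 1) Λ := by
    have hU : MeasurableSet (⋃ j, C j) := MeasurableSet.iUnion hC
    have hUfin : Λ (⋃ j, C j) ≠ ∞ :=
      ((measure_iUnion_fintype_le Λ C).trans_lt (ENNReal.sum_lt_top.2 fun j _ => hfin j)).ne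
    have hind : Integrable ((⋃ j, C j).indicator fun _ => (2 : ℝ)) Λ :=
      (integrable_indicator_iff hU).2 (integrableOn_const hUfin)
    refine hind.mono' (by fun_prop) (Eventually.of_forall fun x => ?_)
    by_cases hx : x ∈ ⋃ j, C j
    · rw [Set.indicator_of_mem hx]
      calc ‖cexp (f x * I) - 1‖ ≤ ‖cexp (f x * I)‖ + ‖(1 : ℂ)‖ := norm_sub_le _ _
        _ = 2 := by rw [Complex.norm_exp_ofReal_mul_I, norm_one]; norm_num
    · have h0 : f x = 0 := Finset.sum_eq_zero fun j _ => by
        rw [Set.indicator_of_notMem fun h => hx (Set.mem_iUnion.2 ⟨j, h⟩), mul_zero]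
      rw [Set.indicator_of_notMem hx, h0]
      simp
  have hsumΛ := (hasSum_integral_measure hintΛ).tendsto_sum_nat
  have hrhs : Tendsto (fun K => cexp (∑ k ∈ Finset.range K, ∫ x, (cexp (f x * I) - 1) ∂(m k • ν k)))
      atTop (𝓝 (cexp (∫ x, (cexp (f x * I) - 1) ∂Λ))) :=
    (Complex.continuous_exp.tendsto _).comp hsumΛ
  have hlhs : Tendsto
      (fun K => ∫ w, cexp ((∑ k ∈ Finset.range K, g (w k) : ℝ) * I) ∂(sequenceLaw m ν)) atTop
      (𝓝 (∫ w, cexp ((∑ j, t j * (superposition w (C j)).toReal : ℝ) * I)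
        ∂(sequenceLaw m ν))) := by
    refine tendsto_integral_of_dominated_convergence (fun _ => 1) (fun K => ?_)
      (integrable_const _) (fun K => Eventually.of_forall fun w => ?_) ?_
    · have h1 : Measurable fun w : ℕ → ℕ × (ℕ → β) => ∑ k ∈ Finset.range K, g (w k) :=
        Finset.measurable_sum _ fun k _ => hg.comp (measurable_pi_apply k)
      have h2 : Measurable fun w : ℕ → ℕ × (ℕ → β) =>
        cexp ((∑ k ∈ Finset.range K, g (w k) : ℝ) * I) := by fun_prop
      exact h2.aestronglyMeasurable
    · rw [Complex.norm_exp_ofReal_mul_I]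
    · filter_upwards [hlim] with w hw
      have hc : Continuous fun r : ℝ => cexp (r * I) := by fun_prop
      exact (hc.tendsto _).comp hw
  simp only [hpart] at hlhs
  exact tendsto_nhds_unique hlhs hrhs

/-- If the superposition is finite on a set then it takes an integer value there. -/
theorem exists_nat_eq_superposition (w : ℕ → ℕ × (ℕ → β)) {s : Set β} (hs : MeasurableSet s)
    (hfin : superposition w s < ∞) : ∃ n : ℕ, superposition w s = n := by
  have hb : ∀ k, ∃ n : ℕ, blockMeasure (w k) s = n := fun k => by
    classical
    refine ⟨∑ i ∈ Finset.range (w k).1, if (w k).2 i ∈ s then 1 else 0, ?_⟩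
    rw [blockMeasure_apply _ hs, Nat.cast_sum]
    refine Finset.sum_congr rfl fun i _ => ?_
    by_cases h : (w k).2 i ∈ s <;> simp [h]
  choose n hn using hb
  rw [superposition_apply _ hs] at hfin ⊢
  simp only [hn] at hfin ⊢
  -- A convergent series of naturals has only finitely many terms at least `1`.
  have hfs := ENNReal.finite_const_le_of_tsum_ne_top hfin.ne one_ne_zero
  refine ⟨∑ k ∈ hfs.toFinset, n k, ?_⟩
  rw [Nat.cast_sum, tsum_eq_sum]
  intro k hk
  rw [Set.Finite.mem_toFinset, Set.mem_ofPred_eq, not_le] at hk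
  have : n k < 1 := by exact_mod_cast hk
  simp [Nat.lt_one_iff.1 this]

end PoissonConstruction

/-! ### The Poisson law on locally finite measures -/

section PoissonLaw

open Complex Filter Topology

variable {d : ℕ}

theorem exists_probability_smul_eq {β : Type*} [MeasurableSpace β] [Nonempty β] (μ : Measure β)
    [IsFiniteMeasure μ] : ∃ ν : Measure β, IsProbabilityMeasure ν ∧
      (μ Set.univ).toNNReal • ν = μ := by
  rcases eq_or_ne μ 0 with rfl | h
  -- The zero measure gets weight `0`, so any probability measure serves.
  · exact ⟨Measure.dirac (Classical.arbitrary β), inferInstance, by simp⟩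
  · have : NeZero μ := ⟨h⟩
    have h0 : μ Set.univ ≠ 0 := Measure.measure_univ_ne_zero.2 h
    refine ⟨(μ Set.univ)⁻¹ • μ, inferInstance, ?_⟩
    ext s hs
    rw [Measure.smul_apply, Measure.smul_apply, ENNReal.smul_def, smul_eq_mul, smul_eq_mul,
      ENNReal.coe_toNNReal (measure_ne_top _ _), ← mul_assoc,
      ENNReal.mul_inv_cancel h0 (measure_ne_top _ _), one_mul]

/-- A locally finite measure with integer values on the finite unions of basic open sets has integer
values on compact sets. -/
theorem exists_nat_eq_of_countableBasis (μ : Measure (Rd d)) [IsLocallyFiniteMeasure μ]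
    (h : ∀ F : Set (Set (Rd d)), F.Finite ∧ F ⊆ TopologicalSpace.countableBasis (Rd d) →
      μ (⋃₀ F) = ∞ ∨ ∃ n : ℕ, μ (⋃₀ F) = n) {K : Set (Rd d)} (hK : IsCompact K) :
    ∃ n : ℕ, μ K = n := by
  have hKf : μ K ≠ ∞ := hK.measure_lt_top.ne
  refine ⟨⌊(μ K).toReal⌋₊, ?_⟩
  set n := ⌊(μ K).toReal⌋₊ with hn
  have h1 : μ K < (n + 1 : ℕ) := by
    rw [← ENNReal.ofReal_toReal hKf, ← ENNReal.ofReal_natCast]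
    refine (ENNReal.ofReal_lt_ofReal_iff (by positivity)).2 ?_
    push_cast
    exact Nat.lt_floor_add_one _
  have h2 : (n : ℝ≥0∞) ≤ μ K := by
    rw [← ENNReal.ofReal_toReal hKf, ← ENNReal.ofReal_natCast]
    exact ENNReal.ofReal_le_ofReal (Nat.floor_le ENNReal.toReal_nonneg)
  -- With `n` the integer part of the mass of `K`, outer regularity gives an open `V` of mass below
  -- `n + 1`. A finite union of basic sets between `K` and `V` has integer mass, hence mass at most
  -- `n`.
  obtain ⟨V, hKV, hVo, hV⟩ := hK.exists_isOpen_lt_of_lt _ h1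
  obtain ⟨F, hF, hFf, hKF⟩ := hK.elim_finite_subcover_image
    (b := {s ∈ TopologicalSpace.countableBasis (Rd d) | s ⊆ V}) (c := id)
    (fun s hs => (TopologicalSpace.isBasis_countableBasis (Rd d)).isOpen hs.1) (by
      intro x hx
      obtain ⟨s, hs, hxs, hsV⟩ := (TopologicalSpace.isBasis_countableBasis
        (Rd d)).exists_subset_of_mem_open (hKV hx) hVo
      exact Set.mem_biUnion (show s ∈ {s ∈ TopologicalSpace.countableBasis (Rd d) | s ⊆ V} from
        ⟨hs, hsV⟩) hxs)
  simp only [id, ← Set.sUnion_eq_biUnion] at hKF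
  have h3 : μ (⋃₀ F) ≤ μ V := measure_mono (Set.sUnion_subset fun s hs => (hF hs).2)
  rcases h F ⟨hFf, fun s hs => (hF hs).1⟩ with h4 | ⟨k, h4⟩
  · exact absurd (h4 ▸ h3) (not_le.2 (hV.trans_le le_top))
  · have h5 : k < n + 1 := by exact_mod_cast (h4 ▸ h3).trans_lt hV
    refine le_antisymm ?_ h2
    calc μ K ≤ (k : ℝ≥0∞) := h4 ▸ measure_mono hKF
      _ ≤ (n : ℝ≥0∞) := by exact_mod_cast Nat.lt_succ_iff.1 h5

/-- Existence of a Poisson process, as a law on locally finite measures, characterized by its joint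
characteristic functions. -/
theorem exists_poisson_law (d : ℕ) (c : ℝ≥0) :
    ∃ Q : Measure (LocFin d), IsProbabilityMeasure Q ∧
      (∀ C : Set (Rd d), MeasurableSet C → volume C < ∞ → ∀ᵐ μ ∂Q, μ.1 C < ∞) ∧
      (∀ᵐ μ ∂Q, ∀ K : Set (Rd d), IsCompact K → ∃ n : ℕ, μ.1 K = (n : ℝ≥0∞)) ∧
      ∀ {ι : Type} [Fintype ι] (C : ι → Set (Rd d)), (∀ j, MeasurableSet (C j)) →
        (∀ j, volume (C j) < ∞) → ∀ t : ι → ℝ,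
        ∫ μ, cexp ((∑ j, t j * (μ.1 (C j)).toReal : ℝ) * I) ∂Q
          = cexp (∫ x, (cexp ((∑ j, t j * (C j).indicator 1 x : ℝ) * I) - 1)
            ∂(c • (volume : Measure (Rd d)))) := by
  have hfin : ∀ k, IsFiniteMeasure ((c • (volume : Measure (Rd d))).restrict (shell d k)) :=
    fun k => ⟨by
      rw [Measure.restrict_apply_univ]
      exact measure_shell_lt_top _ k⟩
  choose ν hν hνeq using fun k =>
    exists_probability_smul_eq ((c • (volume : Measure (Rd d))).restrict (shell d k))
  let m : ℕ → ℝ≥0 := fun k =>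
    (((c • (volume : Measure (Rd d))).restrict (shell d k)) Set.univ).toNNReal
  have hΛ : Measure.sum (fun k => m k • ν k) = c • (volume : Measure (Rd d)) := by
    rw [← sum_restrict_shell (c • (volume : Measure (Rd d)))]
    congr 1
    funext k
    exact hνeq k
  have hvol : ∀ {C : Set (Rd d)}, volume C < ∞ → Measure.sum (fun k => m k • ν k) C < ∞ := by
    intro C hC
    rw [hΛ, Measure.smul_apply, ENNReal.smul_def, smul_eq_mul]
    exact ENNReal.mul_lt_top ENNReal.coe_lt_top hC
  let X : (ℕ → ℕ × (ℕ → Rd d)) → LocFin d := fun w => truncate (superposition w)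
  have hX : Measurable X := measurable_truncate.comp measurable_superposition
  have hXeq : ∀ᵐ w ∂(sequenceLaw m ν), (X w).1 = superposition w := by
    filter_upwards [ae_all_iff.2 fun n : ℕ => ae_superposition_lt_top m ν
      (measurableSet_closedBall (x := (0 : Rd d)) (ε := n))
      (hvol Metric.isBounded_closedBall.measure_lt_top)] with w hw
    exact truncate_of_isLocallyFinite (isLocallyFiniteMeasure_of_forall_closedBall hw)
  have hcoe : ∀ {C : Set (Rd d)}, MeasurableSet C → Measurable fun μ : LocFin d => μ.1 C :=
    fun hC => (Measure.measurable_coe hC).comp measurable_subtype_coe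
  refine ⟨(sequenceLaw m ν).map X, Measure.isProbabilityMeasure_map hX.aemeasurable, ?_, ?_,
    fun {ι} _ C hC hCv t => ?_⟩
  · intro C hC hCv
    refine (ae_map_iff hX.aemeasurable (hcoe hC measurableSet_Iio)).2 ?_
    filter_upwards [hXeq, ae_superposition_lt_top m ν hC (hvol hCv)] with w h1 h2
    rw [h1]
    exact h2
  -- Integrality must hold for all compact sets outside a single null set; it is enough to have it
  -- on this countable family.
  · let 𝓕 : Set (Set (Set (Rd d))) :=
      {F | F.Finite ∧ F ⊆ TopologicalSpace.countableBasis (Rd d)}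
    have h𝓕 : 𝓕.Countable :=
      Set.countable_ofPred_finite_subset (TopologicalSpace.countable_countableBasis (Rd d))
    have hopen : ∀ F ∈ 𝓕, MeasurableSet (⋃₀ F) := fun F hF =>
      (isOpen_sUnion fun s hs =>
        (TopologicalSpace.isBasis_countableBasis (Rd d)).isOpen (hF.2 hs)).measurableSet
    have hmem : ∀ᵐ μ ∂((sequenceLaw m ν).map X), ∀ F ∈ 𝓕,
        μ.1 (⋃₀ F) = ∞ ∨ ∃ n : ℕ, μ.1 (⋃₀ F) = (n : ℝ≥0∞) := by
      refine (ae_ball_iff h𝓕).2 fun F hF => ?_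
      have hs : MeasurableSet ({∞} ∪ Set.range fun n : ℕ => (n : ℝ≥0∞)) :=
        (measurableSet_singleton _).union (Set.countable_range _).measurableSet
      have hset : ∀ a : ℝ≥0∞, a ∈ ({∞} ∪ Set.range fun n : ℕ => (n : ℝ≥0∞)) ↔
          (a = ∞ ∨ ∃ n : ℕ, a = n) := fun a =>
        or_congr Iff.rfl (exists_congr fun n => eq_comm)
      simp only [← hset]
      refine (ae_map_iff hX.aemeasurable (hcoe (hopen F hF) hs)).2 ?_
      filter_upwards [hXeq] with w hw
      rw [hset, hw]
      exact or_iff_not_imp_left.2 fun h =>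
        exists_nat_eq_superposition w (hopen F hF) (lt_top_iff_ne_top.2 h)
    filter_upwards [hmem] with μ hμ K hK
    have := μ.2
    exact exists_nat_eq_of_countableBasis μ.1 hμ hK
  · have hm : Measurable fun μ : LocFin d =>
        cexp ((∑ j, t j * (μ.1 (C j)).toReal : ℝ) * I) := by
      have : Measurable fun μ : LocFin d => ∑ j, t j * (μ.1 (C j)).toReal :=
        Finset.measurable_sum _ fun j _ => (hcoe (hC j)).ennreal_toReal.const_mul (t j)
      fun_prop
    rw [integral_map hX.aemeasurable hm.aestronglyMeasurable, ← hΛ,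
      ← integral_cexp_superposition m ν hC (fun j => hvol (hCv j)) t]
    refine integral_congr_ae ?_
    filter_upwards [hXeq] with w hw
    rw [hw]

end PoissonLaw

/-! ### Characteristic functions and the product extension -/

section PoissonExtension

open Complex Filter Topology

variable {d : ℕ}

theorem measurable_locFin_apply {C : Set (Rd d)} (hC : MeasurableSet C) :
    Measurable fun μ : LocFin d => μ.1 C :=
  (Measure.measurable_coe hC).comp measurable_subtype_coe

/-- The family of values of a locally finite measure on the sets of finite volume. -/
noncomputable def finiteVolumeValues (d : ℕ) (μ : LocFin d) :
    {C : Set (Rd d) // MeasurableSet C ∧ volume C < ∞} → ℝ :=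
  fun C => (μ.1 C.1).toReal

theorem measurable_finiteVolumeValues : Measurable (finiteVolumeValues d) :=
  measurable_pi_lambda _ fun C => (measurable_locFin_apply C.2.1).ennreal_toReal

/-- The mass of any Borel set is the supremum of the masses of its intersections with balls. These
are finite by local finiteness, so their real values lose nothing. -/
theorem le_comap_finiteVolumeValues :
    (inferInstance : MeasurableSpace (LocFin d)) ≤
      MeasurableSpace.comap (finiteVolumeValues d) inferInstance := by
  have h : @Measurable _ _ (MeasurableSpace.comap (finiteVolumeValues d) inferInstance) _
      (Subtype.val : LocFin d → Measure (Rd d)) := by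
    let _ : MeasurableSpace (LocFin d) :=
      MeasurableSpace.comap (finiteVolumeValues d) inferInstance
    have hΦ : Measurable (finiteVolumeValues d) := comap_measurable _
    refine Measure.measurable_of_measurable_coe _ fun C hC => ?_
    have hsup : ∀ μ : LocFin d, μ.1 C = ⨆ n : ℕ, ENNReal.ofReal (finiteVolumeValues d μ
        ⟨C ∩ Metric.closedBall 0 n, hC.inter measurableSet_closedBall,
          (measure_mono Set.inter_subset_right).trans_lt
            Metric.isBounded_closedBall.measure_lt_top⟩) := by
      intro μ
      have := μ.2
      have hmono : Monotone fun n : ℕ => C ∩ Metric.closedBall (0 : Rd d) n := fun a b hab =>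
        Set.inter_subset_inter_right _ (Metric.closedBall_subset_closedBall (by exact_mod_cast hab))
      have hU : ⋃ n : ℕ, C ∩ Metric.closedBall (0 : Rd d) n = C := by
        rw [← Set.inter_iUnion, Metric.iUnion_closedBall_nat, Set.inter_univ]
      conv_lhs => rw [← hU, hmono.measure_iUnion]
      refine iSup_congr fun n => (ENNReal.ofReal_toReal ?_).symm
      exact ((measure_mono Set.inter_subset_right).trans_lt
        (isCompact_closedBall (0 : Rd d) n).measure_lt_top).ne
    simp only [hsup]
    exact Measurable.iSup fun n => ((measurable_pi_apply _).comp hΦ).ennreal_ofReal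
  exact h.comap_le

/-- Laws on locally finite measures are determined by their joint characteristic functions on sets
of finite volume. -/
theorem locFin_measure_ext {Q Q' : Measure (LocFin d)} [IsProbabilityMeasure Q]
    [IsProbabilityMeasure Q']
    (h : ∀ {ι : Type} [Fintype ι] (C : ι → Set (Rd d)), (∀ j, MeasurableSet (C j)) →
      (∀ j, volume (C j) < ∞) → ∀ t : ι → ℝ,
      ∫ μ, cexp ((∑ j, t j * (μ.1 (C j)).toReal : ℝ) * I) ∂Q
        = ∫ μ, cexp ((∑ j, t j * (μ.1 (C j)).toReal : ℝ) * I) ∂Q') : Q = Q' := by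
  have hΦ := measurable_finiteVolumeValues (d := d)
  have hp : IsProbabilityMeasure (Q.map (finiteVolumeValues d)) :=
    Measure.isProbabilityMeasure_map hΦ.aemeasurable
  have hp' : IsProbabilityMeasure (Q'.map (finiteVolumeValues d)) :=
    Measure.isProbabilityMeasure_map hΦ.aemeasurable
  have hmap : Q.map (finiteVolumeValues d) = Q'.map (finiteVolumeValues d) := by
    -- Finite-dimensional marginals determine the law on the product space, and each marginal is
    -- determined by its characteristic function. Linear functionals in coordinates are the
    -- combinations in `h`.
    refine IsProjectiveLimit.unique
      (P := fun J => (Q'.map (finiteVolumeValues d)).map J.restrict) (fun J => ?_) fun J => rfl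
    have hJ := Finset.measurable_restrict (X := fun _ : {C : Set (Rd d) //
      MeasurableSet C ∧ volume C < ∞} => ℝ) J
    refine Measure.ext_of_charFunDual (funext fun L => ?_)
    have hL : ∀ x : J → ℝ, L x = ∑ j, L (Pi.single j 1) * x j := fun x => by
      refine (LinearMap.pi_apply_eq_sum_univ L.toLinearMap x).trans
        (Finset.sum_congr rfl fun j _ => ?_)
      rw [smul_eq_mul, mul_comm]
      refine congrArg (fun v : J → ℝ => L v * x j) (funext fun i => ?_)
      simp [Pi.single_apply, eq_comm]
    beta_reduce
    rw [charFunDual_apply, charFunDual_apply, Measure.map_map hJ hΦ, Measure.map_map hJ hΦ,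
      integral_map (hJ.comp hΦ).aemeasurable (by fun_prop),
      integral_map (hJ.comp hΦ).aemeasurable (by fun_prop)]
    have hexp : ∀ μ : LocFin d, cexp (L ((J.restrict ∘ finiteVolumeValues d) μ) * I)
        = cexp ((∑ j : J, L (Pi.single j 1) * (μ.1 j.1.1).toReal : ℝ) * I) := fun μ => by
      rw [hL]
      rfl
    refine (integral_congr_ae (Eventually.of_forall hexp)).trans (Eq.trans ?_
      (integral_congr_ae (Eventually.of_forall hexp)).symm)
    exact h (fun j : J => j.1.1) (fun j => j.1.2.1) (fun j => j.1.2.2) fun j => L (Pi.single j 1)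
  ext A hA
  obtain ⟨B, hB, rfl⟩ := le_comap_finiteVolumeValues A hA
  rw [← Measure.map_apply hΦ hB, ← Measure.map_apply hΦ hB, hmap]

/-- On disjoint sets at most one indicator is nonzero, so the exponent splits as a sum. After
exponentiation this is a product of Poisson characteristic functions, which gives both the marginals
and independence. -/
theorem integral_cexp_sum_indicator_sub_one {ι : Type*} [Fintype ι] (Λ : Measure (Rd d))
    {C : ι → Set (Rd d)} (hC : ∀ j, MeasurableSet (C j)) (hfin : ∀ j, Λ (C j) < ∞)
    (hdisj : Pairwise fun i j => Disjoint (C i) (C j)) (t : ι → ℝ) :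
    ∫ x, (cexp ((∑ j, t j * (C j).indicator 1 x : ℝ) * I) - 1) ∂Λ
      = ∑ j, Λ.real (C j) * (cexp (t j * I) - 1) := by
  have hpt : ∀ x, cexp ((∑ j, t j * (C j).indicator 1 x : ℝ) * I) - 1
      = ∑ j, (C j).indicator (fun _ => cexp (t j * I) - 1) x := by
    intro x
    by_cases hx : ∃ j, x ∈ C j
    · obtain ⟨j, hj⟩ := hx
      have hne : ∀ i, i ≠ j → x ∉ C i := fun i hi hxi => (hdisj hi).le_bot ⟨hxi, hj⟩
      rw [Finset.sum_eq_single j (fun i _ hi => by simp [hne i hi]) (by simp),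
        Finset.sum_eq_single j (fun i _ hi => by simp [hne i hi]) (by simp)]
      simp [hj]
    · have hne : ∀ i, x ∉ C i := fun i hi => hx ⟨i, hi⟩
      simp [hne]
  simp only [hpt]
  rw [integral_finsetSum _ fun j _ =>
    (integrable_indicator_iff (hC j)).2 (integrableOn_const (hfin j).ne)]
  refine Finset.sum_congr rfl fun j _ => ?_
  rw [integral_indicator_const _ (hC j), Complex.real_smul]

/-- A law on locally finite measures with integer values and with the joint characteristic functions
of a Poisson process makes the identity a Poisson process. -/
theorem isPoissonProcess_of_characteristic {c : ℝ≥0} {Q : Measure (LocFin d)}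
    [IsProbabilityMeasure Q]
    (hlt : ∀ C : Set (Rd d), MeasurableSet C → volume C < ∞ → ∀ᵐ μ ∂Q, μ.1 C < ∞)
    (hnat : ∀ᵐ μ ∂Q, ∀ K : Set (Rd d), IsCompact K → ∃ n : ℕ, μ.1 K = (n : ℝ≥0∞))
    (hchar : ∀ {ι : Type} [Fintype ι] (C : ι → Set (Rd d)), (∀ j, MeasurableSet (C j)) →
        (∀ j, volume (C j) < ∞) → ∀ t : ι → ℝ,
        ∫ μ, cexp ((∑ j, t j * (μ.1 (C j)).toReal : ℝ) * I) ∂Q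
          = cexp (∫ x, (cexp ((∑ j, t j * (C j).indicator 1 x : ℝ) * I) - 1)
            ∂(c • (volume : Measure (Rd d))))) :
    IsPoissonProcess Q c fun μ : LocFin d => μ.1 := by
  have hΛ : ∀ C : Set (Rd d), volume C < ∞ → (c • (volume : Measure (Rd d))) C < ∞ := by
    intro C hC
    rw [Measure.smul_apply, ENNReal.smul_def, smul_eq_mul]
    exact ENNReal.mul_lt_top ENNReal.coe_lt_top hC
  have hreal : ∀ C : Set (Rd d), (((c • (volume : Measure (Rd d))).real C : ℝ) : ℂ)
      = ((c * (volume C).toNNReal : ℝ≥0) : ℂ) := by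
    intro C
    rw [Measure.real, Measure.smul_apply, ENNReal.smul_def, smul_eq_mul, ENNReal.toReal_mul]
    rfl
  have hmeas : ∀ {C : Set (Rd d)}, MeasurableSet C →
      Measurable fun μ : LocFin d => (μ.1 C).toReal := fun hC =>
    (measurable_locFin_apply hC).ennreal_toReal
  have hone : ∀ C : Set (Rd d), MeasurableSet C → volume C < ∞ → ∀ t : ℝ,
      charFun (Q.map fun μ => (μ.1 C).toReal) t
        = cexp ((c * (volume C).toNNReal : ℝ≥0) * (cexp (t * I) - 1)) := by
    intro C hC hCv t
    have h := hchar (fun _ : Unit => C) (fun _ => hC) (fun _ => hCv) fun _ => t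
    rw [integral_cexp_sum_indicator_sub_one _ (fun _ => hC) (fun _ => hΛ C hCv)
      (fun i j hij => absurd (Subsingleton.elim i j) hij)] at h
    rw [charFun_apply_real, integral_map (hmeas hC).aemeasurable (by fun_prop)]
    simp only [Finset.univ_unique, Finset.sum_singleton, ofReal_mul, hreal] at h
    exact h
  have hofReal : ∀ C : Set (Rd d), MeasurableSet C → volume C < ∞ →
      (fun μ : LocFin d => ENNReal.ofReal (μ.1 C).toReal) =ᵐ[Q] fun μ => μ.1 C := by
    intro C hC hCv
    filter_upwards [hlt C hC hCv] with μ hμ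
    exact ENNReal.ofReal_toReal hμ.ne
  refine ⟨⟨⟨measurable_subtype_coe, Eventually.of_forall fun μ K hK => ?_⟩, hnat⟩, ?_, ?_⟩
  · have := μ.2
    exact hK.measure_lt_top
  · intro B hB hBv
    have hlaw : (Q.map fun μ => (μ.1 B).toReal) =
        (poissonMeasure (c * (volume B).toNNReal)).map (fun n : ℕ => (n : ℝ)) := by
      have : IsProbabilityMeasure (Q.map fun μ => (μ.1 B).toReal) :=
        Measure.isProbabilityMeasure_map (hmeas hB).aemeasurable
      refine Measure.ext_of_charFun (funext fun t => ?_)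
      rw [hone B hB hBv t]
      exact (charFun_map_cast_poissonMeasure _ t).symm
    -- Characteristic functions concern real values; the extended values agree with them off a null
    -- set.
    rw [← Measure.map_congr (hofReal B hB hBv)]
    have := congrArg (Measure.map ENNReal.ofReal) hlaw
    rw [Measure.map_map ENNReal.measurable_ofReal (hmeas hB),
      Measure.map_map ENNReal.measurable_ofReal .of_discrete] at this
    refine this.trans ?_
    congr 1
    funext n
    exact ENNReal.ofReal_natCast n
  · intro n B hB hBv hdisj
    have hind : iIndepFun (fun i (μ : LocFin d) => (μ.1 (B i)).toReal) Q := by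
      refine (iIndepFun_iff_charFun_pi fun i => (hmeas (hB i)).aemeasurable).2 fun t => ?_
      have hm : Measurable fun μ : LocFin d => WithLp.toLp 2 fun i => (μ.1 (B i)).toReal :=
        (WithLp.measurable_toLp 2 _).comp (measurable_pi_lambda _ fun i => hmeas (hB i))
      have h := hchar B hB hBv fun i => t i
      rw [integral_cexp_sum_indicator_sub_one _ hB (fun i => hΛ _ (hBv i)) hdisj,
        Complex.exp_sum] at h
      rw [charFun_apply, integral_map hm.aemeasurable (by fun_prop)]
      simp only [hone _ (hB _) (hBv _), ← hreal]
      rw [← h]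
      refine integral_congr_ae (Eventually.of_forall fun μ => ?_)
      simp [PiLp.inner_apply]
    have h := hind.comp (fun _ => ENNReal.ofReal) fun _ => ENNReal.measurable_ofReal
    exact h.congr fun i => hofReal (B i) (hB i) (hBv i)

/-- A law with the joint characteristic functions of a stationary Poisson process is translation
invariant. -/
theorem locFinFlow_preserves_of_characteristic {c : ℝ≥0} {Q : Measure (LocFin d)}
    [IsProbabilityMeasure Q]
    (hchar : ∀ {ι : Type} [Fintype ι] (C : ι → Set (Rd d)), (∀ j, MeasurableSet (C j)) →
        (∀ j, volume (C j) < ∞) → ∀ t : ι → ℝ,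
        ∫ μ, cexp ((∑ j, t j * (μ.1 (C j)).toReal : ℝ) * I) ∂Q
          = cexp (∫ x, (cexp ((∑ j, t j * (C j).indicator 1 x : ℝ) * I) - 1)
            ∂(c • (volume : Measure (Rd d))))) :
    (locFinFlow d).Preserves Q := by
  intro x
  have hs : Measurable ((locFinFlow d).shift x) := (locFinFlow d).measurable_shift_right x
  have : IsProbabilityMeasure (Q.map ((locFinFlow d).shift x)) :=
    Measure.isProbabilityMeasure_map hs.aemeasurable
  refine ⟨hs, locFin_measure_ext fun {ι} _ C hC hCv t => ?_⟩
  have hm : Measurable fun μ : LocFin d => cexp ((∑ j, t j * (μ.1 (C j)).toReal : ℝ) * I) := by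
    have : Measurable fun μ : LocFin d => ∑ j, t j * (μ.1 (C j)).toReal :=
      Finset.measurable_sum _ fun j _ =>
        (measurable_locFin_apply (hC j)).ennreal_toReal.const_mul (t j)
    fun_prop
  have hpre : MeasurePreserving (fun y : Rd d => y - x) volume volume :=
    measurePreserving_sub_right volume x
  have hpreΛ : MeasurePreserving (fun y : Rd d => y - x) (c • volume) (c • volume) :=
    hpre.smul_measure c
  rw [integral_map hs.aemeasurable hm.aestronglyMeasurable, hchar C hC hCv t]
  simp only [locFinFlow_shift, translate_apply _ _ (hC _)]
  rw [hchar (fun j => (fun y => y - x) ⁻¹' C j) (fun j => hpre.measurable (hC j))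
    (fun j => by rw [hpre.measure_preimage (hC j).nullMeasurableSet]; exact hCv j) t]
  congr 1
  -- Translating the measure replaces the sets by their preimages, and the exponent is unchanged
  -- because Lebesgue measure is translation invariant.
  exact hpreΛ.integral_comp (MeasurableEquiv.subRight x).measurableEmbedding
    fun y => cexp ((∑ j, t j * (C j).indicator 1 y : ℝ) * I) - 1

theorem IsPoissonProcess.comp_measurePreserving {Ω Ω' : Type*} [MeasurableSpace Ω]
    [MeasurableSpace Ω'] {P : Measure Ω} {P' : Measure Ω'} {c : ℝ≥0} {χ : Ω → Measure (Rd d)}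
    (h : IsPoissonProcess P c χ) {π : Ω' → Ω} (hπ : MeasurePreserving π P' P) :
    IsPoissonProcess P' c fun ω => χ (π ω) where
  measurable := h.measurable.comp hπ.measurable
  finite_on_compacts := hπ.quasiMeasurePreserving.ae h.finite_on_compacts
  nat_on_compacts := hπ.quasiMeasurePreserving.ae h.nat_on_compacts
  law B hB hBv := by
    rw [← h.law B hB hBv]
    conv_rhs => rw [← hπ.map_eq]
    exact (Measure.map_map ((Measure.measurable_coe hB).comp h.measurable) hπ.measurable).symm
  indep n B hB hBv hdisj := by
    have hm : ∀ i, Measurable fun ω => χ ω (B i) := fun i =>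
      (Measure.measurable_coe (hB i)).comp h.measurable
    refine iIndepFun_iff_measure_inter_preimage_eq_mul.2 fun S sets hsets => ?_
    have hi := iIndepFun_iff_measure_inter_preimage_eq_mul.1 (h.indep n B hB hBv hdisj) S hsets
    rw [← hπ.measure_preimage (S.measurableSet_biInter fun i hi =>
      hm i (hsets i hi)).nullMeasurableSet] at hi
    rw [Set.preimage_iInter₂] at hi
    refine hi.trans (Finset.prod_congr rfl fun i hi => ?_)
    exact (hπ.measure_preimage (hm i (hsets i hi)).nullMeasurableSet).symm

/-- Every stationary probability space has an extension supporting an independent stationary Poisson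
process. -/
theorem exists_isPoissonExtension {Ω : Type*} [MeasurableSpace Ω] {P : Measure Ω}
    [IsProbabilityMeasure P] {θ : MeasurableFlow d Ω} (hP : θ.Preserves P)
    {ξ η : Ω → Measure (Rd d)} (hξ : Measurable ξ) (hη : Measurable η) (c : ℝ≥0) :
    ∃ (P' : Measure (Ω × LocFin d)),
      IsPoissonExtension θ P ξ η c (θ.prod (locFinFlow d)) P' Prod.fst fun p => p.2.1 := by
  obtain ⟨Q, hQ, hlt, hnat, hchar⟩ := exists_poisson_law d c
  refine ⟨P.prod Q, inferInstance, fun x => ?_, measurePreserving_fst, fun _ _ => rfl, ?_, ?_, ?_⟩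
  · exact (hP x).prod (locFinFlow_preserves_of_characteristic hchar x)
  · exact (isPoissonProcess_of_characteristic hlt hnat hchar).comp_measurePreserving
      measurePreserving_snd
  · refine Eventually.of_forall fun p x C hC => ?_
    change translate x p.2.1 _ = _
    have hCx : MeasurableSet ((fun y : Rd d => y + x) ⁻¹' C) := measurable_add_const x hC
    rw [translate_apply _ _ hCx, ← Set.preimage_comp]
    congr 1
    ext y
    simp
  · exact (indepFun_prod (hξ.prodMk hη) measurable_subtype_coe).symm

end PoissonExtension

end DiffuseTransport

theorem corollary2 {d : ℕ} (hd : 1 ≤ d)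
    {Ω : Type u} [MeasurableSpace Ω] (P : Measure Ω) [IsProbabilityMeasure P]
    (θ : MeasurableFlow d Ω) (hP : θ.Preserves P)
    (ξ η : Ω → Measure (Rd d))
    (hξ : IsRandomMeasure P ξ) (hη : IsRandomMeasure P η)
    (hξs : IsStationaryRM θ P ξ) (hηs : IsStationaryRM θ P η)
    (herg : JointlyErgodic P ξ η)
    (hdiff : IsDiffuse P ξ)
    (hpos : 0 < intensity P ξ) (heq : intensity P ξ = intensity P η)
    (hfin : intensity P η < ∞)
    (c : ℝ≥0) (hc : 0 < c) :
    -- such an extension exists, ...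
    (∃ (Ω' : Type u) (_ : MeasurableSpace Ω') (θ' : MeasurableFlow d Ω') (P' : Measure Ω')
        (π : Ω' → Ω) (χ : Ω' → Measure (Rd d)),
        IsPoissonExtension θ P ξ η c θ' P' π χ) ∧
    -- ... and on every such extension there is an allocation balancing `ξ` and `η`
    ∀ (Ω' : Type v) [MeasurableSpace Ω'] (θ' : MeasurableFlow d Ω') (P' : Measure Ω')
      (π : Ω' → Ω) (χ : Ω' → Measure (Rd d)),
      IsPoissonExtension θ P ξ η c θ' P' π χ →
        ∃ τ : Ω' × Rd d → OnePoint (Rd d),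
          IsAllocation θ' P' τ ∧ Balances P' τ (ξ ∘ π) (η ∘ π) := by
  refine ⟨?_, fun Ω' _ θ' P' π χ h =>
    exists_balancing_allocation hd h hξ hη hξs hηs herg hdiff heq hfin hc⟩
  obtain ⟨P', hP'⟩ := exists_isPoissonExtension hP hξ.measurable hη.measurable c
  exact ⟨_, _, _, P', _, _, hP'⟩
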